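/- Let $\mathcal H$ be a complex Hilbert space (inner products linear in the second argument) and let $\mathcal P=\{q\in\mathcal B(\mathcal H): q^2=q,\ \operatorname{rank} q=1\}\subset\mathcal B(\mathcal H)\setminus\{0\}$ be the set of all (not necessarily Hermitian) rank-one projections, with tangent spaces $T_q\mathcal P=\{A\in\mathcal B(\mathcal H): qA+Aq=A\}$. Identify $T^*\mathbb P\mathcal H$ with $\mathcal P$: writing points of $\mathbb P\mathcal H$ as rank-one Hermitian projections $p$, with $T_p\mathbb P\mathcal H=\{A: pA+Ap=A=A^*\}$, the projection $q$ corresponds to the covector $A\mapsto\operatorname{Re}\operatorname{Tr}((q-p)A)$ at the orthogonal projection $p$ onto the image of $q$; this is a bijection $\mathcal P\to T^*\mathbb P\mathcal H$. Let $\|q\|=\sqrt{\operatorname{Tr}(q^*q)}$ be the Hilbert–Schmidt norm; for $q\in\mathcal P$ it equals the trace-class norm $\operatorname{Tr}\sqrt{q^*q}$. For $A,B\in T_q\mathcal P$ put $$\mathbf h(A,B)=\frac{1}{\|q\|}\operatorname{Tr}(A^*B)-\frac{1}{2\|q\|^3}\operatorname{Tr}(A^*q)\operatorname{Tr}(Bq^*),\qquad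 IA=iA,\qquad \Omega(A,B)=i\operatorname{Tr}(q[A,B]),$$ $$\mathbf JA=\frac{i}{\|q\|}[q,A^*]-\frac{i}{2\|q\|^3}\operatorname{Tr}(A^*q)[q,q^*],\qquad JA=i[A,q],$$ and $g=\operatorname{Re}\mathbf h$. Then: (1) $(g,I,\mathbf J)$ is a hyperkähler structure on $\mathcal P$: $g$ is a Riemannian metric, $I$ and $\mathbf J$ are almost complex structures with $I\mathbf J=-\mathbf JI$ (and $\mathbf J^2=-1$), and $g(I\cdot,\cdot)$, $g(\mathbf J\cdot,\cdot)$, $g(I\mathbf J\cdot,\cdot)$ are closed 2-forms; moreover $I$ and $\mathbf J$ are integrable. (2) $q\mapsto\|q\|$ is a Kähler potential for $g$ with respect to $I$, that is, $g(I\cdot,\cdot)=i\,\partial\bar\partial\,\|q\|$ on $\mathcal P$. (3) $\Omega$ is an $I$-holomorphic symplectic form, and for $A\in T_q\mathcal P$ the vector $\mathbf JA$ is the unique element of $T_q\mathcal P$ with $\mathbf h(\mathbf JA,B)=\Omega(A,B)$ for all $B\in T_q\mathcal P$. (4) $J$ is an integrable almost complex structure that commutes with $I$ and satisfies $\Omega(JA,JB)=\Omega(A,B)$.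 -/

import Mathlib

open scoped ContDiff InnerProductSpace ComplexConjugate

universe u v

noncomputable section

/-! ### Geometry on an embedded submanifold

`S` is a subset of a normed space `F` and `T q` is the tangent space at `q ∈ S`, a subspace of `F`.
Tensor fields are functions of the base point and of tangent vectors; only their values at
`q ∈ S` and at vectors of `T q` matter. -/

namespace EmbGeom

section Real

variable {F : Type u} [NormedAddCommGroup F] [NormedSpace ℝ F]

/-- `ψ : V → S` is a local parametrization (the inverse of a chart) of the embedded submanifold
`S` with tangent spaces `T`: it is smooth on the open set `V`, it maps `V` onto a relatively open
subset `S ∩ U` of `S`, its inverse is the restriction of a smooth map defined on `U`, and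
its differential at `x` maps onto the tangent space at `ψ x`. -/
structure IsLocalParam (S : Set F) (T : F → Submodule ℝ F)
    {E : Type u} [NormedAddCommGroup E] [NormedSpace ℝ E] (V : Set E) (ψ : E → F) : Prop where
  isOpen : IsOpen V
  smooth : ContDiffOn ℝ ∞ ψ V
  inverse : ∃ (U : Set F) (φ : F → E), IsOpen U ∧ ψ '' V = S ∩ U ∧ ContDiffOn ℝ ∞ φ U ∧
    ∀ x ∈ V, φ (ψ x) = x
  range_fderiv : ∀ x ∈ V, Set.range (fderiv ℝ ψ x) = (T (ψ x) : Set F)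

/-- The coordinate expression of a covariant 2-tensor `w` in the parametrization `ψ`. -/
def pullback₂ {G : Type v} (w : F → F → F → G)
    {E : Type u} [NormedAddCommGroup E] [NormedSpace ℝ E] (ψ : E → F) (x a b : E) : G :=
  w (ψ x) (fderiv ℝ ψ x a) (fderiv ℝ ψ x b)

/-- The covariant 2-tensor `w` is smooth, i.e. smooth in all coordinates. -/
def IsSmoothTensor₂ {G : Type v} [NormedAddCommGroup G] [NormedSpace ℝ G]
    (S : Set F) (T : F → Submodule ℝ F) (w : F → F → F → G) : Prop :=
  ∀ (E : Type u) [NormedAddCommGroup E] [NormedSpace ℝ E] (V : Set E) (ψ : E → F),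
    IsLocalParam S T V ψ →
    ContDiffOn ℝ ∞ (fun y : E × E × E => pullback₂ w ψ y.1 y.2.1 y.2.2)
      (V ×ˢ (Set.univ ×ˢ Set.univ))

/-- `g` is a (strong) Riemannian metric on `S`. -/
structure IsRiemannianMetric (S : Set F) (T : F → Submodule ℝ F) (g : F → F → F → ℝ) :
    Prop where
  add_left : ∀ q ∈ S, ∀ A ∈ T q, ∀ A' ∈ T q, ∀ B ∈ T q, g q (A + A') B = g q A B + g q A' B
  smul_left : ∀ q ∈ S, ∀ (r : ℝ), ∀ A ∈ T q, ∀ B ∈ T q, g q (r • A) B = r * g q A B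
  symm : ∀ q ∈ S, ∀ A ∈ T q, ∀ B ∈ T q, g q A B = g q B A
  coercive : ∀ q ∈ S, ∃ c : ℝ, 0 < c ∧ ∀ A ∈ T q, c * ‖A‖ ^ 2 ≤ g q A A
  smooth : IsSmoothTensor₂ S T g

/-- `w` is a smooth closed 2-form on `S`. In coordinates, closedness is the usual formula for
the exterior derivative on constant vector fields. -/
structure IsClosedTwoForm {G : Type v} [NormedAddCommGroup G] [NormedSpace ℝ G]
    (S : Set F) (T : F → Submodule ℝ F) (w : F → F → F → G) : Prop where
  add_left : ∀ q ∈ S, ∀ A ∈ T q, ∀ A' ∈ T q, ∀ B ∈ T q, w q (A + A') B = w q A B + w q A' B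
  smul_left : ∀ q ∈ S, ∀ (r : ℝ), ∀ A ∈ T q, ∀ B ∈ T q, w q (r • A) B = r • w q A B
  antisymm : ∀ q ∈ S, ∀ A ∈ T q, ∀ B ∈ T q, w q A B = - w q B A
  smooth : IsSmoothTensor₂ S T w
  closed : ∀ (E : Type u) [NormedAddCommGroup E] [NormedSpace ℝ E] (V : Set E) (ψ : E → F),
    IsLocalParam S T V ψ → ∀ x ∈ V, ∀ a b c : E,
      fderiv ℝ (fun y => pullback₂ w ψ y b c) x a - fderiv ℝ (fun y => pullback₂ w ψ y a c) x b
        + fderiv ℝ (fun y => pullback₂ w ψ y a b) x c = 0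

/-- `K` is a smooth almost complex structure on `S`. -/
structure IsAlmostComplex (S : Set F) (T : F → Submodule ℝ F) (K : F → F → F) : Prop where
  mem : ∀ q ∈ S, ∀ A ∈ T q, K q A ∈ T q
  add : ∀ q ∈ S, ∀ A ∈ T q, ∀ B ∈ T q, K q (A + B) = K q A + K q B
  smul : ∀ q ∈ S, ∀ (r : ℝ), ∀ A ∈ T q, K q (r • A) = r • K q A
  sq : ∀ q ∈ S, ∀ A ∈ T q, K q (K q A) = - A
  smooth : ∀ (E : Type u) [NormedAddCommGroup E] [NormedSpace ℝ E] (V : Set E) (ψ : E → F),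
    IsLocalParam S T V ψ →
    ContDiffOn ℝ ∞ (fun y : E × E => K (ψ y.1) (fderiv ℝ ψ y.1 y.2)) (V ×ˢ Set.univ)

/-- A local parametrization by an open subset of a complex normed space that is holomorphic with
respect to the almost complex structure `K`. -/
def IsHolParam (S : Set F) (T : F → Submodule ℝ F) (K : F → F → F)
    {E : Type u} [NormedAddCommGroup E] [NormedSpace ℂ E] (V : Set E) (ψ : E → F) : Prop :=
  IsLocalParam S T V ψ ∧
    ∀ x ∈ V, ∀ a : E, fderiv ℝ ψ x (Complex.I • a) = K (ψ x) (fderiv ℝ ψ x a)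

/-- `K` is an integrable almost complex structure: around every point there are
`K`-holomorphic coordinates. -/
def IsIntegrableAlmostComplex (S : Set F) (T : F → Submodule ℝ F) (K : F → F → F) : Prop :=
  IsAlmostComplex S T K ∧
  ∀ q ∈ S, ∃ (E : Type u) (_ : NormedAddCommGroup E) (_ : NormedSpace ℂ E)
    (V : Set E) (ψ : E → F), IsHolParam S T K V ψ ∧ q ∈ ψ '' V

/-- `(g, K, L)` is a hyperkähler structure on `S`: `g` is a Riemannian metric, `K` and `L` are
anticommuting almost complex structures, and `g(K·,·)`, `g(L·,·)`, `g(KL·,·)` are closed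
2-forms. -/
structure IsHyperkahler (S : Set F) (T : F → Submodule ℝ F) (g : F → F → F → ℝ)
    (K L : F → F → F) : Prop where
  metric : IsRiemannianMetric S T g
  almostComplex₁ : IsAlmostComplex S T K
  almostComplex₂ : IsAlmostComplex S T L
  anticomm : ∀ q ∈ S, ∀ A ∈ T q, K q (L q A) = - L q (K q A)
  closed₁ : IsClosedTwoForm S T (fun q A B => g q (K q A) B)
  closed₂ : IsClosedTwoForm S T (fun q A B => g q (L q A) B)
  closed₃ : IsClosedTwoForm S T (fun q A B => g q (K q (L q A)) B)

/-- `dᶜf = -df ∘ i` for a real function `f` on a complex normed space. -/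
def dc {E : Type u} [NormedAddCommGroup E] [NormedSpace ℂ E] (f : E → ℝ) (x a : E) : ℝ :=
  - fderiv ℝ f x (Complex.I • a)

/-- `i ∂∂̄ f = ½ d dᶜ f` for a real function `f` on a complex normed space. -/
def iddbar {E : Type u} [NormedAddCommGroup E] [NormedSpace ℂ E] (f : E → ℝ) (x a b : E) : ℝ :=
  (1 / 2) * (fderiv ℝ (fun y => dc f y b) x a - fderiv ℝ (fun y => dc f y a) x b)

/-- The smooth function `τ` is a Kähler potential for the metric `g` with respect to the
complex structure `K`: the fundamental form `g(K·,·)` is `i ∂∂̄ τ` in all `K`-holomorphic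
coordinates. -/
def IsKahlerPotential (S : Set F) (T : F → Submodule ℝ F) (g : F → F → F → ℝ) (K : F → F → F)
    (τ : F → ℝ) : Prop :=
  ∀ (E : Type u) [NormedAddCommGroup E] [NormedSpace ℂ E] (V : Set E) (ψ : E → F),
    IsHolParam S T K V ψ →
    ContDiffOn ℝ ∞ (fun x => τ (ψ x)) V ∧
    ∀ x ∈ V, ∀ a b : E,
      pullback₂ (fun q A B => g q (K q A) B) ψ x a b = iddbar (fun x => τ (ψ x)) x a b

/-- `w` is a `K`-holomorphic symplectic form: a closed nondegenerate 2-form, complex linear with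
respect to `K`, with holomorphic coefficients in all `K`-holomorphic coordinates. -/
structure IsHolomorphicSymplectic (S : Set F) (T : F → Submodule ℝ F) (K : F → F → F)
    (w : F → F → F → ℂ) : Prop where
  closed : IsClosedTwoForm S T w
  nondegenerate : ∀ q ∈ S, ∀ A ∈ T q, (∀ B ∈ T q, w q A B = 0) → A = 0
  complex_linear : ∀ q ∈ S, ∀ A ∈ T q, ∀ B ∈ T q, w q (K q A) B = Complex.I * w q A B
  holomorphic : ∀ (E : Type u) [NormedAddCommGroup E] [NormedSpace ℂ E] (V : Set E) (ψ : E → F),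
    IsHolParam S T K V ψ →
    DifferentiableOn ℂ (fun y : E × E × E => pullback₂ w ψ y.1 y.2.1 y.2.2)
      (V ×ˢ (Set.univ ×ˢ Set.univ))

end Real

end EmbGeom

/-! ### Rank-one projections -/

namespace RankOne

variable {H : Type u} [NormedAddCommGroup H] [InnerProductSpace ℂ H] [CompleteSpace H]

/-- The index set of a fixed Hilbert basis of `H`. -/
def basisIndex (H : Type u) [NormedAddCommGroup H] [InnerProductSpace ℂ H] [CompleteSpace H] :
    Set H :=
  (exists_hilbertBasis ℂ H).choose

/-- A fixed Hilbert basis of `H`. -/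
def basis (H : Type u) [NormedAddCommGroup H] [InnerProductSpace ℂ H] [CompleteSpace H] :
    HilbertBasis (basisIndex H) ℂ H :=
  (exists_hilbertBasis ℂ H).choose_spec.choose

/-- The trace of an operator, `Tr M = ∑ᵢ ⟪eᵢ, M eᵢ⟫`. -/
def tr (M : H →L[ℂ] H) : ℂ :=
  ∑' i, ⟪basis H i, M (basis H i)⟫_ℂ

theorem hasSum_tr_aux {ι : Type v} (b : HilbertBasis ι ℂ H) (M : H →L[ℂ] H)
    [FiniteDimensional ℂ (LinearMap.range (M : H →ₗ[ℂ] H))] :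
    HasSum (fun i => ⟪b i, M (b i)⟫_ℂ)
      (∑ j, ⟪(ContinuousLinearMap.adjoint M)
          (stdOrthonormalBasis ℂ (LinearMap.range (M : H →ₗ[ℂ] H)) j : H),
        (stdOrthonormalBasis ℂ (LinearMap.range (M : H →ₗ[ℂ] H)) j : H)⟫_ℂ) := by
  let R := LinearMap.range (M : H →ₗ[ℂ] H)
  let f := stdOrthonormalBasis ℂ R
  have h1 : ∀ i, ⟪b i, M (b i)⟫_ℂ = ∑ j,
      ⟪(ContinuousLinearMap.adjoint M) (f j : H), b i⟫_ℂ * ⟪b i, (f j : H)⟫_ℂ := by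
    intro i
    have h2 := f.sum_repr' (⟨M (b i), ⟨b i, rfl⟩⟩ : R)
    have h3 : M (b i) = ∑ j, ⟪(f j : H), M (b i)⟫_ℂ • (f j : H) := by
      have := congrArg (Subtype.val) h2
      simpa using this.symm
    conv_lhs => rw [h3]
    rw [inner_sum]
    refine Finset.sum_congr rfl fun j _ => ?_
    rw [inner_smul_right, ContinuousLinearMap.adjoint_inner_left]
  simp_rw [h1]
  exact hasSum_sum fun j _ => b.hasSum_inner_mul_inner _ _

/-- For operators of finite rank, the series for the trace converges in every Hilbert basis,
with a sum that does not depend on the basis. -/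
theorem hasSum_tr {ι : Type v} (b : HilbertBasis ι ℂ H) (M : H →L[ℂ] H)
    [FiniteDimensional ℂ (LinearMap.range (M : H →ₗ[ℂ] H))] :
    HasSum (fun i => ⟪b i, M (b i)⟫_ℂ) (tr M) := by
  have h0 := (hasSum_tr_aux (basis H) M).tsum_eq
  have h1 := hasSum_tr_aux b M
  rw [← h0] at h1
  exact h1

/-- The Hilbert–Schmidt norm `‖q‖ = √Tr(q*q)`. -/
def hsNorm (q : H →L[ℂ] H) : ℝ := Real.sqrt (tr (star q * q)).re

/-- The trace-class norm `Tr √(q*q)`. -/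
def traceNorm (q : H →L[ℂ] H) : ℝ := (tr (CFC.sqrt (star q * q))).re

/-- The commutator of two operators. -/
def comm (A B : H →L[ℂ] H) : H →L[ℂ] H := A * B - B * A

/-- The set of all (not necessarily Hermitian) projections of rank one. -/
def projections (H : Type u) [NormedAddCommGroup H] [InnerProductSpace ℂ H] [CompleteSpace H] :
    Set (H →L[ℂ] H) :=
  {q | q * q = q ∧ Module.finrank ℂ (LinearMap.range (q : H →ₗ[ℂ] H)) = 1}

/-- The tangent space `{A : qA + Aq = A}` of the set of rank-one projections at `q`. -/
def tangent (q : H →L[ℂ] H) : Submodule ℝ (H →L[ℂ] H) where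
  carrier := {A | q * A + A * q = A}
  zero_mem' := by simp
  add_mem' := by
    intro A B hA hB
    simp only [Set.mem_ofPred_eq] at hA hB ⊢
    calc q * (A + B) + (A + B) * q = (q * A + A * q) + (q * B + B * q) := by noncomm_ring
      _ = A + B := by rw [hA, hB]
  smul_mem' := by
    intro r A hA
    simp only [Set.mem_ofPred_eq] at hA ⊢
    rw [mul_smul_comm, smul_mul_assoc, ← smul_add, hA]

/-- Projective space, as the set of Hermitian projections of rank one. -/
def projSpace (H : Type u) [NormedAddCommGroup H] [InnerProductSpace ℂ H] [CompleteSpace H] :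
    Set (H →L[ℂ] H) :=
  {p | p ∈ projections H ∧ star p = p}

/-- The tangent space `{A : pA + Ap = A, A* = A}` of projective space at `p`. -/
def projTangent (p : H →L[ℂ] H) : Submodule ℝ (H →L[ℂ] H) where
  carrier := {A | A ∈ tangent p ∧ star A = A}
  zero_mem' := ⟨zero_mem _, by simp⟩
  add_mem' := by
    rintro A B ⟨hA, hA'⟩ ⟨hB, hB'⟩
    exact ⟨add_mem hA hB, by rw [star_add, hA', hB']⟩
  smul_mem' := by
    rintro r A ⟨hA, hA'⟩
    exact ⟨Submodule.smul_mem _ r hA, by rw [star_smul, hA', star_trivial]⟩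

/-- The (real) cotangent bundle of projective space: pairs of a point and a continuous linear
functional on the tangent space at that point. -/
def Cotangent (H : Type u) [NormedAddCommGroup H] [InnerProductSpace ℂ H] [CompleteSpace H] :
    Type u :=
  Σ p : projSpace H, (projTangent (p : H →L[ℂ] H) →L[ℝ] ℝ)

/-- The Hermitian form
`h(A, B) = Tr(A*B) / ‖q‖ - Tr(A*q) Tr(Bq*) / (2‖q‖³)`. -/
def herm (q A B : H →L[ℂ] H) : ℂ :=
  tr (star A * B) / (hsNorm q : ℂ)
    - tr (star A * q) * tr (B * star q) / (2 * (hsNorm q : ℂ) ^ 3)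

/-- The metric `g = Re h`. -/
def metric (q A B : H →L[ℂ] H) : ℝ := (herm q A B).re

/-- `Ω(A, B) = i Tr(q[A, B])`. -/
def Omega (q A B : H →L[ℂ] H) : ℂ := Complex.I * tr (q * comm A B)

/-- The complex structure `I A = iA`. -/
def strI (_q A : H →L[ℂ] H) : H →L[ℂ] H := Complex.I • A

/-- The almost complex structure
`𝐉 A = (i/‖q‖) [q, A*] - (i/(2‖q‖³)) Tr(A*q) [q, q*]`. -/
def strJJ (q A : H →L[ℂ] H) : H →L[ℂ] H :=
  (Complex.I / (hsNorm q : ℂ)) • comm q (star A)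
    - (Complex.I / (2 * (hsNorm q : ℂ) ^ 3) * tr (star A * q)) • comm q (star q)

/-- The almost complex structure `J A = i[A, q]`. -/
def strJ (q A : H →L[ℂ] H) : H →L[ℂ] H := Complex.I • comm A q

end RankOne

end

/-!
A rank-one projection is `q = |x⟩⟨y|`, that is `v ↦ ⟪y, v⟫ x`, with `⟪y, x⟫ = 1`; its tangent vectors
are `|x⟩⟨a| + |b⟩⟨y|` with `a ⟂ x` and `b ⟂ y`. Rescaling gives the balanced form `‖x‖² = ‖y‖² = ‖q‖`.
All traces become inner products, and the Hilbert-Schmidt inner product is that of the Hilbert space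
`HS H` of square summable families, to which smooth families of projections lift smoothly.

*The metric and the closed forms.* By the Cauchy-Schwarz inequality the second term of `h` is at most
half of the first one, so `g` is coercive. Writing `Q` for the lift of `q`, the form `Im h = g(I·,·)`
is the exterior derivative of `½ dᶜ‖Q‖ = Im ⟪Q, dQ⟫ / (2‖Q‖)` (`pullback_metric_strI`); this gives both
closedness and the Kähler potential. A computation in balanced form shows `h(𝐉A, B) = Ω(A, B)`
(`herm_strJJ`), so the other two forms are the real and the imaginary part of `Ω`, and `Ω` is the
exterior derivative of `i ⟪η, dξ⟫` for every local factorization `q = |ξ⟩⟨η|`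
(`isLocallyExactAt_Omega`).

*Integrability of `I` and `J`.* Near a projection with `⟪e, q e⟫ ≠ 0` the image of `q` is spanned by
`e + z` and the image of `q*` by `e + a`, with `z` and `a` orthogonal to `e`. The chart `(z, a)` is
holomorphic for `J` (`fderiv_affineParam_I_smul`). It becomes holomorphic for `I` when `a` is
conjugated, i.e. replaced by a functional through the Riesz isomorphism.

*Integrability of `𝐉`, and `𝐉² = -1`.* With respect to `𝐉` the set of projections is again the
cotangent bundle of projective space, with base point the line through `ξ + η` in the balanced form.
Concretely, a pair of orthogonal vectors `X`, `M` defines the projection with factors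
`(X ± k M) / √(2k)`, where `k = ‖X‖² / (1 + √(1 + ‖X‖² ‖M‖²))` is the scale for which these
have inner product `1`. If `X` varies antiholomorphically and `M` holomorphically, this projection
varies holomorphically for `𝐉` (`fderiv_balanced_strJJ`): the derivatives of the two factors are
`f - κ η` and `g - κ ξ` with a real number `κ` that is determined by the constraint `⟪η, ξ⟫ = 1`, and
`𝐉` exchanges `f` and `g` up to factors `± i`. With `X = e + z` and `M = μ - ⟪z, μ⟫ e` one obtains a chart `(z, μ)`, with
`z` conjugated. Since multiplication by `i` in the chart is `𝐉`, also `𝐉² = -1`.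

*The covectors.* By the Riesz representation theorem the functionals on `T_p` at `p = |x⟩⟨x|` are
`Re ⟪y - x, · x⟫` for exactly one `y` with `⟪y, x⟫ = 1`, which is the functional of `|x⟩⟨y|`.
-/

set_option linter.unusedSectionVars false

namespace RankOne

open InnerProductSpace ContinuousLinearMap

variable {H : Type u} [NormedAddCommGroup H] [InnerProductSpace ℂ H] [CompleteSpace H]

/-! ### Traces of operators of finite rank -/

/-- The series defining the trace of `M` converges. -/
def TraceSummable (M : H →L[ℂ] H) : Prop :=
  Summable fun i => ⟪basis H i, M (basis H i)⟫_ℂ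

theorem tr_add {M N : H →L[ℂ] H} (hM : TraceSummable M) (hN : TraceSummable N) :
    tr (M + N) = tr M + tr N := by
  simp only [tr, _root_.add_apply, inner_add_right]
  exact Summable.tsum_add hM hN

theorem tr_sub {M N : H →L[ℂ] H} (hM : TraceSummable M) (hN : TraceSummable N) :
    tr (M - N) = tr M - tr N := by
  simp only [tr, _root_.sub_apply, inner_sub_right]
  exact Summable.tsum_sub hM hN

@[simp] theorem tr_smul (c : ℂ) (M : H →L[ℂ] H) : tr (c • M) = c * tr M := by
  simp only [tr, _root_.smul_apply, inner_smul_right]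
  exact tsum_mul_left

@[simp] theorem TraceSummable.add {M N : H →L[ℂ] H} (hM : TraceSummable M)
    (hN : TraceSummable N) : TraceSummable (M + N) := by
  simpa only [TraceSummable, _root_.add_apply, inner_add_right] using Summable.add hM hN

@[simp] theorem TraceSummable.sub {M N : H →L[ℂ] H} (hM : TraceSummable M)
    (hN : TraceSummable N) : TraceSummable (M - N) := by
  simpa only [TraceSummable, _root_.sub_apply, inner_sub_right] using Summable.sub hM hN

@[simp] theorem TraceSummable.smul {M : H →L[ℂ] H} (c : ℂ) (hM : TraceSummable M) :
    TraceSummable (c • M) := by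
  simpa only [TraceSummable, _root_.smul_apply, inner_smul_right] using Summable.mul_left c hM

theorem hasSum_tr_rankOne (x y : H) :
    HasSum (fun i => ⟪basis H i, rankOne ℂ x y (basis H i)⟫_ℂ) ⟪y, x⟫_ℂ := by
  simpa [inner_smul_right] using (basis H).hasSum_inner_mul_inner y x

@[simp] theorem traceSummable_rankOne (x y : H) : TraceSummable (rankOne ℂ x y) :=
  (hasSum_tr_rankOne x y).summable

@[simp] theorem tr_rankOne (x y : H) : tr (rankOne ℂ x y) = ⟪y, x⟫_ℂ :=
  (hasSum_tr_rankOne x y).tsum_eq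

@[simp] theorem mul_rankOne (M : H →L[ℂ] H) (x y : H) :
    M * rankOne ℂ x y = rankOne ℂ (M x) y :=
  comp_rankOne x y M

@[simp] theorem rankOne_mul (M : H →L[ℂ] H) (x y : H) :
    rankOne ℂ x y * M = rankOne ℂ x (star M y) :=
  rankOne_comp x y M

theorem rankOne_mul_rankOne (x y z w : H) :
    rankOne ℂ x y * rankOne ℂ z w = ⟪y, z⟫_ℂ • rankOne ℂ x w :=
  rankOne_comp_rankOne x y z w

@[simp] theorem star_rankOne (x y : H) : star (rankOne ℂ x y) = rankOne ℂ y x :=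
  adjoint_rankOne x y

theorem rankOne_real_smul_left (r : ℝ) (x y : H) :
    rankOne ℂ (r • x) y = r • rankOne ℂ x y := by
  rw [← Complex.coe_smul r x, ← Complex.coe_smul r (rankOne ℂ x y), map_smul,
    _root_.smul_apply]

theorem rankOne_real_smul_right (r : ℝ) (x y : H) :
    rankOne ℂ x (r • y) = r • rankOne ℂ x y := by
  rw [← Complex.coe_smul r y, ← Complex.coe_smul r (rankOne ℂ x y), map_smulₛₗ, Complex.conj_ofReal]

/-- The operator `rankOne ℂ x y`, as a bounded real bilinear function of `x` and `y`. -/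
noncomputable def rankOneBilin (H : Type u) [NormedAddCommGroup H] [InnerProductSpace ℂ H]
    [CompleteSpace H] : H →L[ℝ] H →L[ℝ] (H →L[ℂ] H) :=
  LinearMap.mkContinuous₂ (LinearMap.mk₂ ℝ (fun x y => (rankOne ℂ x y : H →L[ℂ] H))
    (by simp) rankOne_real_smul_left (by simp) rankOne_real_smul_right) 1 (by simp)

@[simp] theorem rankOneBilin_apply (x y : H) : rankOneBilin H x y = rankOne ℂ x y := rfl

/-! ### Hilbert–Schmidt operators as square summable families of vectors -/

/-- `A` is a Hilbert–Schmidt operator. -/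
def IsHS (A : H →L[ℂ] H) : Prop :=
  Memℓp (fun i => A (basis H i)) 2

/-- The Hilbert space of square summable families of vectors of `H`, indexed by the Hilbert basis.
It is isometric to the space of Hilbert–Schmidt operators. It is not an abbreviation of `lp`, so
that its real structure is the restriction of the complex one. -/
def HS (H : Type u) [NormedAddCommGroup H] [InnerProductSpace ℂ H] [CompleteSpace H] :
    Type u :=
  lp (fun _ : basisIndex H => H) 2

noncomputable instance : NormedAddCommGroup (HS H) :=
  inferInstanceAs (NormedAddCommGroup (lp (fun _ : basisIndex H => H) 2))

noncomputable instance : InnerProductSpace ℂ (HS H) :=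
  inferInstanceAs (InnerProductSpace ℂ (lp (fun _ : basisIndex H => H) 2))

/-- The evaluation of a square summable family at an index. -/
noncomputable def evalHS (i : basisIndex H) : HS H →L[ℂ] H :=
  lp.evalCLM ℂ (fun _ : basisIndex H => H) 2 i

theorem HS.ext {f g : HS H} (h : ∀ i, evalHS i f = evalHS i g) : f = g :=
  lp.ext (funext h)

theorem HS.inner_eq_tsum (f g : HS H) : ⟪f, g⟫_ℂ = ∑' i, ⟪evalHS i f, evalHS i g⟫_ℂ :=
  lp.inner_eq_tsum f g

/-- A square summable family as an element of `HS H`. -/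
def HS.mk (f : basisIndex H → H) (h : Memℓp f 2) : HS H :=
  (⟨f, h⟩ : lp (fun _ : basisIndex H => H) 2)

theorem evalHS_mk (f : basisIndex H → H) (h : Memℓp f 2) (i : basisIndex H) :
    evalHS i (HS.mk f h) = f i := rfl

open Classical in
/-- The family of the images of the basis vectors under a Hilbert–Schmidt operator; the zero
family for all other operators. -/
noncomputable def toHS (A : H →L[ℂ] H) : HS H :=
  if h : IsHS A then HS.mk (fun i => A (basis H i)) h else 0

theorem IsHS.toHS_apply {A : H →L[ℂ] H} (h : IsHS A) (i : basisIndex H) :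
    evalHS i (toHS A) = A (basis H i) := by
  rw [toHS, dif_pos h]
  exact evalHS_mk _ h i

theorem IsHS.add {A B : H →L[ℂ] H} (hA : IsHS A) (hB : IsHS B) : IsHS (A + B) :=
  Memℓp.add hA hB

theorem IsHS.sub {A B : H →L[ℂ] H} (hA : IsHS A) (hB : IsHS B) : IsHS (A - B) :=
  Memℓp.sub hA hB

theorem IsHS.smul {A : H →L[ℂ] H} (c : ℂ) (hA : IsHS A) : IsHS (c • A) :=
  Memℓp.const_smul hA c

theorem isHS_rankOne (x y : H) : IsHS (rankOne ℂ x y) := by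
  refine memℓp_gen ?_
  have h := ((basis H).hasSum_inner_mul_inner y y).summable.norm.mul_right (‖x‖ ^ 2)
  refine h.congr fun i => ?_
  simp only [rankOne_apply, norm_smul, norm_mul, norm_inner_symm (basis H i) y]
  norm_num
  ring

theorem toHS_add {A B : H →L[ℂ] H} (hA : IsHS A) (hB : IsHS B) :
    toHS (A + B) = toHS A + toHS B := by
  refine HS.ext fun i => ?_
  rw [map_add, (hA.add hB).toHS_apply, hA.toHS_apply, hB.toHS_apply, _root_.add_apply]

theorem toHS_smul {A : H →L[ℂ] H} (c : ℂ) (hA : IsHS A) : toHS (c • A) = c • toHS A := by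
  refine HS.ext fun i => ?_
  rw [map_smul, (hA.smul c).toHS_apply, hA.toHS_apply, _root_.smul_apply]

theorem tr_star_mul {A B : H →L[ℂ] H} (hA : IsHS A) (hB : IsHS B) :
    tr (star A * B) = ⟪toHS A, toHS B⟫_ℂ := by
  rw [HS.inner_eq_tsum]
  refine tsum_congr fun i => ?_
  rw [hA.toHS_apply, hB.toHS_apply]
  exact ContinuousLinearMap.adjoint_inner_right A _ _

theorem inner_toHS_rankOne (x y z w : H) :
    ⟪toHS (rankOne ℂ x y), toHS (rankOne ℂ z w)⟫_ℂ = ⟪x, z⟫_ℂ * ⟪w, y⟫_ℂ := by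
  rw [← tr_star_mul (isHS_rankOne x y) (isHS_rankOne z w), star_rankOne, rankOne_mul_rankOne]
  simp

theorem norm_toHS_rankOne (x y : H) : ‖toHS (rankOne ℂ x y)‖ = ‖x‖ * ‖y‖ := by
  have h := inner_toHS_rankOne x y x y
  simp only [inner_self_eq_norm_sq_to_K] at h
  have h' : ‖toHS (rankOne ℂ x y)‖ ^ 2 = (‖x‖ * ‖y‖) ^ 2 := by
    rw [mul_pow]; exact_mod_cast h
  exact (sq_eq_sq₀ (norm_nonneg _) (by positivity)).1 h'

theorem inner_toHS_rankOne_left (x y : H) {A : H →L[ℂ] H} (hA : IsHS A) :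
    ⟪toHS (rankOne ℂ x y), toHS A⟫_ℂ = ⟪x, A y⟫_ℂ := by
  rw [← tr_star_mul (isHS_rankOne x y) hA, star_rankOne, rankOne_mul, tr_rankOne]
  exact ContinuousLinearMap.adjoint_inner_left A y x

/-- The Hilbert–Schmidt norm dominates the operator norm: `⟪w, A v⟫` is the Hilbert–Schmidt inner
product of `A` with an operator of norm `‖w‖ ‖v‖`. -/
theorem IsHS.norm_le {A : H →L[ℂ] H} (hA : IsHS A) : ‖A‖ ≤ ‖toHS A‖ := by
  refine A.opNorm_le_bound (norm_nonneg _) fun v => ?_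
  have h := norm_inner_le_norm (𝕜 := ℂ) (toHS (rankOne ℂ (A v) v)) (toHS A)
  rw [inner_toHS_rankOne_left _ _ hA, inner_self_eq_norm_sq_to_K, norm_toHS_rankOne] at h
  rcases eq_or_ne (A v) 0 with h0 | h0
  · rw [h0, norm_zero]; positivity
  · have h1 : 0 < ‖A v‖ := norm_pos_iff.2 h0
    have h2 : ‖A v‖ * ‖A v‖ ≤ ‖A v‖ * (‖toHS A‖ * ‖v‖) := by
      simp only [norm_pow, Complex.coe_algebraMap, Complex.norm_real, norm_norm] at h
      calc _ = ‖A v‖ ^ 2 := by ring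
        _ ≤ _ := by simpa using h
        _ = _ := by ring
    exact le_of_mul_le_mul_left h2 h1

/-! ### Rank-one projections and their tangent vectors -/

theorem rankOne_mem_projections {x y : H} (h : ⟪y, x⟫_ℂ = 1) :
    rankOne ℂ x y ∈ projections H := by
  have hx : x ≠ 0 := by rintro rfl; simp at h
  have hy : y ≠ 0 := by rintro rfl; simp at h
  refine ⟨by rw [rankOne_mul_rankOne, h, one_smul], ?_⟩
  rw [← Module.rank_eq_one_iff_finrank_eq_one]
  exact rank_rankOne hx hy

theorem exists_eq_rankOne {q : H →L[ℂ] H} (hq : q ∈ projections H) :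
    ∃ x y : H, ⟪y, x⟫_ℂ = 1 ∧ q = rankOne ℂ x y := by
  obtain ⟨hqq, hr⟩ := hq
  obtain ⟨⟨x, hx⟩, hx0, hspan⟩ := finrank_eq_one_iff'.1 hr
  obtain ⟨z, rfl⟩ := hx
  have hx0' : q z ≠ 0 := fun h => hx0 (Subtype.ext h)
  have hqx : q (q z) = q z := congrArg (fun f : H →L[ℂ] H => f z) hqq
  have hne : ⟪q z, q z⟫_ℂ ≠ 0 := inner_self_ne_zero.2 hx0'
  have key : ∀ v, q v = (⟪q z, q v⟫_ℂ / ⟪q z, q z⟫_ℂ) • q z := by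
    intro v
    obtain ⟨c, hc⟩ := hspan ⟨q v, ⟨v, rfl⟩⟩
    have hc' : c • q z = q v := congrArg Subtype.val hc
    rw [← hc', inner_smul_right, mul_div_cancel_right₀ _ hne]
  refine ⟨q z, (starRingEnd ℂ (⟪q z, q z⟫_ℂ)⁻¹) • star q (q z), ?_, ?_⟩
  · rw [inner_smul_left, Complex.conj_conj]
    erw [ContinuousLinearMap.adjoint_inner_left]
    rw [hqx, inv_mul_cancel₀ hne]
  · ext v
    rw [rankOne_apply, inner_smul_left, Complex.conj_conj]
    erw [ContinuousLinearMap.adjoint_inner_left]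
    conv_lhs => rw [key v, div_eq_inv_mul]

theorem hsNorm_rankOne (x y : H) : hsNorm (rankOne ℂ x y) = ‖x‖ * ‖y‖ := by
  rw [hsNorm, tr_star_mul (isHS_rankOne x y) (isHS_rankOne x y), inner_self_eq_norm_sq_to_K,
    norm_toHS_rankOne]
  simp only [Complex.coe_algebraMap, ← Complex.ofReal_pow, Complex.ofReal_re]
  exact Real.sqrt_sq (by positivity)

theorem isHS_of_mem_projections {q : H →L[ℂ] H} (hq : q ∈ projections H) : IsHS q := by
  obtain ⟨x, y, -, rfl⟩ := exists_eq_rankOne hq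
  exact isHS_rankOne x y

theorem hsNorm_eq_norm_toHS {q : H →L[ℂ] H} (hq : q ∈ projections H) :
    hsNorm q = ‖toHS q‖ := by
  obtain ⟨x, y, -, rfl⟩ := exists_eq_rankOne hq
  rw [hsNorm_rankOne, norm_toHS_rankOne]

theorem one_le_hsNorm {q : H →L[ℂ] H} (hq : q ∈ projections H) : 1 ≤ hsNorm q := by
  obtain ⟨x, y, h, rfl⟩ := exists_eq_rankOne hq
  have := norm_inner_le_norm (𝕜 := ℂ) y x
  rw [h, norm_one] at this
  rw [hsNorm_rankOne]
  linarith [mul_comm ‖x‖ ‖y‖]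

theorem hsNorm_pos {q : H →L[ℂ] H} (hq : q ∈ projections H) : 0 < hsNorm q :=
  one_pos.trans_le (one_le_hsNorm hq)

/-- A rank-one projection is `v ↦ ⟪y, v⟫ x` with vectors `x`, `y` of equal norm. In this balanced
form the formulas for `h` and `𝐉` are symmetric in `x` and `y`. -/
theorem exists_eq_rankOne_balanced {q : H →L[ℂ] H} (hq : q ∈ projections H) :
    ∃ x y : H, ⟪y, x⟫_ℂ = 1 ∧ q = rankOne ℂ x y ∧ ⟪x, x⟫_ℂ = hsNorm q ∧
      ⟪y, y⟫_ℂ = hsNorm q := by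
  obtain ⟨x, y, h, rfl⟩ := exists_eq_rankOne hq
  have hx : x ≠ 0 := by rintro rfl; simp at h
  have hy : y ≠ 0 := by rintro rfl; simp at h
  have hx' : 0 < ‖x‖ := norm_pos_iff.2 hx
  have hy' : 0 < ‖y‖ := norm_pos_iff.2 hy
  set c : ℝ := Real.sqrt (‖y‖ / ‖x‖) with hc
  have hc0 : 0 < c := Real.sqrt_pos.2 (by positivity)
  have hc2 : c * c = ‖y‖ / ‖x‖ := Real.mul_self_sqrt (by positivity)
  have hcC : (c : ℂ) ≠ 0 := by exact_mod_cast hc0.ne'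
  refine ⟨(c : ℂ) • x, ((c⁻¹ : ℝ) : ℂ) • y, ?_, ?_, ?_, ?_⟩
  · rw [inner_smul_left, inner_smul_right, h, Complex.conj_ofReal]
    push_cast
    field_simp
  · ext v
    simp only [rankOne_apply, inner_smul_left, Complex.conj_ofReal, smul_smul]
    congr 1
    push_cast
    field_simp
  · rw [inner_smul_left, inner_smul_right, Complex.conj_ofReal, inner_self_eq_norm_sq_to_K,
      hsNorm_rankOne]
    have : c * (c * ‖x‖ ^ 2) = ‖x‖ * ‖y‖ := by
      rw [← mul_assoc, hc2]; field_simp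
    simp only [Complex.coe_algebraMap]
    exact_mod_cast this
  · rw [inner_smul_left, inner_smul_right, Complex.conj_ofReal, inner_self_eq_norm_sq_to_K,
      hsNorm_rankOne]
    have : c⁻¹ * (c⁻¹ * ‖y‖ ^ 2) = ‖x‖ * ‖y‖ := by
      rw [← mul_assoc, ← mul_inv, hc2]; field_simp
    simp only [Complex.coe_algebraMap]
    exact_mod_cast this

theorem mem_tangent {q A : H →L[ℂ] H} : A ∈ tangent q ↔ q * A + A * q = A := Iff.rfl

/-- The tangent space at `rankOne ℂ x y` consists of the operators `|x⟩⟨a| + |b⟩⟨y|` with `a ⟂ x`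
and `b ⟂ y`. -/
theorem exists_eq_of_mem_tangent {x y : H} (h : ⟪y, x⟫_ℂ = 1) {A : H →L[ℂ] H}
    (hA : A ∈ tangent (rankOne ℂ x y)) :
    ∃ a b : H, ⟪a, x⟫_ℂ = 0 ∧ ⟪y, b⟫_ℂ = 0 ∧ A = rankOne ℂ x a + rankOne ℂ b y := by
  rw [mem_tangent, mul_rankOne, rankOne_mul] at hA
  have h0 : ⟪y, A x⟫_ℂ = 0 := by
    have := congrArg (fun f : H →L[ℂ] H => ⟪y, f x⟫_ℂ) hA
    simp only [_root_.add_apply, rankOne_apply, inner_add_right, inner_smul_right, h] at this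
    erw [ContinuousLinearMap.adjoint_inner_left] at this
    simpa using this
  refine ⟨star A y, A x, ?_, h0, hA.symm⟩
  erw [ContinuousLinearMap.adjoint_inner_left]
  exact h0

theorem rankOne_add_rankOne_mem_tangent {x y a b : H} (h : ⟪y, x⟫_ℂ = 1) (ha : ⟪a, x⟫_ℂ = 0)
    (hb : ⟪y, b⟫_ℂ = 0) : rankOne ℂ x a + rankOne ℂ b y ∈ tangent (rankOne ℂ x y) := by
  rw [mem_tangent]
  simp only [mul_add, add_mul, rankOne_mul_rankOne, h, ha, hb, one_smul, zero_smul, add_zero,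
    zero_add]

theorem isHS_of_mem_tangent {q A : H →L[ℂ] H} (hq : q ∈ projections H) (hA : A ∈ tangent q) :
    IsHS A := by
  obtain ⟨x, y, h, rfl⟩ := exists_eq_rankOne hq
  obtain ⟨a, b, -, -, rfl⟩ := exists_eq_of_mem_tangent h hA
  exact (isHS_rankOne _ _).add (isHS_rankOne _ _)

theorem smul_mem_tangent {q A : H →L[ℂ] H} (c : ℂ) (hA : A ∈ tangent q) :
    c • A ∈ tangent q := by
  rw [mem_tangent] at hA ⊢
  rw [mul_smul_comm, smul_mul_assoc, ← smul_add, hA]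

/-- Every commutator with a projection is tangent. -/
theorem comm_mem_tangent {q : H →L[ℂ] H} (hq : q ∈ projections H) (X : H →L[ℂ] H) :
    comm q X ∈ tangent q := by
  rw [mem_tangent, comm]
  have h : q * q = q := hq.1
  calc _ = (q * q) * X - q * X * q + q * X * q - X * (q * q) := by noncomm_ring
    _ = _ := by rw [h]; noncomm_ring

theorem comm_swap (A B : H →L[ℂ] H) : comm A B = - comm B A := by
  simp [comm]

/-! ### The Hermitian form, the symplectic form and the endomorphisms -/

theorem tr_mul_star_rankOne (x y : H) {B : H →L[ℂ] H} (hB : IsHS B) :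
    tr (B * star (rankOne ℂ x y)) = ⟪toHS (rankOne ℂ x y), toHS B⟫_ℂ := by
  rw [star_rankOne, mul_rankOne, tr_rankOne, inner_toHS_rankOne_left x y hB]

/-- The form `h` in terms of the Hilbert–Schmidt inner product. -/
theorem herm_eq_inner {q A B : H →L[ℂ] H} (hq : q ∈ projections H) (hA : IsHS A) (hB : IsHS B) :
    herm q A B = ⟪toHS A, toHS B⟫_ℂ / (hsNorm q : ℂ)
      - ⟪toHS A, toHS q⟫_ℂ * ⟪toHS q, toHS B⟫_ℂ / (2 * (hsNorm q : ℂ) ^ 3) := by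
  obtain ⟨x, y, h, rfl⟩ := exists_eq_rankOne hq
  rw [herm, tr_star_mul hA hB, tr_star_mul hA (isHS_rankOne x y), tr_mul_star_rankOne x y hB]

/-- The endomorphism `𝐉` at a projection `rankOne ℂ x y` in balanced form: up to the last summand,
which makes the value tangent, it exchanges the vectors `a` and `b`. -/
theorem strJJ_rankOne {x y : H} (a b : H) (h : ⟪y, x⟫_ℂ = 1)
    (hx : ⟪x, x⟫_ℂ = hsNorm (rankOne ℂ x y)) (hy : ⟪y, y⟫_ℂ = hsNorm (rankOne ℂ x y)) :
    strJJ (rankOne ℂ x y) (rankOne ℂ x a + rankOne ℂ b y)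
      = Complex.I • (rankOne ℂ x b - rankOne ℂ a y)
        + (Complex.I / (2 * (hsNorm (rankOne ℂ x y) : ℂ)) * (⟪y, a⟫_ℂ - ⟪b, x⟫_ℂ)) •
          (rankOne ℂ x x + rankOne ℂ y y) := by
  have hr : (hsNorm (rankOne ℂ x y) : ℂ) ≠ 0 := by
    exact_mod_cast (hsNorm_pos (rankOne_mem_projections h)).ne'
  simp only [strJJ, comm, star_add, star_rankOne, mul_add, add_mul, rankOne_mul_rankOne]
  rw [tr_add (by simp) (by simp)]
  simp only [tr_smul, tr_rankOne, hx, hy]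
  generalize (hsNorm (rankOne ℂ x y) : ℂ) = r at *
  match_scalars <;> field_simp <;> ring

theorem Omega_rankOne {x y a b c d : H} (h : ⟪y, x⟫_ℂ = 1) (ha : ⟪a, x⟫_ℂ = 0)
    (hb : ⟪y, b⟫_ℂ = 0) (hc : ⟪c, x⟫_ℂ = 0) (hd : ⟪y, d⟫_ℂ = 0) :
    Omega (rankOne ℂ x y) (rankOne ℂ x a + rankOne ℂ b y) (rankOne ℂ x c + rankOne ℂ d y)
      = Complex.I * (⟪a, d⟫_ℂ - ⟪c, b⟫_ℂ) := by
  simp only [Omega, comm, mul_add, mul_sub, add_mul, rankOne_mul_rankOne, mul_smul_comm, h, ha, hb,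
    hc, hd, zero_smul, add_zero, zero_add, one_smul]
  rw [tr_sub (by simp) (by simp)]
  simp only [tr_smul, tr_rankOne, h, mul_one]
  ring

/-- `𝐉A` represents the functional `Ω(A, ·)` with respect to `h`. -/
theorem herm_strJJ {q A B : H →L[ℂ] H} (hq : q ∈ projections H) (hA : A ∈ tangent q)
    (hB : B ∈ tangent q) : herm q (strJJ q A) B = Omega q A B := by
  obtain ⟨x, y, h, rfl, hx, hy⟩ := exists_eq_rankOne_balanced hq
  obtain ⟨a, b, ha, hb, rfl⟩ := exists_eq_of_mem_tangent h hA
  obtain ⟨c, d, hc, hd, rfl⟩ := exists_eq_of_mem_tangent h hB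
  have hr : (hsNorm (rankOne ℂ x y) : ℂ) ≠ 0 := by
    exact_mod_cast (hsNorm_pos hq).ne'
  have h' : ⟪x, y⟫_ℂ = 1 := by rw [← inner_conj_symm, h, map_one]
  have ha' : ⟪x, a⟫_ℂ = 0 := by rw [← inner_conj_symm, ha, map_zero]
  have hb' : ⟪b, y⟫_ℂ = 0 := by rw [← inner_conj_symm, hb, map_zero]
  rw [strJJ_rankOne a b h hx hy, Omega_rankOne h ha hb hc hd, herm]
  simp only [star_add, star_sub, star_smul, star_rankOne, mul_add, mul_sub, add_mul, sub_mul,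
    rankOne_mul_rankOne, smul_mul_assoc, h, hx, hy, ha]
  simp (maxDischargeDepth := 12) only [tr_add, tr_sub, tr_smul, tr_rankOne, TraceSummable.add,
    TraceSummable.sub, TraceSummable.smul, traceSummable_rankOne]
  simp only [h, hx, hy, hb, hc, hd]
  simp only [Complex.star_def, map_mul, map_div₀, Complex.conj_I, inner_conj_symm,
    Complex.conj_ofReal, map_ofNat]
  generalize (hsNorm (rankOne ℂ x y) : ℂ) = r at *
  field_simp
  ring

theorem inner_toHS_self (A : H →L[ℂ] H) : ⟪toHS A, toHS A⟫_ℂ = ((‖toHS A‖ ^ 2 : ℝ) : ℂ) := by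
  rw [inner_self_eq_norm_sq_to_K]; norm_cast

theorem metric_eq_inner {q A B : H →L[ℂ] H} (hq : q ∈ projections H) (hA : IsHS A) (hB : IsHS B) :
    metric q A B = (⟪toHS A, toHS B⟫_ℂ).re / hsNorm q
      - (⟪toHS A, toHS q⟫_ℂ * ⟪toHS q, toHS B⟫_ℂ).re / (2 * hsNorm q ^ 3) := by
  rw [metric, herm_eq_inner hq hA hB, Complex.sub_re]
  congr 1
  · rw [Complex.div_ofReal_re]
  · rw [← Complex.div_ofReal_re]; push_cast; rfl

theorem herm_add_left {q A A' B : H →L[ℂ] H} (hq : q ∈ projections H) (hA : IsHS A)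
    (hA' : IsHS A') (hB : IsHS B) : herm q (A + A') B = herm q A B + herm q A' B := by
  rw [herm_eq_inner hq (hA.add hA') hB, herm_eq_inner hq hA hB, herm_eq_inner hq hA' hB,
    toHS_add hA hA', inner_add_left, inner_add_left]
  ring

theorem herm_smul_left {q A B : H →L[ℂ] H} (hq : q ∈ projections H) (c : ℂ) (hA : IsHS A)
    (hB : IsHS B) : herm q (c • A) B = conj c * herm q A B := by
  rw [herm_eq_inner hq (hA.smul c) hB, herm_eq_inner hq hA hB, toHS_smul c hA, inner_smul_left,
    inner_smul_left]
  ring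

theorem conj_herm {q A B : H →L[ℂ] H} (hq : q ∈ projections H) (hA : IsHS A) (hB : IsHS B) :
    conj (herm q A B) = herm q B A := by
  rw [herm_eq_inner hq hA hB, herm_eq_inner hq hB hA]
  simp only [map_sub, map_div₀, map_mul, inner_conj_symm, Complex.conj_ofReal, map_pow, map_ofNat]
  ring

theorem real_smul_eq (r : ℝ) (A : H →L[ℂ] H) : r • A = (r : ℂ) • A :=
  (Complex.coe_smul r A).symm

/-- Coercivity of the metric: the second term of `h` is at most half of the first one by the
Cauchy–Schwarz inequality. -/
theorem le_metric {q A : H →L[ℂ] H} (hq : q ∈ projections H) (hA : IsHS A) :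
    1 / (2 * hsNorm q) * ‖A‖ ^ 2 ≤ metric q A A := by
  have hr := hsNorm_pos hq
  rw [metric_eq_inner hq hA hA, inner_toHS_self, Complex.ofReal_re,
    ← inner_conj_symm (toHS A) (toHS q), ← Complex.normSq_eq_conj_mul_self, Complex.ofReal_re,
    Complex.normSq_eq_norm_sq]
  have h1 : ‖A‖ ^ 2 ≤ ‖toHS A‖ ^ 2 := pow_le_pow_left₀ (norm_nonneg _) hA.norm_le 2
  have h2 : ‖⟪toHS q, toHS A⟫_ℂ‖ ^ 2 ≤ hsNorm q ^ 2 * ‖toHS A‖ ^ 2 := by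
    rw [← mul_pow, hsNorm_eq_norm_toHS hq]
    exact pow_le_pow_left₀ (norm_nonneg _) (norm_inner_le_norm _ _) 2
  calc 1 / (2 * hsNorm q) * ‖A‖ ^ 2 ≤ 1 / (2 * hsNorm q) * ‖toHS A‖ ^ 2 := by gcongr
    _ = ‖toHS A‖ ^ 2 / hsNorm q - hsNorm q ^ 2 * ‖toHS A‖ ^ 2 / (2 * hsNorm q ^ 3) := by
      field_simp; ring
    _ ≤ _ := by gcongr

theorem eq_zero_of_metric_self {q A : H →L[ℂ] H} (hq : q ∈ projections H) (hA : IsHS A)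
    (h : metric q A A = 0) : A = 0 := by
  have h1 := le_metric hq hA
  have hr := hsNorm_pos hq
  rw [h] at h1
  have h2 : ‖A‖ ^ 2 ≤ 0 := by
    by_contra! h3
    have : 0 < 1 / (2 * hsNorm q) * ‖A‖ ^ 2 := by positivity
    linarith
  exact norm_eq_zero.1 (pow_eq_zero_iff two_ne_zero |>.1 (le_antisymm h2 (by positivity)))

/-! ### Linear algebra of `Ω`, `𝐉` and `J` -/

theorem Omega_rankOne_eq (x y : H) (A B : H →L[ℂ] H) :
    Omega (rankOne ℂ x y) A B = Complex.I * ⟪y, comm A B x⟫_ℂ := by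
  rw [Omega, rankOne_mul, tr_rankOne]
  congr 1
  exact ContinuousLinearMap.adjoint_inner_left _ _ _

theorem Omega_add_left {q : H →L[ℂ] H} (hq : q ∈ projections H) (A A' B : H →L[ℂ] H) :
    Omega q (A + A') B = Omega q A B + Omega q A' B := by
  obtain ⟨x, y, -, rfl⟩ := exists_eq_rankOne hq
  simp only [Omega_rankOne_eq]
  rw [show comm (A + A') B = comm A B + comm A' B by simp only [comm]; noncomm_ring,
    _root_.add_apply, inner_add_right, mul_add]

theorem Omega_smul_left {q : H →L[ℂ] H} (hq : q ∈ projections H) (c : ℂ) (A B : H →L[ℂ] H) :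
    Omega q (c • A) B = c * Omega q A B := by
  obtain ⟨x, y, -, rfl⟩ := exists_eq_rankOne hq
  simp only [Omega_rankOne_eq]
  rw [show comm (c • A) B = c • comm A B by
    simp only [comm, smul_mul_assoc, mul_smul_comm, smul_sub],
    _root_.smul_apply, inner_smul_right]
  ring

theorem Omega_antisymm {q : H →L[ℂ] H} (hq : q ∈ projections H) (A B : H →L[ℂ] H) :
    Omega q A B = - Omega q B A := by
  obtain ⟨x, y, -, rfl⟩ := exists_eq_rankOne hq
  simp only [Omega_rankOne_eq]
  rw [comm_swap A B, _root_.neg_apply, inner_neg_right, mul_neg]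

theorem strJJ_mem_tangent {q : H →L[ℂ] H} (hq : q ∈ projections H) (A : H →L[ℂ] H) :
    strJJ q A ∈ tangent q :=
  sub_mem (smul_mem_tangent _ (comm_mem_tangent hq _)) (smul_mem_tangent _ (comm_mem_tangent hq _))

theorem strJ_mem_tangent {q : H →L[ℂ] H} (hq : q ∈ projections H) (A : H →L[ℂ] H) :
    strJ q A ∈ tangent q := by
  rw [strJ, comm_swap]
  exact smul_mem_tangent _ (neg_mem (comm_mem_tangent hq _))

theorem tr_star_mul_rankOne (A : H →L[ℂ] H) (x y : H) :
    tr (star A * rankOne ℂ x y) = ⟪A y, x⟫_ℂ := by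
  rw [mul_rankOne, tr_rankOne]
  exact ContinuousLinearMap.adjoint_inner_right A y x

theorem strJJ_add {q : H →L[ℂ] H} (hq : q ∈ projections H) (A B : H →L[ℂ] H) :
    strJJ q (A + B) = strJJ q A + strJJ q B := by
  obtain ⟨x, y, -, rfl⟩ := exists_eq_rankOne hq
  simp only [strJJ, tr_star_mul_rankOne, _root_.add_apply, inner_add_left]
  rw [show comm (rankOne ℂ x y) (star (A + B)) = comm (rankOne ℂ x y) (star A)
    + comm (rankOne ℂ x y) (star B) by rw [star_add]; simp only [comm]; noncomm_ring]
  module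

/-- The endomorphism `𝐉` is antilinear. -/
theorem strJJ_smul {q : H →L[ℂ] H} (hq : q ∈ projections H) (c : ℂ) (A : H →L[ℂ] H) :
    strJJ q (c • A) = conj c • strJJ q A := by
  obtain ⟨x, y, -, rfl⟩ := exists_eq_rankOne hq
  simp only [strJJ, tr_star_mul_rankOne, _root_.smul_apply, inner_smul_left]
  rw [show comm (rankOne ℂ x y) (star (c • A)) = conj c • comm (rankOne ℂ x y) (star A) by
    rw [star_smul]; simp only [comm, smul_mul_assoc, mul_smul_comm, smul_sub, Complex.star_def]]
  module

theorem herm_eq_Omega_iff {q A C : H →L[ℂ] H} (hq : q ∈ projections H) (hA : A ∈ tangent q)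
    (hC : C ∈ tangent q) :
    (∀ B ∈ tangent q, herm q C B = Omega q A B) ↔ C = strJJ q A := by
  refine ⟨fun h => ?_, ?_⟩
  · have hJ := strJJ_mem_tangent hq A
    have hD : C - strJJ q A ∈ tangent q := sub_mem hC hJ
    have hDS := isHS_of_mem_tangent hq hD
    have h1 := h _ hD
    rw [← herm_strJJ hq hA hD] at h1
    have h2 := herm_add_left hq (isHS_of_mem_tangent hq hJ) hDS hDS
    rw [add_sub_cancel, h1] at h2
    refine sub_eq_zero.1 (eq_zero_of_metric_self hq hDS ?_)
    rw [metric, left_eq_add.1 h2, Complex.zero_re]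
  · rintro rfl B hB
    exact herm_strJJ hq hA hB

theorem comm_rankOne {x y a b : H} (h : ⟪y, x⟫_ℂ = 1) (ha : ⟪a, x⟫_ℂ = 0)
    (hb : ⟪y, b⟫_ℂ = 0) :
    comm (rankOne ℂ x a + rankOne ℂ b y) (rankOne ℂ x y) = rankOne ℂ b y - rankOne ℂ x a := by
  simp only [comm, mul_add, add_mul, rankOne_mul_rankOne, h, ha, hb]
  module

theorem strJ_strJ {q A : H →L[ℂ] H} (hq : q ∈ projections H) (hA : A ∈ tangent q) :
    strJ q (strJ q A) = - A := by
  obtain ⟨x, y, h, rfl⟩ := exists_eq_rankOne hq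
  obtain ⟨a, b, ha, hb, rfl⟩ := exists_eq_of_mem_tangent h hA
  have hc : ∀ B : H →L[ℂ] H, comm (Complex.I • B) (rankOne ℂ x y)
      = Complex.I • comm B (rankOne ℂ x y) := fun B => by
    simp only [comm, smul_mul_assoc, mul_smul_comm, smul_sub]
  simp only [strJ, hc, comm_rankOne h ha hb, smul_smul, Complex.I_mul_I]
  rw [show rankOne ℂ b y - rankOne ℂ x a = rankOne ℂ x (-a) + rankOne ℂ b y by
    rw [map_neg]; abel, comm_rankOne h (by simp [ha]) hb, map_neg]
  module

theorem Omega_strJ {q A B : H →L[ℂ] H} (hq : q ∈ projections H) (hA : A ∈ tangent q)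
    (hB : B ∈ tangent q) : Omega q (strJ q A) (strJ q B) = Omega q A B := by
  obtain ⟨x, y, h, rfl⟩ := exists_eq_rankOne hq
  obtain ⟨a, b, ha, hb, rfl⟩ := exists_eq_of_mem_tangent h hA
  obtain ⟨c, d, hc, hd, rfl⟩ := exists_eq_of_mem_tangent h hB
  have key : ∀ a b : H, Complex.I • (rankOne ℂ b y - rankOne ℂ x a)
      = rankOne ℂ x (Complex.I • a) + rankOne ℂ (Complex.I • b) y := by
    intro a b
    ext v
    simp only [rankOne_apply, _root_.smul_apply, _root_.sub_apply, _root_.add_apply,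
      inner_smul_left, Complex.conj_I]
    module
  simp only [strJ, comm_rankOne h ha hb, comm_rankOne h hc hd, key]
  rw [Omega_rankOne h (by simp [ha]) (by simp [hb])
    (by simp [hc]) (by simp [hd]), Omega_rankOne h ha hb hc hd]
  simp only [inner_smul_left, inner_smul_right, Complex.conj_I]
  linear_combination (-Complex.I * (⟪a, d⟫_ℂ - ⟪c, b⟫_ℂ)) * Complex.I_mul_I

theorem zero_notMem_projections : (0 : H →L[ℂ] H) ∉ projections H := by
  intro h
  have := hsNorm_pos h
  simp [hsNorm, tr] at this

/-! ### The trace-class norm -/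

theorem hsNorm_eq_traceNorm {q : H →L[ℂ] H} (hq : q ∈ projections H) :
    hsNorm q = traceNorm q := by
  obtain ⟨x, y, h, hq', hx, hy⟩ := exists_eq_rankOne_balanced hq
  have hs : CFC.sqrt (star q * q) = rankOne ℂ y y := by
    refine CFC.sqrt_unique ?_ ?_
    · rw [hq', star_rankOne, rankOne_mul_rankOne, rankOne_mul_rankOne, hx, hy]
    · exact (ContinuousLinearMap.nonneg_iff_isPositive _).2 (isPositive_rankOne_self y)
  rw [traceNorm, hs, tr_rankOne, hy, Complex.ofReal_re]

/-! ### Rank-one projections as covectors on projective space -/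

theorem inner_star_left (A : H →L[ℂ] H) (v w : H) : ⟪star A v, w⟫_ℂ = ⟪v, A w⟫_ℂ :=
  ContinuousLinearMap.adjoint_inner_left A w v

theorem exists_eq_rankOne_unit {q : H →L[ℂ] H} (hq : q ∈ projections H) :
    ∃ x y : H, ⟪x, x⟫_ℂ = 1 ∧ ⟪y, x⟫_ℂ = 1 ∧ q = rankOne ℂ x y := by
  obtain ⟨x, y, h, rfl⟩ := exists_eq_rankOne hq
  have hx : x ≠ 0 := by rintro rfl; simp at h
  have hx' : (‖x‖ : ℂ) ≠ 0 := by exact_mod_cast norm_ne_zero_iff.2 hx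
  refine ⟨((‖x‖⁻¹ : ℝ) : ℂ) • x, (‖x‖ : ℂ) • y, ?_, ?_, ?_⟩
  · rw [inner_smul_left, inner_smul_right, Complex.conj_ofReal, inner_self_eq_norm_sq_to_K]
    push_cast
    simp only [Complex.coe_algebraMap]
    field_simp
  · rw [inner_smul_left, inner_smul_right, h, Complex.conj_ofReal]
    push_cast
    field_simp
  · ext v
    simp only [rankOne_apply, inner_smul_left, Complex.conj_ofReal, smul_smul]
    congr 1
    push_cast
    field_simp

/-- The orthogonal projection `q q* / ‖q‖²` onto the image of `q`. -/
noncomputable def imageProj (q : H →L[ℂ] H) : H →L[ℂ] H :=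
  ((hsNorm q : ℂ) ^ 2)⁻¹ • (q * star q)

theorem imageProj_rankOne {x y : H} (hx : ⟪x, x⟫_ℂ = 1) (h : ⟪y, x⟫_ℂ = 1) :
    imageProj (rankOne ℂ x y) = rankOne ℂ x x := by
  have hr : (hsNorm (rankOne ℂ x y) : ℂ) ≠ 0 := by
    exact_mod_cast (hsNorm_pos (rankOne_mem_projections h)).ne'
  have hy : ⟪y, y⟫_ℂ = (hsNorm (rankOne ℂ x y) : ℂ) ^ 2 := by
    have hx1 : ‖x‖ ^ 2 = 1 := by
      rw [inner_self_eq_norm_sq_to_K] at hx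
      simp only [Complex.coe_algebraMap] at hx
      exact_mod_cast hx
    rw [hsNorm_rankOne, inner_self_eq_norm_sq_to_K]
    simp only [Complex.coe_algebraMap]
    norm_cast
    rw [mul_pow, hx1, one_mul]
  rw [imageProj, star_rankOne, rankOne_mul_rankOne, hy, smul_smul, inv_mul_cancel₀ (pow_ne_zero 2 hr),
    one_smul]

theorem imageProj_mem {q : H →L[ℂ] H} (hq : q ∈ projections H) : imageProj q ∈ projSpace H := by
  obtain ⟨x, y, hx, h, rfl⟩ := exists_eq_rankOne_unit hq
  rw [imageProj_rankOne hx h]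
  exact ⟨rankOne_mem_projections hx, star_rankOne x x⟩

theorem range_rankOne {x y : H} (hy : y ≠ 0) :
    LinearMap.range ((rankOne ℂ x y : H →L[ℂ] H) : H →ₗ[ℂ] H) = Submodule.span ℂ {x} := by
  refine le_antisymm ?_ ?_
  · rintro _ ⟨v, rfl⟩
    exact Submodule.smul_mem _ _ (Submodule.mem_span_singleton_self x)
  · rw [Submodule.span_singleton_le_iff_mem]
    refine ⟨(⟪y, y⟫_ℂ)⁻¹ • y, ?_⟩
    simp only [ContinuousLinearMap.coe_coe, rankOne_apply, inner_smul_right]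
    rw [inv_mul_cancel₀ (inner_self_ne_zero.2 hy), one_smul]

theorem range_imageProj {q : H →L[ℂ] H} (hq : q ∈ projections H) :
    LinearMap.range (imageProj q : H →ₗ[ℂ] H) = LinearMap.range (q : H →ₗ[ℂ] H) := by
  obtain ⟨x, y, hx, h, rfl⟩ := exists_eq_rankOne_unit hq
  rw [imageProj_rankOne hx h, range_rankOne (by rintro rfl; simp at h),
    range_rankOne (by rintro rfl; simp at h)]

theorem eq_rankOne_of_mem_projSpace {p : H →L[ℂ] H} (hp : p ∈ projSpace H) :
    ∃ x : H, ⟪x, x⟫_ℂ = 1 ∧ p = rankOne ℂ x x := by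
  obtain ⟨x, y, hx, h, rfl⟩ := exists_eq_rankOne_unit hp.1
  have h1 := congrArg (fun f : H →L[ℂ] H => f x) hp.2
  simp only [star_rankOne, rankOne_apply, hx, h, one_smul] at h1
  exact ⟨x, hx, by rw [h1]⟩

/-- A projection is determined by a unit vector `x` in its image and the vector `q* x`. -/
theorem eq_rankOne_star {q : H →L[ℂ] H} (hq : q ∈ projections H) {x : H} (hx : ⟪x, x⟫_ℂ = 1)
    (hp : imageProj q = rankOne ℂ x x) :
    q = rankOne ℂ x (star q x) ∧ ⟪star q x, x⟫_ℂ = 1 := by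
  obtain ⟨x', y', hx', h', rfl⟩ := exists_eq_rankOne_unit hq
  rw [imageProj_rankOne hx' h'] at hp
  have h1 : rankOne ℂ x x * rankOne ℂ x' y' = rankOne ℂ x' y' := by
    rw [← hp, rankOne_mul_rankOne, hx', one_smul]
  have h2 : rankOne ℂ x' y' * rankOne ℂ x x = rankOne ℂ x x := by
    rw [← hp, rankOne_mul_rankOne, h', one_smul]
  refine ⟨by rw [← rankOne_mul, h1], ?_⟩
  rw [inner_star_left]
  have h3 : ⟪x, rankOne ℂ x' y' (rankOne ℂ x x x)⟫_ℂ = ⟪x, rankOne ℂ x x x⟫_ℂ :=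
    congrArg (fun f : H →L[ℂ] H => ⟪x, f x⟫_ℂ) h2
  rw [rankOne_apply x, hx, one_smul, hx] at h3
  exact h3

theorem tr_sub_mul (x y : H) (A : H →L[ℂ] H) :
    tr ((rankOne ℂ x y - rankOne ℂ x x) * A) = ⟪y - x, A x⟫_ℂ := by
  rw [← map_sub, rankOne_mul, tr_rankOne, inner_star_left]

theorem exists_covector {q : H →L[ℂ] H} (hq : q ∈ projections H) :
    ∃ L : projTangent (imageProj q) →L[ℝ] ℝ, ∀ A : projTangent (imageProj q),
      L A = (tr ((q - imageProj q) * (A : H →L[ℂ] H))).re := by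
  obtain ⟨x, y, hx, h, rfl⟩ := exists_eq_rankOne_unit hq
  refine ⟨Complex.reCLM ∘L (((innerSL ℂ (y - x)) ∘L
    (ContinuousLinearMap.apply ℂ H x)).restrictScalars ℝ) ∘L Submodule.subtypeL _, fun A => ?_⟩
  have h1 := tr_sub_mul x y A
  rw [← imageProj_rankOne hx h] at h1
  rw [h1]
  rfl

/-- The covector `A ↦ Re Tr ((q - p) A)` at the orthogonal projection `p` onto the image of `q`. -/
noncomputable def toCotangent (q : projections H) : Cotangent H :=
  ⟨⟨imageProj q, imageProj_mem q.2⟩, (exists_covector q.2).choose⟩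

theorem toCotangent_apply (q : projections H) (A : projTangent (imageProj (q : H →L[ℂ] H))) :
    (toCotangent q).2 A = (tr (((q : H →L[ℂ] H) - imageProj q) * (A : H →L[ℂ] H))).re :=
  (exists_covector q.2).choose_spec A

theorem Cotangent.ext_iff {s t : Cotangent H} :
    s = t ↔ (s.1 : H →L[ℂ] H) = t.1 ∧ ∀ (A : H →L[ℂ] H) (h : A ∈ projTangent (s.1 : H →L[ℂ] H))
      (h' : A ∈ projTangent (t.1 : H →L[ℂ] H)), s.2 ⟨A, h⟩ = t.2 ⟨A, h'⟩ := by
  refine ⟨by rintro rfl; exact ⟨rfl, fun _ _ _ => rfl⟩, ?_⟩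
  obtain ⟨⟨p, hp⟩, s⟩ := s
  obtain ⟨⟨p', hp'⟩, t⟩ := t
  rintro ⟨h1, h2⟩
  dsimp only at h1
  subst h1
  congr 1
  exact ContinuousLinearMap.ext fun A => h2 A A.2 A.2

theorem rankOne_add_rankOne_mem_projTangent {x a : H} (hx : ⟪x, x⟫_ℂ = 1) (ha : ⟪x, a⟫_ℂ = 0) :
    rankOne ℂ x a + rankOne ℂ a x ∈ projTangent (rankOne ℂ x x) :=
  ⟨rankOne_add_rankOne_mem_tangent hx (by rw [← inner_conj_symm, ha, map_zero]) ha, by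
    rw [star_add, star_rankOne, star_rankOne, add_comm]⟩

theorem toCotangent_injective : Function.Injective (toCotangent (H := H)) := by
  rintro ⟨q, hq⟩ ⟨q', hq'⟩ h
  obtain ⟨h1, h2⟩ := Cotangent.ext_iff.1 h
  change imageProj q = imageProj q' at h1
  obtain ⟨x, hx, hp⟩ := eq_rankOne_of_mem_projSpace (imageProj_mem hq)
  obtain ⟨e, f⟩ := eq_rankOne_star hq hx hp
  obtain ⟨e', f'⟩ := eq_rankOne_star hq' hx (h1 ▸ hp)
  set y := star q x
  set y' := star q' x
  have hf : ⟪y - y', x⟫_ℂ = 0 := by rw [inner_sub_left, f, f', sub_self]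
  have hf' : ⟪x, y - y'⟫_ℂ = 0 := by rw [← inner_conj_symm, hf, map_zero]
  have hA := rankOne_add_rankOne_mem_projTangent hx hf'
  have h3 := h2 _ (show _ ∈ projTangent (imageProj q) from hp ▸ hA)
    (show _ ∈ projTangent (imageProj q') from h1 ▸ hp ▸ hA)
  erw [toCotangent_apply ⟨q, hq⟩, toCotangent_apply ⟨q', hq'⟩] at h3
  simp only at h3
  rw [← h1, hp, e, e', tr_sub_mul, tr_sub_mul, ← sub_eq_zero, ← Complex.sub_re, ← inner_sub_left,
    sub_sub_sub_cancel_right, _root_.add_apply, rankOne_apply, rankOne_apply, hf, hx, zero_smul,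
    zero_add, one_smul] at h3
  have h4 : y - y' = 0 := by
    rw [← norm_eq_zero, ← sq_eq_zero_iff (a := ‖y - y'‖), ← inner_self_eq_norm_sq (𝕜 := ℂ)]
    exact h3
  ext1
  change q = q'
  rw [e, e', sub_eq_zero.1 h4]

/-- Surjectivity is the Riesz representation theorem on the orthogonal complement of the image. -/
theorem toCotangent_surjective : Function.Surjective (toCotangent (H := H)) := by
  rintro ⟨⟨p, hp⟩, l⟩
  obtain ⟨x, hx, rfl⟩ := eq_rankOne_of_mem_projSpace hp
  let P : H →ₗ[ℝ] H := LinearMap.restrictScalars ℝ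
    (LinearMap.id - (rankOne ℂ x x : H →L[ℂ] H).toLinearMap)
  have hPdef : ∀ a, P a = a - ⟪x, a⟫_ℂ • x := fun a => rfl
  have hP : ∀ a, ⟪x, P a⟫_ℂ = 0 := fun a => by
    rw [hPdef, inner_sub_right, inner_smul_right, hx, mul_one, sub_self]
  have hPn : ∀ a, ‖P a‖ ≤ (1 + ‖x‖ * ‖x‖) * ‖a‖ := fun a => by
    rw [hPdef, add_mul, one_mul]
    refine (norm_sub_le _ _).trans (add_le_add le_rfl ?_)
    rw [norm_smul]
    nlinarith [norm_inner_le_norm (𝕜 := ℂ) x a, norm_nonneg x]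
  let lin : H →ₗ[ℝ] ℝ :=
    { toFun := fun a => l ⟨_, rankOne_add_rankOne_mem_projTangent hx (hP a)⟩
      map_add' := fun a b => by
        rw [← map_add]; congr 1; ext1
        simp only [map_add, _root_.add_apply, Submodule.coe_add]
        abel
      map_smul' := fun r a => by
        rw [RingHom.id_apply, ← map_smul]; congr 1; ext1
        simp only [map_smul, Submodule.coe_smul, rankOne_real_smul_left,
          rankOne_real_smul_right, smul_add] }
  let L : H →L[ℝ] ℝ := lin.mkContinuous (‖l‖ * (2 * (‖x‖ * (1 + ‖x‖ * ‖x‖)))) fun a => by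
    refine (l.le_opNorm _).trans ?_
    rw [mul_assoc ‖l‖]
    refine mul_le_mul_of_nonneg_left ?_ (norm_nonneg l)
    refine (norm_add_le (rankOne ℂ x (P a)) (rankOne ℂ (P a) x)).trans ?_
    rw [norm_rankOne, norm_rankOne]
    nlinarith [hPn a, norm_nonneg x]
  let _ : InnerProductSpace ℝ H := InnerProductSpace.rclikeToReal ℂ H
  obtain ⟨c, hc⟩ := (InnerProductSpace.toDual ℝ H).surjective L
  have hc' : ∀ a, (⟪c, a⟫_ℂ).re = l ⟨_, rankOne_add_rankOne_mem_projTangent hx (hP a)⟩ := fun a =>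
    congrArg (fun f : H →L[ℝ] ℝ => f a) hc
  have hPx : ⟪P c, x⟫_ℂ = 0 := by rw [← inner_conj_symm, hP, map_zero]
  have hy : ⟪x + P c, x⟫_ℂ = 1 := by rw [inner_add_left, hx, hPx, add_zero]
  refine ⟨⟨rankOne ℂ x (x + P c), rankOne_mem_projections hy⟩,
    Cotangent.ext_iff.2 ⟨imageProj_rankOne hx hy, fun A h h' => ?_⟩⟩
  erw [toCotangent_apply ⟨rankOne ℂ x (x + P c), rankOne_mem_projections hy⟩]
  simp only
  rw [imageProj_rankOne hx hy, tr_sub_mul, add_sub_cancel_left]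
  obtain ⟨a, b, ha, hb, rfl⟩ := exists_eq_of_mem_tangent hx h'.1
  have hab : a = b := by
    have h1 := congrArg (fun f : H →L[ℂ] H => f x) h'.2
    simpa only [star_add, star_rankOne, _root_.add_apply, rankOne_apply, hx, ha,
      ← inner_conj_symm b x, hb, map_zero, zero_smul, one_smul, zero_add, add_zero] using h1
  subst hab
  have hPa : P a = a := by rw [hPdef, hb, zero_smul, sub_zero]
  have h2 := hc' a
  simp only [hPa] at h2
  rw [← h2, _root_.add_apply, rankOne_apply, rankOne_apply, hx, ha, zero_smul, one_smul, zero_add,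
    hPdef, inner_sub_left, inner_smul_left, hb, mul_zero, sub_zero]

/-- Rank-one projections correspond to covectors on projective space. -/
noncomputable def cotangentEquiv : projections H ≃ Cotangent H :=
  Equiv.ofBijective toCotangent ⟨toCotangent_injective, toCotangent_surjective⟩

end RankOne

namespace EmbGeom

open Set Filter Topology

section Forms

variable {F : Type u} [NormedAddCommGroup F] [NormedSpace ℝ F]
  {G : Type v} [NormedAddCommGroup G] [NormedSpace ℝ G]

/-! ### Closed forms in coordinates -/

/-- The coordinate formula for `d(dθ) = 0`. -/
theorem cyclic_fderiv_of_exact {E : Type*} [NormedAddCommGroup E] [NormedSpace ℝ E] {x : E}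
    {θ : E → E →L[ℝ] G} (hθ : ContDiffAt ℝ ∞ θ x) {w : E → E → E → G}
    (hw : ∀ᶠ y in 𝓝 x, ∀ a b, w y a b = fderiv ℝ θ y a b - fderiv ℝ θ y b a) (a b c : E) :
    fderiv ℝ (fun y => w y b c) x a - fderiv ℝ (fun y => w y a c) x b
      + fderiv ℝ (fun y => w y a b) x c = 0 := by
  have hd : DifferentiableAt ℝ (fderiv ℝ θ) x :=
    (hθ.fderiv_right (m := 1) (by norm_cast)).differentiableAt (by simp)
  have hsymm : IsSymmSndFDerivAt ℝ θ x :=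
    hθ.isSymmSndFDerivAt (by simp [minSmoothness_of_isRCLikeNormedField]; norm_cast)
  have key : ∀ a b c : E, fderiv ℝ (fun y => w y b c) x a
      = fderiv ℝ (fderiv ℝ θ) x a b c - fderiv ℝ (fderiv ℝ θ) x a c b := by
    intro a b c
    have h1 : (fun y => w y b c) =ᶠ[𝓝 x] fun y => fderiv ℝ θ y b c - fderiv ℝ θ y c b :=
      hw.mono fun y hy => hy b c
    have h2 : HasFDerivAt (fderiv ℝ θ) (fderiv ℝ (fderiv ℝ θ) x) x := hd.hasFDerivAt
    have h3 : ∀ u v : E, HasFDerivAt (fun y => fderiv ℝ θ y u v)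
        (((fderiv ℝ (fderiv ℝ θ) x).flip u).flip v) x := fun u v => by
      have h4 := (h2.clm_apply (hasFDerivAt_const u x)).clm_apply (hasFDerivAt_const v x)
      simpa using h4
    have h5 : HasFDerivAt (fun y => fderiv ℝ θ y b c - fderiv ℝ θ y c b) _ x :=
      (h3 b c).sub (h3 c b)
    rw [h1.fderiv_eq, h5.fderiv]
    rfl
  rw [key a b c, key b a c, key c a b, hsymm.eq a b, hsymm.eq a c, hsymm.eq b c]
  abel

theorem IsLocalParam.mem {S : Set F} {T : F → Submodule ℝ F} {E : Type u} [NormedAddCommGroup E]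
    [NormedSpace ℝ E] {V : Set E} {ψ : E → F} (h : IsLocalParam S T V ψ) {x : E} (hx : x ∈ V) :
    ψ x ∈ S := by
  obtain ⟨U, φ, -, him, -⟩ := h.inverse
  exact (him.subset (mem_image_of_mem ψ hx)).1

theorem IsLocalParam.fderiv_mem {S : Set F} {T : F → Submodule ℝ F} {E : Type u}
    [NormedAddCommGroup E] [NormedSpace ℝ E] {V : Set E} {ψ : E → F} (h : IsLocalParam S T V ψ)
    {x : E} (hx : x ∈ V) (a : E) : fderiv ℝ ψ x a ∈ T (ψ x) := by
  have := h.range_fderiv x hx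
  exact this.subset (mem_range_self a)

theorem IsLocalParam.contDiffAt {S : Set F} {T : F → Submodule ℝ F} {E : Type u}
    [NormedAddCommGroup E] [NormedSpace ℝ E] {V : Set E} {ψ : E → F} (h : IsLocalParam S T V ψ)
    {x : E} (hx : x ∈ V) : ContDiffAt ℝ ∞ ψ x :=
  h.smooth.contDiffAt (h.isOpen.mem_nhds hx)

/-- `w` is smooth and exact in the coordinates `ψ` around `x`. -/
def IsLocallyExactAt (w : F → F → F → G) {E : Type u} [NormedAddCommGroup E] [NormedSpace ℝ E]
    (ψ : E → F) (x : E) : Prop :=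
  ∃ θ : E → E →L[ℝ] G, ContDiffAt ℝ ∞ θ x ∧
    ∀ᶠ y in 𝓝 x, ∀ a b, pullback₂ w ψ y a b = fderiv ℝ θ y a b - fderiv ℝ θ y b a

theorem isSmoothTensor₂_of_contDiffAt {S : Set F} {T : F → Submodule ℝ F} {w : F → F → F → G}
    (h : ∀ (E : Type u) [NormedAddCommGroup E] [NormedSpace ℝ E] (V : Set E) (ψ : E → F),
      IsLocalParam S T V ψ → ∀ x ∈ V, ∃ f : E × E × E → G, (∀ a b, ContDiffAt ℝ ∞ f (x, a, b)) ∧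
        ∀ᶠ y in 𝓝 x, ∀ a b, pullback₂ w ψ y a b = f (y, a, b)) :
    IsSmoothTensor₂ S T w := by
  intro E _ _ V ψ hψ
  rintro ⟨x, a, b⟩ ⟨hx, -⟩
  obtain ⟨f, hf, hw⟩ := h E V ψ hψ x hx
  refine ((hf a b).congr_of_eventuallyEq ?_).contDiffWithinAt
  have h2 : Tendsto (fun y : E × E × E => y.1) (𝓝 (x, a, b)) (𝓝 x) := continuousAt_fst
  exact (h2.eventually hw).mono fun y hy => hy _ _

/-- A 2-form that is locally exact in all coordinates is smooth and closed. -/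
theorem isClosedTwoForm_of_isLocallyExactAt {S : Set F} {T : F → Submodule ℝ F}
    {w : F → F → F → G}
    (add_left : ∀ q ∈ S, ∀ A ∈ T q, ∀ A' ∈ T q, ∀ B ∈ T q, w q (A + A') B = w q A B + w q A' B)
    (smul_left : ∀ q ∈ S, ∀ (r : ℝ), ∀ A ∈ T q, ∀ B ∈ T q, w q (r • A) B = r • w q A B)
    (antisymm : ∀ q ∈ S, ∀ A ∈ T q, ∀ B ∈ T q, w q A B = - w q B A)
    (h : ∀ (E : Type u) [NormedAddCommGroup E] [NormedSpace ℝ E] (V : Set E) (ψ : E → F),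
      IsLocalParam S T V ψ → ∀ x ∈ V, IsLocallyExactAt w ψ x) :
    IsClosedTwoForm S T w where
  add_left := add_left
  smul_left := smul_left
  antisymm := antisymm
  smooth := by
    refine isSmoothTensor₂_of_contDiffAt fun E _ _ V ψ hψ x hx => ?_
    obtain ⟨θ, hθ, hw⟩ := h E V ψ hψ x hx
    have h1 : ContDiffAt ℝ ∞ (fderiv ℝ θ) x := hθ.fderiv_right (by norm_cast)
    refine ⟨fun y => fderiv ℝ θ y.1 y.2.1 y.2.2 - fderiv ℝ θ y.1 y.2.2 y.2.1, fun a b => ?_, hw⟩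
    have h2 : ContDiffAt ℝ ∞ (fun y : E × E × E => fderiv ℝ θ y.1) (x, a, b) :=
      ContDiffAt.comp (x, a, b) (g := fderiv ℝ θ) h1 contDiffAt_fst
    have h3 : ContDiffAt ℝ ∞ (fun y : E × E × E => y.2.1) (x, a, b) := contDiffAt_snd.fst
    have h4 : ContDiffAt ℝ ∞ (fun y : E × E × E => y.2.2) (x, a, b) := contDiffAt_snd.snd
    exact ((h2.clm_apply h3).clm_apply h4).sub ((h2.clm_apply h4).clm_apply h3)
  closed := by
    intro E _ _ V ψ hψ x hx a b c
    obtain ⟨θ, hθ, hw⟩ := h E V ψ hψ x hx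
    exact cyclic_fderiv_of_exact hθ hw a b c

theorem pullback₂_eventuallyEq {S : Set F} {T : F → Submodule ℝ F} {w w' : F → F → F → G}
    (hw : ∀ q ∈ S, ∀ A ∈ T q, ∀ B ∈ T q, w q A B = w' q A B)
    {E : Type u} [NormedAddCommGroup E] [NormedSpace ℝ E] {V : Set E} {ψ : E → F}
    (hψ : IsLocalParam S T V ψ) {x : E} (hx : x ∈ V) :
    ∀ᶠ y in 𝓝 x, ∀ a b, pullback₂ w ψ y a b = pullback₂ w' ψ y a b :=
  Filter.Eventually.mono (hψ.isOpen.mem_nhds hx) fun _ hy a b =>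
    hw _ (hψ.mem hy) _ (hψ.fderiv_mem hy a) _ (hψ.fderiv_mem hy b)

/-- A locally exact form stays locally exact after composition with a linear map of the values. -/
theorem IsLocallyExactAt.comp {G' : Type*} [NormedAddCommGroup G'] [NormedSpace ℝ G']
    (L : G →L[ℝ] G') {w : F → F → F → G} {E : Type u} [NormedAddCommGroup E] [NormedSpace ℝ E]
    {ψ : E → F} {x : E} (h : IsLocallyExactAt w ψ x) :
    IsLocallyExactAt (fun q A B => L (w q A B)) ψ x := by
  obtain ⟨θ, hθ, hw⟩ := h
  refine ⟨fun y => L ∘L θ y, contDiffAt_const.clm_comp hθ, ?_⟩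
  have h2 : ∀ᶠ y in 𝓝 x, ContDiffAt ℝ 1 θ y := (hθ.of_le (by norm_cast)).eventually (by simp)
  filter_upwards [hw, h2] with y hy hy2 a b
  have h3 : HasFDerivAt (fun y => L ∘L θ y)
      ((ContinuousLinearMap.compL ℝ E G G' L) ∘L fderiv ℝ θ y) y :=
    (ContinuousLinearMap.compL ℝ E G G' L).hasFDerivAt.comp y
      (hy2.differentiableAt (by simp)).hasFDerivAt
  rw [h3.fderiv]
  have := congrArg L (hy a b)
  rw [map_sub] at this
  exact this

theorem IsLocallyExactAt.congr {w w' : F → F → F → G} {E : Type u} [NormedAddCommGroup E]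
    [NormedSpace ℝ E] {ψ : E → F} {x : E} (h : IsLocallyExactAt w ψ x)
    (hw : ∀ᶠ y in 𝓝 x, ∀ a b, pullback₂ w' ψ y a b = pullback₂ w ψ y a b) :
    IsLocallyExactAt w' ψ x := by
  obtain ⟨θ, hθ, h⟩ := h
  exact ⟨θ, hθ, (hw.and h).mono fun y hy a b => (hy.1 a b).trans (hy.2 a b)⟩

end Forms

section Bilinear

variable {E K₁ K₂ G : Type*} [NormedAddCommGroup E] [NormedSpace ℝ E]
  [NormedAddCommGroup K₁] [NormedSpace ℝ K₁] [NormedAddCommGroup K₂] [NormedSpace ℝ K₂]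
  [NormedAddCommGroup G] [NormedSpace ℝ G]

theorem contDiffAt_bilin_fderiv (B : K₁ →L[ℝ] K₂ →L[ℝ] G) {η : E → K₁} {ξ : E → K₂} {x : E}
    (hη : ContDiffAt ℝ ∞ η x) (hξ : ContDiffAt ℝ ∞ ξ x) :
    ContDiffAt ℝ ∞ (fun y => (B (η y)) ∘L fderiv ℝ ξ y) x :=
  (B.contDiff.contDiffAt.comp x hη).clm_comp (hξ.fderiv_right (by norm_cast))

/-- The exterior derivative of the 1-form `B(η, dξ)` is `B(dη ∧ dξ)`: the second derivatives of
`ξ` cancel. -/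
theorem fderiv_bilin_fderiv (B : K₁ →L[ℝ] K₂ →L[ℝ] G) {η : E → K₁} {ξ : E → K₂} {x : E}
    (hη : ContDiffAt ℝ 2 η x) (hξ : ContDiffAt ℝ 2 ξ x) (a b : E) :
    fderiv ℝ (fun y => (B (η y)) ∘L fderiv ℝ ξ y) x a b
      - fderiv ℝ (fun y => (B (η y)) ∘L fderiv ℝ ξ y) x b a
      = B (fderiv ℝ η x a) (fderiv ℝ ξ x b) - B (fderiv ℝ η x b) (fderiv ℝ ξ x a) := by
  have hη' := (hη.differentiableAt (by simp)).hasFDerivAt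
  have hξ' : HasFDerivAt (fderiv ℝ ξ) (fderiv ℝ (fderiv ℝ ξ) x) x :=
    ((hξ.fderiv_right (m := 1) (by norm_num)).differentiableAt (by simp)).hasFDerivAt
  have hsymm : IsSymmSndFDerivAt ℝ ξ x :=
    hξ.isSymmSndFDerivAt (by simp [minSmoothness_of_isRCLikeNormedField])
  have h : HasFDerivAt (fun y => (B (η y)) ∘L fderiv ℝ ξ y) _ x :=
    (B.hasFDerivAt.comp x hη').clm_comp hξ'
  rw [h.fderiv]
  simp only [Function.comp_apply, _root_.add_apply, ContinuousLinearMap.comp_apply,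
    ContinuousLinearMap.flip_apply, ContinuousLinearMap.compL_apply]
  rw [hsymm.eq a b]
  abel

end Bilinear

/-! ### The form `½ d dᶜ` of the norm on a Hilbert space -/

section Norm

variable {E K : Type*} [NormedAddCommGroup E] [NormedSpace ℝ E]
  [NormedAddCommGroup K] [InnerProductSpace ℂ K]

/-- The imaginary part of the inner product, as a bounded real bilinear form. -/
noncomputable def imInner (K : Type*) [NormedAddCommGroup K] [InnerProductSpace ℂ K] :
    K →L[ℝ] K →L[ℝ] ℝ :=
  LinearMap.mkContinuous₂ (LinearMap.mk₂ ℝ (fun u v : K => (⟪u, v⟫_ℂ).im)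
    (fun _ _ _ => by rw [inner_add_left, Complex.add_im])
    (fun r u v => by
      rw [← Complex.coe_smul, inner_smul_left, Complex.conj_ofReal, Complex.im_ofReal_mul,
        smul_eq_mul])
    (fun _ _ _ => by rw [inner_add_right, Complex.add_im])
    (fun r u v => by
      rw [← Complex.coe_smul, inner_smul_right, Complex.im_ofReal_mul, smul_eq_mul])) 1
    (fun u v => by
      rw [one_mul]; exact (Complex.abs_im_le_norm _).trans (norm_inner_le_norm u v))

@[simp] theorem imInner_apply (u v : K) : imInner K u v = (⟪u, v⟫_ℂ).im := rfl

theorem fderiv_norm_comp {Q : E → K} {x : E} (hQ : DifferentiableAt ℝ Q x) (h0 : Q x ≠ 0) (a : E) :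
    HasLineDerivAt ℝ (fun y => ‖Q y‖) ((⟪Q x, fderiv ℝ Q x a⟫_ℂ).re / ‖Q x‖) x a := by
  have h1 : HasDerivAt (fun t : ℝ => Q (x + t • a)) (fderiv ℝ Q x a) 0 :=
    hQ.hasFDerivAt.hasLineDerivAt a
  have h2 := h1.inner ℂ h1
  have h3 : HasDerivAt (fun t : ℝ => (⟪Q (x + t • a), Q (x + t • a)⟫_ℂ).re) _ 0 :=
    Complex.reCLM.hasFDerivAt.comp_hasDerivAt 0 h2
  have h4 := h3.sqrt (by
    simp only [zero_smul, add_zero]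
    rw [inner_self_eq_norm_sq_to_K]
    norm_cast
    exact pow_ne_zero 2 (norm_ne_zero_iff.2 h0))
  have h5 : (fun t : ℝ => Real.sqrt (⟪Q (x + t • a), Q (x + t • a)⟫_ℂ).re)
      = fun t => ‖Q (x + t • a)‖ := by
    funext t
    exact (norm_eq_sqrt_re_inner (𝕜 := ℂ) _).symm
  rw [h5] at h4
  change HasDerivAt (fun t : ℝ => ‖Q (x + t • a)‖) _ 0
  convert! h4 using 1
  simp only [zero_smul, add_zero, Complex.reCLM_apply, Complex.add_re]
  rw [show Real.sqrt (⟪Q x, Q x⟫_ℂ).re = ‖Q x‖ from (norm_eq_sqrt_re_inner (𝕜 := ℂ) _).symm,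
    ← inner_conj_symm (fderiv ℝ Q x a), Complex.conj_re]
  have := norm_ne_zero_iff.2 h0
  field_simp
  ring

/-- The 1-form `½ dᶜ‖Q‖ = Im ⟪Q, dQ⟫ / (2‖Q‖)`. -/
noncomputable def halfDcNorm (Q : E → K) (y : E) : E →L[ℝ] ℝ :=
  imInner K ((2 * ‖Q y‖)⁻¹ • Q y) ∘L fderiv ℝ Q y

theorem contDiffAt_halfDcNorm {Q : E → K} {x : E} (hQ : ContDiffAt ℝ ∞ Q x) (h0 : Q x ≠ 0) :
    ContDiffAt ℝ ∞ (halfDcNorm Q) x := by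
  have hn : ‖Q x‖ ≠ 0 := norm_ne_zero_iff.2 h0
  have hi : ContDiffAt ℝ ∞ (fun y => (2 * ‖Q y‖)⁻¹) x :=
    ContDiffAt.inv (contDiffAt_const.mul (hQ.norm ℂ h0)) (by positivity)
  exact contDiffAt_bilin_fderiv (imInner K) (hi.smul hQ) hQ

theorem fderiv_halfDcNorm {Q : E → K} {x : E} (hQ : ContDiffAt ℝ 2 Q x) (h0 : Q x ≠ 0) (a b : E) :
    fderiv ℝ (halfDcNorm Q) x a b - fderiv ℝ (halfDcNorm Q) x b a
      = (⟪fderiv ℝ Q x a, fderiv ℝ Q x b⟫_ℂ).im / ‖Q x‖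
        - (⟪fderiv ℝ Q x a, Q x⟫_ℂ * ⟪Q x, fderiv ℝ Q x b⟫_ℂ).im / (2 * ‖Q x‖ ^ 3) := by
  have hn : ‖Q x‖ ≠ 0 := norm_ne_zero_iff.2 h0
  have hi : ContDiffAt ℝ 2 (fun y => (2 * ‖Q y‖)⁻¹) x :=
    ContDiffAt.inv (contDiffAt_const.mul (hQ.norm ℂ h0)) (by positivity)
  have hη : ContDiffAt ℝ 2 (fun y => (2 * ‖Q y‖)⁻¹ • Q y) x := hi.smul hQ
  have hd : ∀ a, fderiv ℝ (fun y => (2 * ‖Q y‖)⁻¹ • Q y) x a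
      = (2 * ‖Q x‖)⁻¹ • fderiv ℝ Q x a
        - ((⟪Q x, fderiv ℝ Q x a⟫_ℂ).re / (2 * ‖Q x‖ ^ 3)) • Q x := by
    intro a
    have h1 : HasDerivAt (fun t : ℝ => (2 * ‖Q (x + t • a)‖)⁻¹ • Q (x + t • a)) _ 0 :=
      (hη.differentiableAt (by simp)).hasFDerivAt.hasLineDerivAt a
    have h2 : HasDerivAt (fun t : ℝ => Q (x + t • a)) (fderiv ℝ Q x a) 0 :=
      (hQ.differentiableAt (by simp)).hasFDerivAt.hasLineDerivAt a
    have h3 : HasDerivAt (fun t : ℝ => ‖Q (x + t • a)‖) _ 0 :=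
      fderiv_norm_comp (hQ.differentiableAt (by simp)) h0 a
    have h4 := ((h3.const_mul 2).fun_inv (by simpa using h0)).fun_smul h2
    rw [h1.unique h4]
    simp only [zero_smul, add_zero]
    rw [sub_eq_add_neg, ← neg_smul]
    congr 2
    field_simp
  unfold halfDcNorm
  rw [fderiv_bilin_fderiv (imInner K) hη hQ, hd, hd]
  simp only [map_sub, map_smul, _root_.sub_apply, _root_.smul_apply, imInner_apply, smul_eq_mul,
    Complex.mul_im]
  rw [← inner_conj_symm (fderiv ℝ Q x b) (fderiv ℝ Q x a),
    ← inner_conj_symm (fderiv ℝ Q x a) (Q x)]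
  simp only [Complex.conj_im, Complex.conj_re]
  field_simp
  ring

end Norm

end EmbGeom

namespace RankOne

open InnerProductSpace ContinuousLinearMap EmbGeom Set Filter Topology

variable {H : Type u} [NormedAddCommGroup H] [InnerProductSpace ℂ H] [CompleteSpace H]

/-! ### Families of rank-one projections -/

/-- The Hilbert–Schmidt operator `rankOne ℂ x y`, as a bounded real bilinear function of `x`
and `y` with values in the Hilbert space `HS H`. -/
noncomputable def toHSBilin (H : Type u) [NormedAddCommGroup H] [InnerProductSpace ℂ H]
    [CompleteSpace H] : H →L[ℝ] H →L[ℝ] HS H :=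
  LinearMap.mkContinuous₂ (LinearMap.mk₂ ℝ (fun x y => toHS (rankOne ℂ x y))
    (fun x x' y => by
      rw [map_add, _root_.add_apply, toHS_add (isHS_rankOne _ _) (isHS_rankOne _ _)])
    (fun r x y => by
      rw [rankOne_real_smul_left, real_smul_eq, toHS_smul _ (isHS_rankOne _ _), Complex.coe_smul])
    (fun x y y' => by rw [map_add, toHS_add (isHS_rankOne _ _) (isHS_rankOne _ _)])
    (fun r x y => by
      rw [rankOne_real_smul_right, real_smul_eq, toHS_smul _ (isHS_rankOne _ _), Complex.coe_smul]))
    1 (fun x y => by rw [one_mul]; exact (norm_toHS_rankOne x y).le)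

theorem toHSBilin_apply (x y : H) : toHSBilin H x y = toHS (rankOne ℂ x y) := rfl

theorem contDiff_star : ContDiff ℝ ∞ (fun A : H →L[ℂ] H => star A) :=
  IsBoundedLinearMap.contDiff
    { map_add := star_add
      map_smul := fun r A => by rw [star_smul, star_trivial]
      bound := ⟨1, one_pos, fun A => by rw [norm_star, one_mul]⟩ }

/-- A quadratic form that vanishes identically vanishes as a sesquilinear form; for `q = |x⟩⟨y|`
the three vectors `x`, `y`, `x + y` suffice. -/
theorem exists_inner_ne_zero {q : H →L[ℂ] H} (hq : q ∈ projections H) :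
    ∃ e : H, ⟪e, q e⟫_ℂ ≠ 0 := by
  obtain ⟨x, y, h, rfl⟩ := exists_eq_rankOne hq
  by_contra! h0
  simp only [rankOne_apply, inner_smul_right] at h0
  have h1 := h0 x
  have h2 := h0 (x + y)
  have h3 := h0 y
  simp only [inner_add_left, inner_add_right, h, one_mul, mul_one] at h1 h2 h3
  rw [h1, h3] at h2
  norm_num at h2

theorem eq_rankOne_of_inner_ne_zero {q : H →L[ℂ] H} (hq : q ∈ projections H) {e : H}
    (he : ⟪e, q e⟫_ℂ ≠ 0) : q = rankOne ℂ ((⟪e, q e⟫_ℂ)⁻¹ • q e) (star q e) := by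
  obtain ⟨x, y, h, rfl⟩ := exists_eq_rankOne hq
  rw [star_rankOne]
  ext v
  simp only [rankOne_apply, inner_smul_right, inner_smul_left, inner_conj_symm, smul_smul] at he ⊢
  have h1 := left_ne_zero_of_mul he
  have h2 := right_ne_zero_of_mul he
  congr 1
  field_simp

section Family

variable {E : Type*} [NormedAddCommGroup E] [NormedSpace ℝ E] {ψ : E → H →L[ℂ] H} {x : E}

/-- A smooth family of rank-one projections is locally a smooth family of operators
`rankOne ℂ ξ η`. -/
theorem exists_factorization (hψ : ContDiffAt ℝ ∞ ψ x) (hP : ∀ᶠ y in 𝓝 x, ψ y ∈ projections H) :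
    ∃ ξ η : E → H, ContDiffAt ℝ ∞ ξ x ∧ ContDiffAt ℝ ∞ η x ∧
      ∀ᶠ y in 𝓝 x, ⟪η y, ξ y⟫_ℂ = 1 ∧ ψ y = rankOne ℂ (ξ y) (η y) := by
  obtain ⟨e, he⟩ := exists_inner_ne_zero hP.self_of_nhds
  have h1 : ContDiffAt ℝ ∞ (fun y => ψ y e) x := by
    have : ContDiff ℝ ∞ (fun A : H →L[ℂ] H => A e) :=
      ((ContinuousLinearMap.apply ℂ H e).restrictScalars ℝ).contDiff
    exact this.contDiffAt.comp x hψ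
  have h2 : ContDiffAt ℝ ∞ (fun y => star (ψ y) e) x := by
    have : ContDiff ℝ ∞ (fun A : H →L[ℂ] H => A e) :=
      ((ContinuousLinearMap.apply ℂ H e).restrictScalars ℝ).contDiff
    exact this.contDiffAt.comp x (contDiff_star.contDiffAt.comp x hψ)
  have h3 : ContDiffAt ℝ ∞ (fun y => ⟪e, ψ y e⟫_ℂ) x := contDiffAt_const.inner ℂ h1
  refine ⟨fun y => (⟪e, ψ y e⟫_ℂ)⁻¹ • ψ y e, fun y => star (ψ y) e, (h3.inv he).smul h1, h2, ?_⟩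
  filter_upwards [hP, h3.continuousAt.eventually_ne he] with y hy hy'
  refine ⟨?_, eq_rankOne_of_inner_ne_zero hy hy'⟩
  rw [inner_star_left, map_smul, inner_smul_right,
    show ψ y (ψ y e) = ψ y e from congrArg (fun f : H →L[ℂ] H => f e) hy.1, inv_mul_cancel₀ hy']

theorem fderiv_rankOne {ξ η : E → H} (hξ : DifferentiableAt ℝ ξ x) (hη : DifferentiableAt ℝ η x)
    (a : E) : fderiv ℝ (fun y => (rankOne ℂ (ξ y) (η y) : H →L[ℂ] H)) x a
      = rankOne ℂ (ξ x) (fderiv ℝ η x a) + rankOne ℂ (fderiv ℝ ξ x a) (η x) := by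
  have h := (rankOneBilin H).hasFDerivAt_of_bilinear hξ.hasFDerivAt hη.hasFDerivAt
  simp only [rankOneBilin_apply] at h
  rw [h.fderiv]
  rfl

/-- The lift of a smooth family of rank-one projections to the Hilbert space `HS H` is smooth. -/
theorem contDiffAt_toHS (hψ : ContDiffAt ℝ ∞ ψ x) (hP : ∀ᶠ y in 𝓝 x, ψ y ∈ projections H) :
    ContDiffAt ℝ ∞ (fun y => toHS (ψ y)) x := by
  obtain ⟨ξ, η, hξ, hη, h⟩ := exists_factorization hψ hP
  have h1 : ContDiffAt ℝ ∞ (fun y => toHSBilin H (ξ y) (η y)) x :=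
    ((toHSBilin H).contDiff.contDiffAt.comp x hξ).clm_apply hη
  exact h1.congr_of_eventuallyEq (h.mono fun y hy => by
    dsimp only
    rw [toHSBilin_apply, hy.2])

/-- The derivative of a family of projections is tangent: differentiate `ψ ψ = ψ`. -/
theorem fderiv_mem_tangent (hψ : DifferentiableAt ℝ ψ x)
    (hP : ∀ᶠ y in 𝓝 x, ψ y ∈ projections H) (a : E) : fderiv ℝ ψ x a ∈ tangent (ψ x) := by
  rw [mem_tangent]
  have h1 : (fun y => ψ y * ψ y) =ᶠ[𝓝 x] ψ := hP.mono fun y hy => hy.1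
  have h2 : HasFDerivAt (fun y => ψ y * ψ y) _ x := hψ.hasFDerivAt.mul' hψ.hasFDerivAt
  have h3 := congrArg (fun f : E →L[ℝ] (H →L[ℂ] H) => f a) (h2.fderiv.symm.trans h1.fderiv_eq)
  exact h3

/-- Differentiation commutes with the lift to `HS H`: both sides have the same components. -/
theorem fderiv_toHS (hψ : ContDiffAt ℝ ∞ ψ x) (hP : ∀ᶠ y in 𝓝 x, ψ y ∈ projections H) (a : E) :
    fderiv ℝ (fun y => toHS (ψ y)) x a = toHS (fderiv ℝ ψ x a) := by
  have hd := hψ.differentiableAt (by simp)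
  have hT := isHS_of_mem_tangent hP.self_of_nhds (fderiv_mem_tangent hd hP a)
  refine HS.ext fun i => ?_
  rw [hT.toHS_apply]
  have h1 : HasFDerivAt (fun y => evalHS i (toHS (ψ y)))
      (((evalHS i).restrictScalars ℝ) ∘L
        fderiv ℝ (fun y => toHS (ψ y)) x) x :=
    ((evalHS i).restrictScalars ℝ).hasFDerivAt.comp x
      ((contDiffAt_toHS hψ hP).differentiableAt (by simp)).hasFDerivAt
  have h2 : HasFDerivAt (fun y => ψ y (basis H i))
      (((ContinuousLinearMap.apply ℂ H (basis H i)).restrictScalars ℝ) ∘L fderiv ℝ ψ x) x :=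
    ((ContinuousLinearMap.apply ℂ H (basis H i)).restrictScalars ℝ).hasFDerivAt.comp x
      hd.hasFDerivAt
  have h3 : (fun y => evalHS i (toHS (ψ y))) =ᶠ[𝓝 x] fun y => ψ y (basis H i) :=
    hP.mono fun y hy => (isHS_of_mem_projections hy).toHS_apply i
  exact congrArg (fun f : E →L[ℝ] H => f a) (h1.unique (h2.congr_of_eventuallyEq h3))

end Family

/-! ### Smoothness and closedness in coordinates -/

section Coordinates

variable {E : Type u} [NormedAddCommGroup E] [NormedSpace ℝ E] {V : Set E} {ψ : E → H →L[ℂ] H}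
  {x : E}

theorem eventually_mem (hψ : IsLocalParam (projections H) tangent V ψ) (hx : x ∈ V) :
    ∀ᶠ y in 𝓝 x, ψ y ∈ projections H :=
  Filter.Eventually.mono (hψ.isOpen.mem_nhds hx) fun _ hy => hψ.mem hy

theorem toHS_ne_zero {q : H →L[ℂ] H} (hq : q ∈ projections H) : toHS q ≠ 0 := by
  rw [← norm_ne_zero_iff, ← hsNorm_eq_norm_toHS hq]
  exact (hsNorm_pos hq).ne'

theorem metric_strI {q A B : H →L[ℂ] H} (hq : q ∈ projections H) (hA : IsHS A) (hB : IsHS B) :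
    metric q (strI q A) B = (herm q A B).im := by
  rw [metric, strI, herm_smul_left hq _ hA hB, Complex.conj_I]
  simp

theorem herm_im {q A B : H →L[ℂ] H} (hq : q ∈ projections H) (hA : IsHS A) (hB : IsHS B) :
    (herm q A B).im = (⟪toHS A, toHS B⟫_ℂ).im / ‖toHS q‖
      - (⟪toHS A, toHS q⟫_ℂ * ⟪toHS q, toHS B⟫_ℂ).im / (2 * ‖toHS q‖ ^ 3) := by
  rw [herm_eq_inner hq hA hB, Complex.sub_im, hsNorm_eq_norm_toHS hq]
  congr 1
  · rw [Complex.div_ofReal_im]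
  · rw [← Complex.div_ofReal_im]; push_cast; rfl

/-- The fundamental form `g(I·,·)` is the exterior derivative of `½ dᶜ‖q‖`. -/
theorem pullback_metric_strI (hψ : IsLocalParam (projections H) tangent V ψ) (hx : x ∈ V)
    (a b : E) : pullback₂ (fun q A B => metric q (strI q A) B) ψ x a b
      = fderiv ℝ (halfDcNorm fun y => toHS (ψ y)) x a b
        - fderiv ℝ (halfDcNorm fun y => toHS (ψ y)) x b a := by
  have hs := hψ.contDiffAt hx
  have hP := eventually_mem hψ hx
  have hq := hψ.mem hx
  have hT := fun a => isHS_of_mem_tangent hq (hψ.fderiv_mem hx a)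
  rw [fderiv_halfDcNorm ((contDiffAt_toHS hs hP).of_le (by norm_cast)) (toHS_ne_zero hq),
    fderiv_toHS hs hP, fderiv_toHS hs hP, pullback₂, metric_strI hq (hT a) (hT b),
    herm_im hq (hT a) (hT b)]

theorem isLocallyExactAt_metric_strI (hψ : IsLocalParam (projections H) tangent V ψ) (hx : x ∈ V) :
    IsLocallyExactAt (fun q A B => metric q (strI q A) B) ψ x :=
  ⟨halfDcNorm fun y => toHS (ψ y),
    contDiffAt_halfDcNorm (contDiffAt_toHS (hψ.contDiffAt hx) (eventually_mem hψ hx))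
      (toHS_ne_zero (hψ.mem hx)),
    Filter.Eventually.mono (hψ.isOpen.mem_nhds hx) fun _ hy => pullback_metric_strI hψ hy⟩

/-- The inner product as a bounded real bilinear map with complex values. -/
noncomputable def innerBilin (H : Type u) [NormedAddCommGroup H] [InnerProductSpace ℂ H] :
    H →L[ℝ] H →L[ℝ] ℂ :=
  LinearMap.mkContinuous₂ (LinearMap.mk₂ ℝ (fun u v : H => ⟪u, v⟫_ℂ)
    inner_add_left
    (fun r u v => by
      rw [← Complex.coe_smul, inner_smul_left, Complex.conj_ofReal, Complex.real_smul])
    inner_add_right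
    (fun r u v => by rw [← Complex.coe_smul, inner_smul_right, Complex.real_smul])) 1
    (fun u v => by rw [one_mul]; exact norm_inner_le_norm u v)

@[simp] theorem innerBilin_apply (u v : H) : innerBilin H u v = ⟪u, v⟫_ℂ := rfl

/-- The formula for `Ω` needs only the linearized constraint `⟪y, b⟫ + ⟪a, x⟫ = 0`, which holds
for the derivatives of every factorization. -/
theorem Omega_rankOne_of_constraint {x y a b c d : H} (h : ⟪y, x⟫_ℂ = 1)
    (hA : ⟪y, b⟫_ℂ + ⟪a, x⟫_ℂ = 0) (hB : ⟪y, d⟫_ℂ + ⟪c, x⟫_ℂ = 0) :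
    Omega (rankOne ℂ x y) (rankOne ℂ x a + rankOne ℂ b y) (rankOne ℂ x c + rankOne ℂ d y)
      = Complex.I * (⟪a, d⟫_ℂ - ⟪c, b⟫_ℂ) := by
  rw [Omega_rankOne_eq]
  congr 1
  simp only [comm, mul_add, add_mul, rankOne_mul_rankOne, _root_.add_apply, _root_.sub_apply,
    _root_.smul_apply, rankOne_apply, h, one_smul, inner_add_right, inner_sub_right,
    inner_smul_right, mul_one]
  linear_combination ⟪c, x⟫_ℂ * hA - ⟪a, x⟫_ℂ * hB

/-- In terms of a local factorization `q = rankOne ℂ ξ η`, the form `Ω` is the exterior derivative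
of `i ⟪η, dξ⟫`. -/
theorem isLocallyExactAt_Omega (hψ : IsLocalParam (projections H) tangent V ψ) (hx : x ∈ V) :
    IsLocallyExactAt Omega ψ x := by
  obtain ⟨ξ, η, hξ, hη, h⟩ := exists_factorization (hψ.contDiffAt hx) (eventually_mem hψ hx)
  have hexact : IsLocallyExactAt (fun q A B => -(Complex.I * Omega q A B)) ψ x := by
    refine ⟨_, contDiffAt_bilin_fderiv (innerBilin H) hη hξ, ?_⟩
    have hξ' : ContDiffAt ℝ 2 ξ x := hξ.of_le (by norm_cast)
    have hη' : ContDiffAt ℝ 2 η x := hη.of_le (by norm_cast)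
    filter_upwards [h.eventually_nhds, hξ'.eventually (by simp), hη'.eventually (by simp)]
      with y hy hξy hηy a b
    have h1 : ψ =ᶠ[𝓝 y] fun z => rankOne ℂ (ξ z) (η z) := hy.mono fun z hz => hz.2
    have hd := hξy.differentiableAt (by simp)
    have hd' := hηy.differentiableAt (by simp)
    have hc : ∀ a, ⟪η y, fderiv ℝ ξ y a⟫_ℂ + ⟪fderiv ℝ η y a, ξ y⟫_ℂ = 0 := by
      intro a
      have h2 : (fun z => ⟪η z, ξ z⟫_ℂ) =ᶠ[𝓝 y] fun _ => 1 := hy.mono fun z hz => hz.1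
      have h3 := fderiv_inner_apply ℂ hd' hd a
      rw [h2.fderiv_eq] at h3
      simpa using h3.symm
    rw [fderiv_bilin_fderiv (innerBilin H) hηy hξy, pullback₂, h1.fderiv_eq, h1.self_of_nhds,
      fderiv_rankOne hd hd', fderiv_rankOne hd hd',
      Omega_rankOne_of_constraint hy.self_of_nhds.1 (hc a) (hc b), ← mul_assoc, Complex.I_mul_I,
      innerBilin_apply, innerBilin_apply]
    ring
  have h2 := hexact.comp ((ContinuousLinearMap.mul ℂ ℂ Complex.I).restrictScalars ℝ)
  refine h2.congr (Eventually.of_forall fun y a b => ?_)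
  simp only [pullback₂, ContinuousLinearMap.coe_restrictScalars', ContinuousLinearMap.mul_apply']
  linear_combination (Omega (ψ y) (fderiv ℝ ψ y a) (fderiv ℝ ψ y b)) * Complex.I_mul_I

end Coordinates

end RankOne

namespace EmbGeom

open Set Filter Topology

/-! ### Tangent maps of smooth and of holomorphic maps -/

theorem contDiffAt_fderiv_apply {E F : Type*} [NormedAddCommGroup E] [NormedSpace ℝ E]
    [NormedAddCommGroup F] [NormedSpace ℝ F] {f : E → F} {x : E} (hf : ContDiffAt ℝ ∞ f x) (a : E) :
    ContDiffAt ℝ ∞ (fun y : E × E => fderiv ℝ f y.1 y.2) (x, a) :=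
  (ContDiffAt.comp (x, a) (g := fderiv ℝ f) (hf.fderiv_right (by norm_cast))
    contDiffAt_fst).clm_apply contDiffAt_snd

section Complex

variable {E F : Type*} [NormedAddCommGroup E] [NormedSpace ℂ E]
  [NormedAddCommGroup F] [NormedSpace ℂ F]

/-- The Cauchy–Riemann equations. -/
theorem differentiableAt_complex_of_fderiv_I {f : E → F} {x : E} (hf : DifferentiableAt ℝ f x)
    (hI : ∀ a, fderiv ℝ f x (Complex.I • a) = Complex.I • fderiv ℝ f x a) :
    DifferentiableAt ℂ f x := by
  rw [differentiableAt_iff_restrictScalars ℝ hf]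
  have key : ∀ (c : ℂ) (a : E), fderiv ℝ f x (c • a) = c • fderiv ℝ f x a := by
    intro c a
    have h1 : c • a = c.re • a + c.im • (Complex.I • a) := by
      conv_lhs => rw [← Complex.re_add_im c, add_smul, mul_smul]
      simp only [Complex.coe_smul]
    have h2 : c • fderiv ℝ f x a
        = c.re • fderiv ℝ f x a + c.im • (Complex.I • fderiv ℝ f x a) := by
      conv_lhs => rw [← Complex.re_add_im c, add_smul, mul_smul]
      simp only [Complex.coe_smul]
    rw [h1, h2, map_add, map_smul, map_smul, hI]
  exact ⟨{ toFun := fderiv ℝ f x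
           map_add' := map_add _
           map_smul' := key
           cont := (fderiv ℝ f x).continuous }, rfl⟩

/-- The tangent map of a holomorphic map is holomorphic in the base point and the vector jointly. -/
theorem differentiableAt_complex_fderiv_apply {f : E → F} {x : E} (hf : ContDiffAt ℝ ∞ f x)
    (hI : ∀ᶠ y in 𝓝 x, ∀ a, fderiv ℝ f y (Complex.I • a) = Complex.I • fderiv ℝ f y a) (a : E) :
    DifferentiableAt ℂ (fun y : E × E => fderiv ℝ f y.1 y.2) (x, a) := by
  have hd : HasFDerivAt (fderiv ℝ f) (fderiv ℝ (fderiv ℝ f) x) x :=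
    ((hf.fderiv_right (m := 1) (by norm_cast)).differentiableAt (by simp)).hasFDerivAt
  have hsymm : IsSymmSndFDerivAt ℝ f x :=
    hf.isSymmSndFDerivAt (by simp [minSmoothness_of_isRCLikeNormedField]; norm_cast)
  have h2 : HasFDerivAt (fun y : E × E => fderiv ℝ f y.1 y.2) _ (x, a) :=
    (HasFDerivAt.comp (x, a) (g := fderiv ℝ f) hd hasFDerivAt_fst).clm_apply hasFDerivAt_snd
  refine differentiableAt_complex_of_fderiv_I
    ((contDiffAt_fderiv_apply hf a).differentiableAt (by simp)) ?_
  rintro ⟨u, v⟩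
  rw [h2.fderiv]
  -- the second derivative is complex linear in its second argument, hence in the first one
  have h3 : fderiv ℝ (fderiv ℝ f) x a (Complex.I • u)
      = Complex.I • fderiv ℝ (fderiv ℝ f) x a u := by
    have h4 : ∀ w : E, HasFDerivAt (fun y => fderiv ℝ f y w)
        ((fderiv ℝ (fderiv ℝ f) x).flip w) x := fun w => by
      simpa using hd.clm_apply (hasFDerivAt_const w x)
    have h5 := (h4 (Complex.I • u)).congr_of_eventuallyEq
      (f₁ := fun y => Complex.I • fderiv ℝ f y u) (hI.mono fun y hy => (hy u).symm)
    have h6 : HasFDerivAt (fun y => Complex.I • fderiv ℝ f y u) _ x :=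
      (h4 u).const_smul Complex.I
    exact congrArg (fun L : E →L[ℝ] F => L a) (h5.unique h6)
  have h7 : fderiv ℝ (fderiv ℝ f) x (Complex.I • u) a
      = Complex.I • fderiv ℝ (fderiv ℝ f) x u a := by
    rw [hsymm.eq (Complex.I • u) a, h3, hsymm.eq a u]
  have h8 := hI.self_of_nhds v
  simp only [_root_.add_apply, ContinuousLinearMap.comp_apply, Function.comp_apply, Prod.smul_mk,
    ContinuousLinearMap.coe_fst', ContinuousLinearMap.coe_snd', ContinuousLinearMap.flip_apply]
  rw [h7, h8, smul_add]

end Complex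

end EmbGeom

namespace RankOne

open InnerProductSpace ContinuousLinearMap EmbGeom Set Filter Topology

variable {H : Type u} [NormedAddCommGroup H] [InnerProductSpace ℂ H] [CompleteSpace H]

/-! ### The metric and its fundamental forms -/

theorem isRiemannianMetric_metric :
    IsRiemannianMetric (projections H) tangent metric where
  add_left q hq A hA A' hA' B hB := by
    rw [metric, herm_add_left hq (isHS_of_mem_tangent hq hA) (isHS_of_mem_tangent hq hA')
      (isHS_of_mem_tangent hq hB), Complex.add_re]
    rfl
  smul_left q hq r A hA B hB := by
    rw [metric, real_smul_eq, herm_smul_left hq _ (isHS_of_mem_tangent hq hA)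
      (isHS_of_mem_tangent hq hB), Complex.conj_ofReal, Complex.re_ofReal_mul]
    rfl
  symm q hq A hA B hB := by
    rw [metric, ← conj_herm hq (isHS_of_mem_tangent hq hB) (isHS_of_mem_tangent hq hA),
      Complex.conj_re]
    rfl
  coercive q hq := ⟨1 / (2 * hsNorm q), by have := hsNorm_pos hq; positivity,
    fun A hA => le_metric hq (isHS_of_mem_tangent hq hA)⟩
  smooth := by
    refine isSmoothTensor₂_of_contDiffAt fun E _ _ V ψ hψ x hx => ?_
    set Q : E → HS H := fun y => toHS (ψ y) with hQdef
    have hQ : ContDiffAt ℝ ∞ Q x := contDiffAt_toHS (hψ.contDiffAt hx) (eventually_mem hψ hx)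
    have h0 : Q x ≠ 0 := toHS_ne_zero (hψ.mem hx)
    refine ⟨fun y => (⟪fderiv ℝ Q y.1 y.2.1, fderiv ℝ Q y.1 y.2.2⟫_ℂ).re / ‖Q y.1‖
      - (⟪fderiv ℝ Q y.1 y.2.1, Q y.1⟫_ℂ * ⟪Q y.1, fderiv ℝ Q y.1 y.2.2⟫_ℂ).re
        / (2 * ‖Q y.1‖ ^ 3), fun a b => ?_, ?_⟩
    · have hn := norm_ne_zero_iff.2 h0
      have hq : ContDiffAt ℝ ∞ (fun y : E × E × E => Q y.1) (x, a, b) :=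
        ContDiffAt.comp (x, a, b) (g := Q) hQ contDiffAt_fst
      have hnq : ContDiffAt ℝ ∞ (fun y : E × E × E => ‖Q y.1‖) (x, a, b) := hq.norm ℂ h0
      have hA : ContDiffAt ℝ ∞ (fun y : E × E × E => fderiv ℝ Q y.1 y.2.1) (x, a, b) :=
        ContDiffAt.comp (x, a, b) (g := fun z : E × E => fderiv ℝ Q z.1 z.2)
          (contDiffAt_fderiv_apply hQ a) (contDiffAt_fst.prodMk contDiffAt_snd.fst)
      have hB : ContDiffAt ℝ ∞ (fun y : E × E × E => fderiv ℝ Q y.1 y.2.2) (x, a, b) :=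
        ContDiffAt.comp (x, a, b) (g := fun z : E × E => fderiv ℝ Q z.1 z.2)
          (contDiffAt_fderiv_apply hQ b) (contDiffAt_fst.prodMk contDiffAt_snd.snd)
      have hre : ∀ {f : E × E × E → ℂ}, ContDiffAt ℝ ∞ f (x, a, b) →
          ContDiffAt ℝ ∞ (fun y => (f y).re) (x, a, b) := fun hf =>
        Complex.reCLM.contDiff.contDiffAt.comp (x, a, b) hf
      exact ((hre (hA.inner ℂ hB)).div hnq hn).sub
        ((hre ((hA.inner ℂ hq).mul (hq.inner ℂ hB))).div (contDiffAt_const.mul (hnq.pow 3))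
          (by dsimp only; positivity))
    · refine Filter.Eventually.mono (hψ.isOpen.mem_nhds hx) fun y hy a b => ?_
      have hq := hψ.mem hy
      have hP := eventually_mem hψ hy
      rw [pullback₂, metric_eq_inner hq (isHS_of_mem_tangent hq (hψ.fderiv_mem hy a))
        (isHS_of_mem_tangent hq (hψ.fderiv_mem hy b)), hsNorm_eq_norm_toHS hq,
        ← fderiv_toHS (hψ.contDiffAt hy) hP, ← fderiv_toHS (hψ.contDiffAt hy) hP]

theorem isClosedTwoForm_metric_strI :
    IsClosedTwoForm (projections H) tangent (fun q A B => metric q (strI q A) B) := by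
  have hS : ∀ q ∈ projections H, ∀ A ∈ tangent q, ∀ B ∈ tangent q,
      metric q (strI q A) B = (herm q A B).im := fun q hq A hA B hB =>
    metric_strI hq (isHS_of_mem_tangent hq hA) (isHS_of_mem_tangent hq hB)
  refine isClosedTwoForm_of_isLocallyExactAt ?_ ?_ ?_
    fun E _ _ V ψ hψ x hx => isLocallyExactAt_metric_strI hψ hx
  · intro q hq A hA A' hA' B hB
    rw [hS q hq _ (add_mem hA hA') B hB, hS q hq A hA B hB, hS q hq A' hA' B hB,
      herm_add_left hq (isHS_of_mem_tangent hq hA) (isHS_of_mem_tangent hq hA')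
      (isHS_of_mem_tangent hq hB), Complex.add_im]
  · intro q hq r A hA B hB
    rw [hS q hq _ (Submodule.smul_mem _ r hA) B hB, hS q hq A hA B hB, real_smul_eq,
      herm_smul_left hq _ (isHS_of_mem_tangent hq hA) (isHS_of_mem_tangent hq hB),
      Complex.conj_ofReal, Complex.im_ofReal_mul, smul_eq_mul]
  · intro q hq A hA B hB
    rw [hS q hq A hA B hB, hS q hq B hB A hA,
      ← conj_herm hq (isHS_of_mem_tangent hq hB) (isHS_of_mem_tangent hq hA), Complex.conj_im]

/-- A real linear function of the values of `Ω` is a closed 2-form. -/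
theorem isClosedTwoForm_comp_Omega {G : Type*} [NormedAddCommGroup G] [NormedSpace ℝ G]
    (L : ℂ →L[ℝ] G) {w : (H →L[ℂ] H) → (H →L[ℂ] H) → (H →L[ℂ] H) → G}
    (hw : ∀ q ∈ projections H, ∀ A ∈ tangent q, ∀ B ∈ tangent q, w q A B = L (Omega q A B)) :
    IsClosedTwoForm (projections H) tangent w := by
  refine isClosedTwoForm_of_isLocallyExactAt ?_ ?_ ?_ fun E _ _ V ψ hψ x hx =>
    ((isLocallyExactAt_Omega hψ hx).comp L).congr (pullback₂_eventuallyEq hw hψ hx)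
  · intro q hq A hA A' hA' B hB
    rw [hw q hq _ (add_mem hA hA') B hB, hw q hq A hA B hB, hw q hq A' hA' B hB,
      Omega_add_left hq, map_add]
  · intro q hq r A hA B hB
    rw [hw q hq _ (Submodule.smul_mem _ r hA) B hB, hw q hq A hA B hB, real_smul_eq,
      Omega_smul_left hq, ← Complex.real_smul, map_smul]
  · intro q hq A hA B hB
    rw [hw q hq A hA B hB, hw q hq B hB A hA, Omega_antisymm hq, map_neg]

theorem isClosedTwoForm_Omega : IsClosedTwoForm (projections H) tangent Omega :=
  isClosedTwoForm_comp_Omega (ContinuousLinearMap.id ℝ ℂ) fun _ _ _ _ _ _ => rfl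

theorem isClosedTwoForm_metric_strJJ :
    IsClosedTwoForm (projections H) tangent (fun q A B => metric q (strJJ q A) B) :=
  isClosedTwoForm_comp_Omega Complex.reCLM fun q hq A hA B hB => by
    rw [metric, herm_strJJ hq hA hB]; rfl

theorem isClosedTwoForm_metric_strI_strJJ :
    IsClosedTwoForm (projections H) tangent (fun q A B => metric q (strI q (strJJ q A)) B) :=
  isClosedTwoForm_comp_Omega Complex.imCLM fun q hq A hA B hB => by
    rw [metric_strI hq (isHS_of_mem_tangent hq (strJJ_mem_tangent hq A))
      (isHS_of_mem_tangent hq hB), herm_strJJ hq hA hB]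
    rfl

/-! ### The almost complex structures -/

theorem isAlmostComplex_strI : IsAlmostComplex (projections H) tangent strI where
  mem q _ A hA := smul_mem_tangent _ hA
  add q _ A _ B _ := smul_add _ _ _
  smul q _ r A _ := smul_comm _ _ _
  sq q _ A _ := by rw [strI, strI, smul_smul, Complex.I_mul_I, neg_one_smul]
  smooth := by
    rintro E _ _ V ψ hψ ⟨x, a⟩ ⟨hx, -⟩
    exact ((contDiffAt_fderiv_apply (hψ.contDiffAt hx) a).const_smul Complex.I).contDiffWithinAt

theorem contDiffAt_comp_fst {E F : Type*} [NormedAddCommGroup E] [NormedSpace ℝ E]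
    [NormedAddCommGroup F] [NormedSpace ℝ F] {f : E → F} {x : E} (hf : ContDiffAt ℝ ∞ f x) (a : E) :
    ContDiffAt ℝ ∞ (fun y : E × E => f y.1) (x, a) :=
  ContDiffAt.comp (x, a) (g := f) hf contDiffAt_fst

theorem ContDiffAt.comm {E : Type*} [NormedAddCommGroup E] [NormedSpace ℝ E]
    {f g : E → H →L[ℂ] H} {x : E} (hf : ContDiffAt ℝ ∞ f x) (hg : ContDiffAt ℝ ∞ g x) :
    ContDiffAt ℝ ∞ (fun y => RankOne.comm (f y) (g y)) x :=
  (hf.mul hg).sub (hg.mul hf)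

theorem isAlmostComplex_strJ : IsAlmostComplex (projections H) tangent strJ where
  mem q hq A _ := strJ_mem_tangent hq A
  add q _ A _ B _ := by simp only [strJ, comm, add_mul, mul_add]; module
  smul q _ r A _ := by
    simp only [strJ, comm, smul_mul_assoc, mul_smul_comm]; rw [← smul_sub, smul_comm]
  sq q hq A hA := strJ_strJ hq hA
  smooth := by
    rintro E _ _ V ψ hψ ⟨x, a⟩ ⟨hx, -⟩
    have h := hψ.contDiffAt hx
    exact ((ContDiffAt.comm (contDiffAt_fderiv_apply h a)
      (contDiffAt_comp_fst h a)).const_smul Complex.I).contDiffWithinAt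

theorem contDiffAt_strJJ {E : Type u} [NormedAddCommGroup E] [NormedSpace ℝ E] {V : Set E}
    {ψ : E → H →L[ℂ] H} (hψ : IsLocalParam (projections H) tangent V ψ) {x : E} (hx : x ∈ V)
    (a : E) : ContDiffAt ℝ ∞ (fun y : E × E => strJJ (ψ y.1) (fderiv ℝ ψ y.1 y.2)) (x, a) := by
  set Q : E → HS H := fun y => toHS (ψ y) with hQdef
  have h := hψ.contDiffAt hx
  have hQ : ContDiffAt ℝ ∞ Q x := contDiffAt_toHS h (eventually_mem hψ hx)
  have h0 : Q x ≠ 0 := toHS_ne_zero (hψ.mem hx)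
  have hn : ((‖Q x‖ : ℝ) : ℂ) ≠ 0 := Complex.ofReal_ne_zero.2 (norm_ne_zero_iff.2 h0)
  have h1 := contDiffAt_comp_fst h a
  have h2 := contDiffAt_fderiv_apply h a
  have hq := contDiffAt_comp_fst hQ a
  have hr : ContDiffAt ℝ ∞ (fun y : E × E => ((‖Q y.1‖ : ℝ) : ℂ)) (x, a) :=
    Complex.ofRealCLM.contDiff.contDiffAt.comp (x, a) (hq.norm ℂ h0)
  have hA := contDiffAt_fderiv_apply hQ a
  have hs1 : ContDiffAt ℝ ∞ (fun y : E × E => star (fderiv ℝ ψ y.1 y.2)) (x, a) :=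
    contDiff_star.contDiffAt.comp (x, a) h2
  have hs2 : ContDiffAt ℝ ∞ (fun y : E × E => star (ψ y.1)) (x, a) :=
    contDiff_star.contDiffAt.comp (x, a) h1
  have hd1 : ContDiffAt ℝ ∞ (fun y : E × E => Complex.I / ((‖Q y.1‖ : ℝ) : ℂ)) (x, a) := by
    simp only [div_eq_mul_inv]
    exact contDiffAt_const.mul (hr.inv hn)
  have hd2 : ContDiffAt ℝ ∞ (fun y : E × E => Complex.I / (2 * ((‖Q y.1‖ : ℝ) : ℂ) ^ 3)) (x, a) := by
    simp only [div_eq_mul_inv]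
    exact contDiffAt_const.mul ((contDiffAt_const.mul (hr.pow 3)).inv
      (mul_ne_zero two_ne_zero (pow_ne_zero 3 hn)))
  have key : ContDiffAt ℝ ∞ (fun y : E × E =>
      (Complex.I / ((‖Q y.1‖ : ℝ) : ℂ)) • comm (ψ y.1) (star (fderiv ℝ ψ y.1 y.2))
      - (Complex.I / (2 * ((‖Q y.1‖ : ℝ) : ℂ) ^ 3) * ⟪fderiv ℝ Q y.1 y.2, Q y.1⟫_ℂ) •
        comm (ψ y.1) (star (ψ y.1))) (x, a) :=
    (hd1.smul (ContDiffAt.comm h1 hs1)).sub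
      ((hd2.mul (hA.inner ℂ hq)).smul (ContDiffAt.comm h1 hs2))
  refine key.congr_of_eventuallyEq ?_
  filter_upwards [(hψ.isOpen.prod isOpen_univ).mem_nhds (show (x, a) ∈ V ×ˢ univ from ⟨hx, trivial⟩)]
    with y hy
  have hq := hψ.mem hy.1
  rw [strJJ, tr_star_mul (isHS_of_mem_tangent hq (hψ.fderiv_mem hy.1 _))
    (isHS_of_mem_projections hq), hsNorm_eq_norm_toHS hq,
    ← fderiv_toHS (hψ.contDiffAt hy.1) (eventually_mem hψ hy.1)]

/-- The relation `𝐉² = -1` is a hypothesis here; `strJJ_strJJ` reads it off in a chart. -/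
theorem isAlmostComplex_strJJ
    (hsq : ∀ q ∈ projections H, ∀ A ∈ tangent q, strJJ q (strJJ q A) = - A) :
    IsAlmostComplex (projections H) tangent strJJ where
  mem q hq A _ := strJJ_mem_tangent hq A
  add q hq A _ B _ := strJJ_add hq A B
  smul q hq r A _ := by
    rw [real_smul_eq, real_smul_eq, strJJ_smul hq, Complex.conj_ofReal]
  sq := hsq
  smooth := by
    rintro E _ _ V ψ hψ ⟨x, a⟩ ⟨hx, -⟩
    exact (contDiffAt_strJJ hψ hx a).contDiffWithinAt

/-! ### The Kähler potential -/

/-- In `I`-holomorphic coordinates the lift of `q` to `HS H` is holomorphic, so that `halfDcNorm`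
is indeed half of `dᶜ` of the norm. -/
theorem isKahlerPotential_hsNorm :
    IsKahlerPotential (projections H) tangent metric strI hsNorm := by
  intro E _ _ V ψ ⟨hψ, hI⟩
  set Q : E → HS H := fun y => toHS (ψ y) with hQdef
  have hQ : ∀ y ∈ V, ContDiffAt ℝ ∞ Q y := fun y hy =>
    contDiffAt_toHS (hψ.contDiffAt hy) (eventually_mem hψ hy)
  have h0 : ∀ y ∈ V, Q y ≠ 0 := fun y hy => toHS_ne_zero (hψ.mem hy)
  have hf : ∀ y ∈ V, (fun x => hsNorm (ψ x)) =ᶠ[𝓝 y] fun x => ‖Q x‖ := fun y hy =>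
    Filter.Eventually.mono (hψ.isOpen.mem_nhds hy) fun z hz => hsNorm_eq_norm_toHS (hψ.mem hz)
  have hs : ∀ y ∈ V, ContDiffAt ℝ ∞ (fun x => hsNorm (ψ x)) y := fun y hy =>
    ((hQ y hy).norm ℂ (h0 y hy)).congr_of_eventuallyEq (hf y hy)
  have hdc : ∀ y ∈ V, ∀ b, dc (fun x => hsNorm (ψ x)) y b = 2 * halfDcNorm Q y b := by
    intro y hy b
    have hd : DifferentiableAt ℝ (fun x => ‖Q x‖) y :=
      ((hQ y hy).norm ℂ (h0 y hy)).differentiableAt (by simp)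
    have h1 : HasDerivAt (fun t : ℝ => ‖Q (y + t • Complex.I • b)‖) _ 0 :=
      hd.hasFDerivAt.hasLineDerivAt (Complex.I • b)
    have h2 := h1.unique (fderiv_norm_comp ((hQ y hy).differentiableAt (by simp)) (h0 y hy) _)
    have h3 : fderiv ℝ Q y (Complex.I • b) = Complex.I • fderiv ℝ Q y b := by
      have hT := isHS_of_mem_tangent (hψ.mem hy) (hψ.fderiv_mem hy b)
      rw [fderiv_toHS (hψ.contDiffAt hy) (eventually_mem hψ hy),
        fderiv_toHS (hψ.contDiffAt hy) (eventually_mem hψ hy), hI y hy, strI, toHS_smul _ hT]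
    have hn : ‖Q y‖ ≠ 0 := norm_ne_zero_iff.2 (h0 y hy)
    rw [dc, (hf y hy).fderiv_eq, h2, h3, inner_smul_right, halfDcNorm,
      ContinuousLinearMap.comp_apply, map_smul, _root_.smul_apply, imInner_apply, smul_eq_mul]
    simp only [Complex.mul_re, Complex.I_re, Complex.I_im]
    field_simp
    ring
  refine ⟨fun y hy => (hs y hy).contDiffWithinAt, fun x hx a b => ?_⟩
  have key : ∀ a b, fderiv ℝ (fun y => dc (fun x => hsNorm (ψ x)) y b) x a
      = 2 * fderiv ℝ (halfDcNorm Q) x a b := by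
    intro a b
    have h1 : (fun y => dc (fun x => hsNorm (ψ x)) y b) =ᶠ[𝓝 x] fun y => 2 * halfDcNorm Q y b :=
      Filter.Eventually.mono (hψ.isOpen.mem_nhds hx) fun y hy => hdc y hy b
    have hd : HasFDerivAt (halfDcNorm Q) (fderiv ℝ (halfDcNorm Q) x) x :=
      ((contDiffAt_halfDcNorm (hQ x hx) (h0 x hx)).differentiableAt (by simp)).hasFDerivAt
    have h2 : HasFDerivAt (fun y => 2 * halfDcNorm Q y b) _ x :=
      (hd.clm_apply (hasFDerivAt_const b x)).const_mul 2
    rw [h1.fderiv_eq, h2.fderiv]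
    simp
  rw [pullback_metric_strI hψ hx, iddbar, key, key]
  ring

/-! ### The holomorphic symplectic form -/

/-- An expression for `Ω` in which `q` and its derivatives enter holomorphically. -/
theorem Omega_eq_div {q : H →L[ℂ] H} (hq : q ∈ projections H) {e : H} (he : ⟪e, q e⟫_ℂ ≠ 0)
    (A B : H →L[ℂ] H) :
    Omega q A B = Complex.I * (⟪e, (q * comm A B * q) e⟫_ℂ / ⟪e, q e⟫_ℂ) := by
  obtain ⟨x, y, h, rfl⟩ := exists_eq_rankOne hq
  rw [Omega_rankOne_eq]
  congr 1
  rw [rankOne_mul, rankOne_mul_rankOne]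
  simp only [_root_.smul_apply, rankOne_apply, inner_smul_right, inner_star_left] at he ⊢
  have h1 := left_ne_zero_of_mul he
  have h2 := right_ne_zero_of_mul he
  field_simp

theorem isHolomorphicSymplectic_Omega
    (hsq : ∀ q ∈ projections H, ∀ A ∈ tangent q, strJJ q (strJJ q A) = - A) :
    IsHolomorphicSymplectic (projections H) tangent strI Omega where
  closed := isClosedTwoForm_Omega
  nondegenerate q hq A hA h := by
    have hJ := strJJ_mem_tangent hq A
    have h1 : strJJ q A = 0 := by
      refine eq_zero_of_metric_self hq (isHS_of_mem_tangent hq hJ) ?_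
      rw [metric, herm_strJJ hq hA hJ, h _ hJ, Complex.zero_re]
    have h2 := hsq q hq A hA
    have h3 : strJJ q 0 = 0 := by simpa using strJJ_smul hq 0 0
    rw [h1, h3] at h2
    exact neg_eq_zero.1 h2.symm
  complex_linear q hq A _ B _ := Omega_smul_left hq _ A B
  holomorphic := by
    rintro E _ _ V ψ ⟨hψ, hI⟩ ⟨x, a, b⟩ ⟨hx, -⟩
    refine DifferentiableAt.differentiableWithinAt ?_
    have hs := hψ.contDiffAt hx
    have hI' : ∀ᶠ y in 𝓝 x, ∀ a, fderiv ℝ ψ y (Complex.I • a) = Complex.I • fderiv ℝ ψ y a :=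
      Filter.Eventually.mono (hψ.isOpen.mem_nhds hx) fun y hy a => hI y hy a
    obtain ⟨e, he⟩ := exists_inner_ne_zero (hψ.mem hx)
    have hψd : DifferentiableAt ℂ ψ x :=
      differentiableAt_complex_of_fderiv_I (hs.differentiableAt (by simp)) hI'.self_of_nhds
    have h1 : DifferentiableAt ℂ (fun y : E × E × E => ψ y.1) (x, a, b) :=
      DifferentiableAt.comp (x, a, b) (g := ψ) hψd differentiableAt_fst
    have hA : DifferentiableAt ℂ (fun y : E × E × E => fderiv ℝ ψ y.1 y.2.1) (x, a, b) :=
      DifferentiableAt.comp (x, a, b) (g := fun z : E × E => fderiv ℝ ψ z.1 z.2)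
        (f := fun y : E × E × E => (y.1, y.2.1))
        (differentiableAt_complex_fderiv_apply hs hI' a)
        (differentiableAt_fst.prodMk differentiableAt_snd.fst)
    have hB : DifferentiableAt ℂ (fun y : E × E × E => fderiv ℝ ψ y.1 y.2.2) (x, a, b) :=
      DifferentiableAt.comp (x, a, b) (g := fun z : E × E => fderiv ℝ ψ z.1 z.2)
        (f := fun y : E × E × E => (y.1, y.2.2))
        (differentiableAt_complex_fderiv_apply hs hI' b)
        (differentiableAt_fst.prodMk differentiableAt_snd.snd)
    have hev : ∀ {f : E × E × E → H →L[ℂ] H}, DifferentiableAt ℂ f (x, a, b) →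
        DifferentiableAt ℂ (fun y => ⟪e, f y e⟫_ℂ) (x, a, b) := fun hf =>
      (((innerSL ℂ e) ∘L (ContinuousLinearMap.apply ℂ H e)).differentiableAt).comp (x, a, b) hf
    have key : DifferentiableAt ℂ (fun y : E × E × E => Complex.I *
        (⟪e, (ψ y.1 * comm (fderiv ℝ ψ y.1 y.2.1) (fderiv ℝ ψ y.1 y.2.2) * ψ y.1) e⟫_ℂ
          / ⟪e, ψ y.1 e⟫_ℂ)) (x, a, b) := by
      simp only [div_eq_mul_inv]
      exact ((hev ((h1.mul ((hA.mul hB).sub (hB.mul hA))).mul h1)).mul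
        ((hev h1).inv he)).const_mul _
    refine key.congr_of_eventuallyEq ?_
    have h2 : Tendsto (fun y : E × E × E => y.1) (𝓝 (x, a, b)) (𝓝 x) := continuousAt_fst
    have h3 := (hev h1).continuousAt.eventually_ne he
    filter_upwards [h2.eventually (hψ.isOpen.mem_nhds hx), h3] with y hy hy'
    exact Omega_eq_div (hψ.mem hy) hy' _ _

end RankOne

namespace EmbGeom

open Set Filter Topology

/-! ### Linear changes of coordinates -/

/-- Precomposition of a local parametrization with a linear isomorphism. -/
theorem IsLocalParam.comp_equiv {F : Type u} [NormedAddCommGroup F] [NormedSpace ℝ F]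
    {S : Set F} {T : F → Submodule ℝ F} {E E' : Type u} [NormedAddCommGroup E] [NormedSpace ℝ E]
    [NormedAddCommGroup E'] [NormedSpace ℝ E'] {V : Set E} {ψ : E → F}
    (h : IsLocalParam S T V ψ) (L : E' ≃L[ℝ] E) : IsLocalParam S T (L ⁻¹' V) (ψ ∘ L) where
  isOpen := h.isOpen.preimage L.continuous
  smooth := h.smooth.comp L.contDiff.contDiffOn (fun _ hx => hx)
  inverse := by
    obtain ⟨U, φ, hU, him, hφ, hinv⟩ := h.inverse
    refine ⟨U, L.symm ∘ φ, hU, ?_, L.symm.contDiff.comp_contDiffOn hφ, fun x hx => ?_⟩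
    · rw [image_comp, image_preimage_eq V L.surjective, him]
    · simp [hinv (L x) hx]
  range_fderiv x hx := by
    rw [L.comp_right_fderiv, Function.comp_apply, ← h.range_fderiv (L x) hx]
    exact L.surjective.range_comp (fderiv ℝ ψ (L x))

/-- A local parametrization becomes holomorphic after a real linear change of coordinates which
turns `i` into the structure induced by `K`. -/
theorem IsLocalParam.isHolParam_comp {F : Type u} [NormedAddCommGroup F] [NormedSpace ℝ F]
    {S : Set F} {T : F → Submodule ℝ F} {K : F → F → F} {E E' : Type u} [NormedAddCommGroup E]
    [NormedSpace ℝ E] [NormedAddCommGroup E'] [NormedSpace ℂ E'] {V : Set E} {ψ : E → F}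
    (h : IsLocalParam S T V ψ) (L : E' ≃L[ℝ] E)
    (hK : ∀ x ∈ V, ∀ a : E', fderiv ℝ ψ x (L (Complex.I • a)) = K (ψ x) (fderiv ℝ ψ x (L a))) :
    IsHolParam S T K (L ⁻¹' V) (ψ ∘ L) := by
  refine ⟨h.comp_equiv L, fun x hx a => ?_⟩
  rw [L.comp_right_fderiv]
  exact hK (L x) hx a

end EmbGeom

namespace RankOne

open InnerProductSpace ContinuousLinearMap EmbGeom Set Filter Topology

variable {H : Type u} [NormedAddCommGroup H] [InnerProductSpace ℂ H] [CompleteSpace H]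

/-! ### Parametrizations of the set of rank-one projections -/

/-- Every tangent vector is the velocity of a curve of projections. -/
theorem exists_curve {q A : H →L[ℂ] H} (hq : q ∈ projections H) (hA : A ∈ tangent q) :
    ∃ γ : ℝ → H →L[ℂ] H, γ 0 = q ∧ HasDerivAt γ A 0 ∧ ∀ᶠ t in 𝓝 0, γ t ∈ projections H := by
  obtain ⟨x, y, h, rfl⟩ := exists_eq_rankOne hq
  obtain ⟨a, b, ha, hb, rfl⟩ := exists_eq_of_mem_tangent h hA
  have hX : HasDerivAt (fun t : ℝ => x + t • b) b 0 := by
    simpa using ((hasDerivAt_id (0 : ℝ)).smul_const b).const_add x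
  have hY : HasDerivAt (fun t : ℝ => y + t • a) a 0 := by
    simpa using ((hasDerivAt_id (0 : ℝ)).smul_const a).const_add y
  have hs := hY.inner ℂ hX
  simp only [zero_smul, add_zero, hb, ha] at hs
  have hs' : HasDerivAt (fun t : ℝ => (⟪y + t • a, x + t • b⟫_ℂ)⁻¹) _ 0 :=
    hs.fun_inv (by simp [h])
  have hR : HasDerivAt (fun t : ℝ => (rankOne ℂ (x + t • b) (y + t • a) : H →L[ℂ] H))
      (rankOne ℂ x a + rankOne ℂ b y) 0 := by
    have h1 := (rankOneBilin H).hasFDerivAt_of_bilinear hX.hasFDerivAt hY.hasFDerivAt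
    have h2 : HasDerivAt (fun t : ℝ => rankOneBilin H (x + t • b) (y + t • a)) _ 0 :=
      h1.hasDerivAt
    simpa using h2
  refine ⟨fun t => (⟪y + t • a, x + t • b⟫_ℂ)⁻¹ • rankOne ℂ (x + t • b) (y + t • a), ?_, ?_, ?_⟩
  · simp [h]
  · have h3 : HasDerivAt (fun t : ℝ => (⟪y + t • a, x + t • b⟫_ℂ)⁻¹ •
      (rankOne ℂ (x + t • b) (y + t • a) : H →L[ℂ] H)) _ 0 := hs'.fun_smul hR
    simpa [h] using h3
  · have h4 := hs.continuousAt.eventually_ne (y := 0) (by simp [h])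
    filter_upwards [h4] with t ht
    have h5 : (⟪y + t • a, x + t • b⟫_ℂ)⁻¹ • (rankOne ℂ (x + t • b) (y + t • a) : H →L[ℂ] H)
        = rankOne ℂ ((⟪y + t • a, x + t • b⟫_ℂ)⁻¹ • (x + t • b)) (y + t • a) := by
      rw [map_smul, _root_.smul_apply]
    rw [h5]
    exact rankOne_mem_projections (by rw [inner_smul_right, inv_mul_cancel₀ ht])

/-- A smooth map into the set of projections that is inverse to a smooth map of operators is a
local parametrization. For the tangent spaces, a curve `γ` of projections is written as
`ψ ∘ φ ∘ γ`, so that its velocity lies in the range of the derivative of `ψ`. -/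
theorem isLocalParam_of_inverse {E : Type u} [NormedAddCommGroup E] [NormedSpace ℝ E]
    {ψ : E → H →L[ℂ] H} {φ : (H →L[ℂ] H) → E} {V : Set E} {U : Set (H →L[ℂ] H)}
    (hV : IsOpen V) (hψ : ContDiffOn ℝ ∞ ψ V) (hU : IsOpen U) (hφ : ContDiffOn ℝ ∞ φ U)
    (hP : ∀ x ∈ V, ψ x ∈ projections H) (hl : ∀ x ∈ V, ψ x ∈ U → φ (ψ x) = x)
    (hr : ∀ q ∈ projections H, q ∈ U → φ q ∈ V ∧ ψ (φ q) = q) :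
    IsLocalParam (projections H) tangent (V ∩ ψ ⁻¹' U) ψ where
  isOpen := hψ.continuousOn.isOpen_inter_preimage hV hU
  smooth := hψ.mono inter_subset_left
  inverse := by
    refine ⟨U, φ, hU, ?_, hφ, fun x hx => hl x hx.1 hx.2⟩
    ext q
    constructor
    · rintro ⟨x, hx, rfl⟩
      exact ⟨hP x hx.1, hx.2⟩
    · rintro ⟨hq, hqU⟩
      obtain ⟨h1, h2⟩ := hr q hq hqU
      exact ⟨φ q, ⟨h1, by rwa [mem_preimage, h2]⟩, h2⟩
  range_fderiv := by
    rintro x ⟨hx, hxU⟩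
    have hd := ((hψ.contDiffAt (hV.mem_nhds hx)).differentiableAt (by simp)).hasFDerivAt
    refine Subset.antisymm ?_ fun A hA => ?_
    · rintro _ ⟨a, rfl⟩
      exact fderiv_mem_tangent hd.differentiableAt
        (Filter.Eventually.mono (hV.mem_nhds hx) fun y hy => hP y hy) a
    · obtain ⟨γ, h0, hγ, hγP⟩ := exists_curve (hP x hx) hA
      have hφd : HasFDerivAt φ (fderiv ℝ φ (γ 0)) (γ 0) := by
        rw [h0]
        exact ((hφ.contDiffAt (hU.mem_nhds hxU)).differentiableAt (by simp)).hasFDerivAt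
      have h1 : HasDerivAt (φ ∘ γ) (fderiv ℝ φ (γ 0) A) 0 := hφd.comp_hasDerivAt 0 hγ
      have hψd : HasFDerivAt ψ (fderiv ℝ ψ x) ((φ ∘ γ) 0) := by
        rw [Function.comp_apply, h0, hl x hx hxU]
        exact hd
      have h2 : HasDerivAt (ψ ∘ (φ ∘ γ)) (fderiv ℝ ψ x (fderiv ℝ φ (γ 0) A)) 0 :=
        hψd.comp_hasDerivAt 0 h1
      have h3 : ∀ᶠ t in 𝓝 0, γ t ∈ U :=
        hγ.continuousAt.eventually (by rw [h0]; exact hU.mem_nhds hxU)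
      have h4 : γ =ᶠ[𝓝 0] ψ ∘ (φ ∘ γ) := by
        filter_upwards [hγP, h3] with t ht ht'
        exact (hr _ ht ht').2.symm
      exact ⟨_, (h2.congr_of_eventuallyEq h4).unique hγ⟩

/-- The model space of the charts: the orthogonal complement of a vector. -/
noncomputable abbrev perp (e : H) : Submodule ℂ H := (ℂ ∙ e)ᗮ

theorem inner_perp (e : H) (z : perp e) : ⟪e, (z : H)⟫_ℂ = 0 :=
  Submodule.mem_orthogonal_singleton_iff_inner_right.1 z.2

theorem inner_perp' (e : H) (z : perp e) : ⟪(z : H), e⟫_ℂ = 0 :=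
  Submodule.mem_orthogonal_singleton_iff_inner_left.1 z.2

/-- The projection `v ↦ v - ⟪e, v⟫ e` onto the orthogonal complement of a unit vector `e`. -/
noncomputable def toPerp (e : H) (he : ⟪e, e⟫_ℂ = 1) : H →L[ℂ] perp e :=
  (ContinuousLinearMap.id ℂ H - rankOne ℂ e e).codRestrict (perp e) fun v => by
    rw [Submodule.mem_orthogonal_singleton_iff_inner_right, _root_.sub_apply, rankOne_apply,
      inner_sub_right, inner_smul_right, he]
    simp

theorem coe_toPerp (e : H) (he : ⟪e, e⟫_ℂ = 1) (v : H) :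
    (toPerp e he v : H) = v - ⟪e, v⟫_ℂ • e := rfl

theorem toPerp_eq {e : H} (he : ⟪e, e⟫_ℂ = 1) (z : perp e) (c : ℂ) :
    toPerp e he (z + c • e) = z := by
  ext1
  rw [coe_toPerp, inner_add_right, inner_smul_right, he, inner_perp]
  simp

/-- A Hilbert space and its dual are isomorphic as real spaces; the isomorphism is antilinear. -/
noncomputable def dualEquivReal (K : Type u) [NormedAddCommGroup K] [InnerProductSpace ℂ K]
    [CompleteSpace K] : StrongDual ℂ K ≃L[ℝ] K where
  toFun := (toDual ℂ K).symm
  invFun := toDual ℂ K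
  left_inv := (toDual ℂ K).symm.left_inv
  right_inv := (toDual ℂ K).symm.right_inv
  map_add' := map_add _
  map_smul' r l := by
    rw [← Complex.coe_smul, map_smulₛₗ, Complex.conj_ofReal, Complex.coe_smul, RingHom.id_apply]
  continuous_toFun := (toDual ℂ K).symm.continuous
  continuous_invFun := (toDual ℂ K).continuous

theorem dualEquivReal_I_smul {K : Type u} [NormedAddCommGroup K] [InnerProductSpace ℂ K]
    [CompleteSpace K] (l : StrongDual ℂ K) :
    dualEquivReal K (Complex.I • l) = -(Complex.I • dualEquivReal K l) := by
  change (toDual ℂ K).symm (Complex.I • l) = _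
  rw [map_smulₛₗ, Complex.conj_I, neg_smul]
  rfl

/-! ### The affine chart, and integrability of `I` and `J` -/

/-- The parametrization `(z, a) ↦ |e + z⟩⟨e + a| / ⟪e + a, e + z⟫` of the projections `q` with
`⟪e, q e⟫ ≠ 0`. -/
noncomputable def affineParam (e : H) (p : perp e × perp e) : H →L[ℂ] H :=
  rankOne ℂ ((⟪e + (p.2 : H), e + (p.1 : H)⟫_ℂ)⁻¹ • (e + (p.1 : H))) (e + (p.2 : H))

/-- The domain of `affineParam`. -/
def affineDomain (e : H) : Set (perp e × perp e) :=
  {p | ⟪e + (p.2 : H), e + (p.1 : H)⟫_ℂ ≠ 0}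

theorem contDiff_coe_fst (e : H) :
    ContDiff ℝ ∞ (fun p : perp e × perp e => e + (p.1 : H)) :=
  contDiff_const.add (((perp e).subtypeL.restrictScalars ℝ).contDiff.comp contDiff_fst)

theorem contDiff_coe_snd (e : H) :
    ContDiff ℝ ∞ (fun p : perp e × perp e => e + (p.2 : H)) :=
  contDiff_const.add (((perp e).subtypeL.restrictScalars ℝ).contDiff.comp contDiff_snd)

theorem hasFDerivAt_coe_fst (e : H) (p : perp e × perp e) :
    HasFDerivAt (fun p : perp e × perp e => e + (p.1 : H))
      (((perp e).subtypeL.restrictScalars ℝ) ∘L ContinuousLinearMap.fst ℝ (perp e) (perp e)) p :=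
  (((perp e).subtypeL.restrictScalars ℝ).hasFDerivAt.comp p hasFDerivAt_fst).const_add e

theorem hasFDerivAt_coe_snd (e : H) (p : perp e × perp e) :
    HasFDerivAt (fun p : perp e × perp e => e + (p.2 : H))
      (((perp e).subtypeL.restrictScalars ℝ) ∘L ContinuousLinearMap.snd ℝ (perp e) (perp e)) p :=
  (((perp e).subtypeL.restrictScalars ℝ).hasFDerivAt.comp p hasFDerivAt_snd).const_add e

theorem isOpen_affineDomain (e : H) : IsOpen (affineDomain e) :=
  isOpen_ne_fun ((contDiff_coe_snd e).continuous.inner (contDiff_coe_fst e).continuous)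
    continuous_const

theorem contDiff_apply (e : H) : ContDiff ℝ ∞ (fun q : H →L[ℂ] H => q e) :=
  ((ContinuousLinearMap.apply ℂ H e).restrictScalars ℝ).contDiff

theorem contDiff_star_apply (e : H) : ContDiff ℝ ∞ (fun q : H →L[ℂ] H => star q e) :=
  (contDiff_apply e).comp contDiff_star

theorem contDiff_toPerp (e : H) (he : ⟪e, e⟫_ℂ = 1) : ContDiff ℝ ∞ (toPerp e he) :=
  ((toPerp e he).restrictScalars ℝ).contDiff

/-- The projections with `⟪e, q e⟫ ≠ 0`. -/
def affineTarget (e : H) : Set (H →L[ℂ] H) := {q | ⟪e, q e⟫_ℂ ≠ 0}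

theorem isOpen_affineTarget (e : H) : IsOpen (affineTarget e) :=
  isOpen_ne_fun (continuous_const.inner (contDiff_apply e).continuous) continuous_const

/-- The coordinates `(q e / ⟪e, q e⟫ - e, q* e / ⟪q e, e⟫ - e)`, the inverse of `affineParam`. -/
noncomputable def affineCoord (e : H) (he : ⟪e, e⟫_ℂ = 1) (q : H →L[ℂ] H) : perp e × perp e :=
  (toPerp e he ((⟪e, q e⟫_ℂ)⁻¹ • q e), toPerp e he ((⟪e, star q e⟫_ℂ)⁻¹ • star q e))

theorem inner_star_right (A : H →L[ℂ] H) (v w : H) : ⟪v, star A w⟫_ℂ = ⟪A v, w⟫_ℂ :=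
  ContinuousLinearMap.adjoint_inner_right A v w

theorem contDiffOn_affineCoord (e : H) (he : ⟪e, e⟫_ℂ = 1) :
    ContDiffOn ℝ ∞ (affineCoord e he) (affineTarget e) := by
  intro q hq
  refine ContDiffAt.contDiffWithinAt ?_
  have h1 := (contDiff_apply e).contDiffAt (x := q)
  have h2 := (contDiff_star_apply e).contDiffAt (x := q)
  have hq' : ⟪e, star q e⟫_ℂ ≠ 0 := by
    rw [inner_star_right, ← inner_conj_symm]
    exact (map_ne_zero _).2 hq
  exact ((contDiff_toPerp e he).contDiffAt.comp q
    (((contDiffAt_const.inner ℂ h1).inv hq).smul h1)).prodMk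
    ((contDiff_toPerp e he).contDiffAt.comp q
      (((contDiffAt_const.inner ℂ h2).inv hq').smul h2))

theorem affineParam_affineCoord {e : H} (he : ⟪e, e⟫_ℂ = 1) {q : H →L[ℂ] H}
    (hq : q ∈ projections H) (hqe : q ∈ affineTarget e) :
    affineCoord e he q ∈ affineDomain e ∧ affineParam e (affineCoord e he q) = q := by
  obtain ⟨x, y, h, rfl⟩ := exists_eq_rankOne hq
  have hqe' : ⟪y, e⟫_ℂ * ⟪e, x⟫_ℂ ≠ 0 := by
    have : ⟪e, rankOne ℂ x y e⟫_ℂ ≠ 0 := hqe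
    rwa [rankOne_apply, inner_smul_right] at this
  have h1 := left_ne_zero_of_mul hqe'
  have h2 := right_ne_zero_of_mul hqe'
  have h1' : ⟪e, y⟫_ℂ ≠ 0 := by rw [← inner_conj_symm]; exact (map_ne_zero _).2 h1
  have h2' : ⟪x, e⟫_ℂ ≠ 0 := by rw [← inner_conj_symm]; exact (map_ne_zero _).2 h2
  have hX : e + ((affineCoord e he (rankOne ℂ x y)).1 : H) = (⟪e, x⟫_ℂ)⁻¹ • x := by
    rw [affineCoord, coe_toPerp, rankOne_apply]
    simp only [inner_smul_right, smul_smul]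
    rw [mul_inv, mul_assoc, mul_comm (⟪e, x⟫_ℂ)⁻¹, ← mul_assoc, inv_mul_cancel₀ h1, one_mul,
      inv_mul_cancel₀ h2, one_smul]
    abel
  have hY : e + ((affineCoord e he (rankOne ℂ x y)).2 : H) = (⟪e, y⟫_ℂ)⁻¹ • y := by
    rw [affineCoord, coe_toPerp, star_rankOne, rankOne_apply]
    simp only [inner_smul_right, smul_smul]
    rw [mul_inv, mul_assoc, mul_comm (⟪e, y⟫_ℂ)⁻¹, ← mul_assoc, inv_mul_cancel₀ h2', one_mul,
      inv_mul_cancel₀ h1', one_smul]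
    abel
  have hn : ⟪(⟪e, y⟫_ℂ)⁻¹ • y, (⟪e, x⟫_ℂ)⁻¹ • x⟫_ℂ = (⟪y, e⟫_ℂ)⁻¹ * (⟪e, x⟫_ℂ)⁻¹ := by
    rw [inner_smul_left, inner_smul_right, h, map_inv₀, inner_conj_symm, mul_one]
  refine ⟨?_, ?_⟩
  · change ⟪e + ((affineCoord e he (rankOne ℂ x y)).2 : H),
      e + ((affineCoord e he (rankOne ℂ x y)).1 : H)⟫_ℂ ≠ 0
    rw [hX, hY, hn]
    exact mul_ne_zero (inv_ne_zero h1) (inv_ne_zero h2)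
  · rw [affineParam, hX, hY, hn]
    ext v
    simp only [rankOne_apply, inner_smul_left, smul_smul, map_inv₀, inner_conj_symm]
    congr 1
    field_simp

theorem isLocalParam_affineParam (e : H) (he : ⟪e, e⟫_ℂ = 1) :
    IsLocalParam (projections H) tangent (affineDomain e ∩ affineParam e ⁻¹' affineTarget e)
      (affineParam e) := by
  refine isLocalParam_of_inverse (φ := affineCoord e he) (isOpen_affineDomain e) ?_
    (isOpen_affineTarget e) (contDiffOn_affineCoord e he) ?_ ?_ ?_
  · intro p hp
    refine ContDiffAt.contDiffWithinAt ?_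
    have hX := (contDiff_coe_fst e).contDiffAt (x := p)
    have hY := (contDiff_coe_snd e).contDiffAt (x := p)
    exact ((rankOneBilin H).contDiff.contDiffAt.comp p
      (((hY.inner ℂ hX).inv hp).smul hX)).clm_apply hY
  · intro p hp
    exact rankOne_mem_projections (by rw [inner_smul_right, inv_mul_cancel₀ hp])
  · rintro ⟨z, a⟩ hp -
    have hp' : ⟪e + (z : H), e + (a : H)⟫_ℂ ≠ 0 := by
      rw [← inner_conj_symm]; exact (map_ne_zero _).2 hp
    change ⟪e + (a : H), e + (z : H)⟫_ℂ ≠ 0 at hp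
    have h1 : ⟪e + (a : H), e⟫_ℂ = 1 := by rw [inner_add_left, he, inner_perp', add_zero]
    have h2 : ⟪e, e + (z : H)⟫_ℂ = 1 := by rw [inner_add_right, he, inner_perp, add_zero]
    have h3 : ⟪e, e + (a : H)⟫_ℂ = 1 := by rw [inner_add_right, he, inner_perp, add_zero]
    have h4 : ⟪e + (z : H), e⟫_ℂ = 1 := by rw [inner_add_left, he, inner_perp', add_zero]
    have key : ∀ z : perp e, toPerp e he (e + (z : H)) = z := fun z => by
      have := toPerp_eq he z 1
      rwa [one_smul, add_comm] at this
    simp only [affineCoord, affineParam, star_rankOne, rankOne_apply, h1, inner_smul_right,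
      inner_smul_left, inner_conj_symm, h2, h3, h4, smul_smul, one_mul, mul_one, inv_inv, map_inv₀]
    rw [mul_inv_cancel₀ hp, mul_inv_cancel₀ hp', one_smul, one_smul, key, key]
  · exact fun q hq hqe => affineParam_affineCoord he hq hqe

/-- The derivative of `affineParam`. -/
theorem fderiv_affineParam {e : H} {p : perp e × perp e} (hp : p ∈ affineDomain e)
    (v : perp e × perp e) : fderiv ℝ (affineParam e) p v
      = rankOne ℂ ((⟪e + (p.2 : H), e + (p.1 : H)⟫_ℂ)⁻¹ • (e + (p.1 : H))) (v.2 : H)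
        + rankOne ℂ ((⟪e + (p.2 : H), e + (p.1 : H)⟫_ℂ)⁻¹ • (v.1 : H)
          - ((⟪e + (p.2 : H), (v.1 : H)⟫_ℂ + ⟪(v.2 : H), e + (p.1 : H)⟫_ℂ)
            / ⟪e + (p.2 : H), e + (p.1 : H)⟫_ℂ ^ 2) • (e + (p.1 : H))) (e + (p.2 : H)) := by
  have hX := hasFDerivAt_coe_fst e p
  have hY := hasFDerivAt_coe_snd e p
  have hs : HasFDerivAt (fun p : perp e × perp e => (⟪e + (p.2 : H), e + (p.1 : H)⟫_ℂ)⁻¹) _ p :=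
    (hasFDerivAt_inv' (𝕜 := ℝ) hp).comp p (hY.inner ℂ hX)
  have hξ : HasFDerivAt (fun p : perp e × perp e =>
      (⟪e + (p.2 : H), e + (p.1 : H)⟫_ℂ)⁻¹ • (e + (p.1 : H))) _ p := hs.smul hX
  have h1 := fderiv_rankOne hξ.differentiableAt hY.differentiableAt v
  rw [hξ.fderiv, hY.fderiv] at h1
  refine h1.trans ?_
  congr 3
  change (⟪e + (p.2 : H), e + (p.1 : H)⟫_ℂ)⁻¹ • (v.1 : H)
    + (-((⟪e + (p.2 : H), e + (p.1 : H)⟫_ℂ)⁻¹ *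
      (⟪e + (p.2 : H), (v.1 : H)⟫_ℂ + ⟪(v.2 : H), e + (p.1 : H)⟫_ℂ)
      * (⟪e + (p.2 : H), e + (p.1 : H)⟫_ℂ)⁻¹)) • (e + (p.1 : H)) = _
  rw [neg_smul, ← sub_eq_add_neg]
  congr 2
  field_simp

theorem affineParam_inner {e : H} {p : perp e × perp e} (hp : p ∈ affineDomain e) :
    ⟪e + (p.2 : H), (⟪e + (p.2 : H), e + (p.1 : H)⟫_ℂ)⁻¹ • (e + (p.1 : H))⟫_ℂ = 1 := by
  rw [inner_smul_right, inv_mul_cancel₀ hp]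

/-- The affine chart is holomorphic for `J`, which multiplies both vectors `a` and `b` of a
tangent vector `|ξ⟩⟨a| + |b⟩⟨η|` by `i`. -/
theorem fderiv_affineParam_I_smul {e : H} {p : perp e × perp e} (hp : p ∈ affineDomain e)
    (v : perp e × perp e) : fderiv ℝ (affineParam e) p (Complex.I • v)
      = strJ (affineParam e p) (fderiv ℝ (affineParam e) p v) := by
  have h := affineParam_inner hp
  rw [fderiv_affineParam hp, fderiv_affineParam hp, strJ, affineParam]
  replace hp : ⟪e + (p.2 : H), e + (p.1 : H)⟫_ℂ ≠ 0 := hp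
  simp only [comm, add_mul, mul_add, rankOne_mul_rankOne, h, Prod.smul_fst, Prod.smul_snd,
    Submodule.coe_smul]
  generalize e + (p.1 : H) = X at *
  generalize e + (p.2 : H) = Y at *
  ext w
  simp only [_root_.smul_apply, _root_.add_apply, _root_.sub_apply, rankOne_apply,
    inner_smul_left, inner_smul_right, inner_sub_right, smul_sub, smul_smul, Complex.conj_I]
  match_scalars
  · field_simp
    ring
  · field_simp

/-- Conjugating the second slot of the affine chart makes it holomorphic for `I`, because
`|ξ⟩⟨η|` is antilinear in `η`. -/
theorem fderiv_affineParam_conj {e : H} {p : perp e × perp e} (hp : p ∈ affineDomain e)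
    (v : perp e × perp e) : fderiv ℝ (affineParam e) p (Complex.I • v.1, -(Complex.I • v.2))
      = strI (affineParam e p) (fderiv ℝ (affineParam e) p v) := by
  rw [fderiv_affineParam hp, fderiv_affineParam hp, strI]
  simp only [Submodule.coe_smul, Submodule.coe_neg]
  generalize e + (p.1 : H) = X at *
  generalize e + (p.2 : H) = Y at *
  ext w
  simp only [_root_.smul_apply, _root_.add_apply, rankOne_apply, inner_smul_left,
    inner_smul_right, inner_neg_left, smul_smul, Complex.conj_I]
  module

theorem exists_affineParam {q : H →L[ℂ] H} (hq : q ∈ projections H) :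
    ∃ e : H, ⟪e, e⟫_ℂ = 1 ∧
      q ∈ affineParam e '' (affineDomain e ∩ affineParam e ⁻¹' affineTarget e) := by
  obtain ⟨e, he⟩ := exists_inner_ne_zero hq
  have he0 : e ≠ 0 := fun h => he (by simp [h])
  have hn : (‖e‖ : ℂ) ≠ 0 := by simpa using he0
  have he1 : ⟪(‖e‖⁻¹ : ℂ) • e, (‖e‖⁻¹ : ℂ) • e⟫_ℂ = 1 := by
    rw [inner_smul_left, inner_smul_right, inner_self_eq_norm_sq_to_K]
    simp
    field_simp
  have hq1 : q ∈ affineTarget ((‖e‖⁻¹ : ℂ) • e) := by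
    change ⟪(‖e‖⁻¹ : ℂ) • e, q ((‖e‖⁻¹ : ℂ) • e)⟫_ℂ ≠ 0
    rw [map_smul, inner_smul_left, inner_smul_right]
    simp [hn, he]
  obtain ⟨h1, h2⟩ := affineParam_affineCoord he1 hq hq1
  exact ⟨_, he1, affineCoord _ he1 q, ⟨h1, by rwa [mem_preimage, h2]⟩, h2⟩

theorem isIntegrable_strJ : IsIntegrableAlmostComplex (projections H) tangent strJ := by
  refine ⟨isAlmostComplex_strJ, fun q hq => ?_⟩
  obtain ⟨e, he, hmem⟩ := exists_affineParam hq
  exact ⟨perp e × perp e, inferInstance, inferInstance, _, affineParam e,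
    ⟨isLocalParam_affineParam e he, fun p hp v => fderiv_affineParam_I_smul hp.1 v⟩, hmem⟩

/-- The antilinear identification of the second factor with the dual space. -/
noncomputable def conjSnd (K : Type u) [NormedAddCommGroup K] [InnerProductSpace ℂ K]
    [CompleteSpace K] : (K × StrongDual ℂ K) ≃L[ℝ] (K × K) :=
  (ContinuousLinearEquiv.refl ℝ K).prodCongr (dualEquivReal K)

theorem conjSnd_I_smul {K : Type u} [NormedAddCommGroup K] [InnerProductSpace ℂ K]
    [CompleteSpace K] (p : K × StrongDual ℂ K) :
    conjSnd K (Complex.I • p) = (Complex.I • (conjSnd K p).1, -(Complex.I • (conjSnd K p).2)) :=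
  Prod.ext rfl (dualEquivReal_I_smul p.2)

theorem isIntegrable_strI : IsIntegrableAlmostComplex (projections H) tangent strI := by
  refine ⟨isAlmostComplex_strI, fun q hq => ?_⟩
  obtain ⟨e, he, hmem⟩ := exists_affineParam hq
  refine ⟨perp e × StrongDual ℂ (perp e), inferInstance, inferInstance, _, _,
    (isLocalParam_affineParam e he).isHolParam_comp (conjSnd (perp e)) fun p hp v => ?_, ?_⟩
  · rw [conjSnd_I_smul]
    exact fderiv_affineParam_conj hp.1 _
  · rwa [image_comp, image_preimage_eq _ (conjSnd (perp e)).surjective]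

/-! ### Balanced factorizations from orthogonal pairs -/

theorem inner_self_eq_ofReal_sq (x : H) : ⟪x, x⟫_ℂ = (‖x‖ : ℂ) ^ 2 :=
  inner_self_eq_norm_sq_to_K x

theorem norm_eq_of_inner_self_eq {x y : H} (h : ⟪x, x⟫_ℂ = ⟪y, y⟫_ℂ) : ‖x‖ = ‖y‖ := by
  rw [inner_self_eq_ofReal_sq, inner_self_eq_ofReal_sq] at h
  have h' : ‖x‖ ^ 2 = ‖y‖ ^ 2 := by exact_mod_cast h
  exact (pow_left_inj₀ (norm_nonneg _) (norm_nonneg _) two_ne_zero).1 h'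

/-- The real scale `k` for which `X + k M` and `X - k M` have inner product `2 k` when `X` and `M` are
orthogonal. -/
noncomputable def balScale (X M : H) : ℝ := ‖X‖ ^ 2 / (1 + √(1 + ‖X‖ ^ 2 * ‖M‖ ^ 2))

/-- The normalizing factor `1 / √(2k)`. -/
noncomputable def balNorm (X M : H) : ℝ := (√(2 * balScale X M))⁻¹

/-- The left factor `(X + k M) / √(2k)` of the projection built from an orthogonal pair. -/
noncomputable def balLeft (X M : H) : H := balNorm X M • (X + balScale X M • M)

/-- The right factor `(X - k M) / √(2k)` of the projection built from an orthogonal pair. -/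
noncomputable def balRight (X M : H) : H := balNorm X M • (X - balScale X M • M)

theorem balScale_pos {X : H} (hX : X ≠ 0) (M : H) : 0 < balScale X M := by
  have := norm_pos_iff.2 hX
  unfold balScale
  positivity

theorem balNorm_mul_self {X : H} (hX : X ≠ 0) (M : H) :
    balNorm X M * balNorm X M * (2 * balScale X M) = 1 := by
  have h := balScale_pos hX M
  rw [balNorm, ← mul_inv, Real.mul_self_sqrt (by positivity), inv_mul_cancel₀ (by positivity)]

theorem balScale_sq (X M : H) :
    ‖X‖ ^ 2 - balScale X M ^ 2 * ‖M‖ ^ 2 = 2 * balScale X M := by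
  have hs : √(1 + ‖X‖ ^ 2 * ‖M‖ ^ 2) ^ 2 = 1 + ‖X‖ ^ 2 * ‖M‖ ^ 2 := Real.sq_sqrt (by positivity)
  have hp : 0 < 1 + √(1 + ‖X‖ ^ 2 * ‖M‖ ^ 2) := by positivity
  unfold balScale
  generalize √(1 + ‖X‖ ^ 2 * ‖M‖ ^ 2) = s at *
  field_simp
  linear_combination ‖X‖ ^ 2 * hs

theorem inner_balRight_balLeft {X M : H} (hX : X ≠ 0) (h : ⟪X, M⟫_ℂ = 0) :
    ⟪balRight X M, balLeft X M⟫_ℂ = 1 := by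
  have h' : ⟪M, X⟫_ℂ = 0 := by rw [← inner_conj_symm, h, map_zero]
  have h1 : ((balNorm X M * balNorm X M * (2 * balScale X M) : ℝ) : ℂ) = 1 := by
    rw [balNorm_mul_self hX, Complex.ofReal_one]
  have h2 : ((‖X‖ ^ 2 - balScale X M ^ 2 * ‖M‖ ^ 2 : ℝ) : ℂ) = (2 * balScale X M : ℝ) := by
    rw [balScale_sq]
  simp only [balRight, balLeft, ← Complex.coe_smul, inner_smul_left, inner_smul_right,
    inner_sub_left, inner_add_right, h, h', inner_self_eq_norm_sq_to_K, Complex.conj_ofReal]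
  push_cast at h1 h2 ⊢
  linear_combination h1 + (balNorm X M : ℂ) ^ 2 * h2

/-- The two factors have the same norm, so the factorization is balanced. -/
theorem inner_balLeft_self {X M : H} (h : ⟪X, M⟫_ℂ = 0) :
    ⟪balLeft X M, balLeft X M⟫_ℂ = hsNorm (rankOne ℂ (balLeft X M) (balRight X M)) ∧
      ⟪balRight X M, balRight X M⟫_ℂ = hsNorm (rankOne ℂ (balLeft X M) (balRight X M)) := by
  have h' : ⟪M, X⟫_ℂ = 0 := by rw [← inner_conj_symm, h, map_zero]
  have h1 : ⟪balLeft X M, balLeft X M⟫_ℂ = ⟪balRight X M, balRight X M⟫_ℂ := by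
    simp only [balRight, balLeft, ← Complex.coe_smul, inner_smul_left, inner_smul_right,
      inner_sub_left, inner_add_right, inner_sub_right, inner_add_left, h, h']
    ring
  have h2 := norm_eq_of_inner_self_eq h1
  rw [← h1, inner_self_eq_norm_sq_to_K, hsNorm_rankOne, h2]
  simp [sq]

theorem rankOne_balLeft_balRight {X : H} (hX : X ≠ 0) (M : H) :
    (rankOne ℂ (balLeft X M) (balRight X M) : H →L[ℂ] H)
      = (2 * balScale X M)⁻¹ • rankOne ℂ (X + balScale X M • M) (X - balScale X M • M) := by
  rw [balLeft, balRight, rankOne_real_smul_left, rankOne_real_smul_right, smul_smul,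
    ← eq_inv_of_mul_eq_one_left (balNorm_mul_self hX M)]

section Family

variable {E : Type u} [NormedAddCommGroup E] [NormedSpace ℝ E] {X M : E → H} {p : E}

theorem contDiffAt_balScale (hX : ContDiffAt ℝ ∞ X p) (hM : ContDiffAt ℝ ∞ M p) :
    ContDiffAt ℝ ∞ (fun p => balScale (X p) (M p)) p := by
  refine (hX.norm_sq ℂ).div (contDiffAt_const.add
    ((contDiffAt_const.add ((hX.norm_sq ℂ).mul (hM.norm_sq ℂ))).sqrt ?_)) ?_ <;> positivity

theorem contDiffAt_balNorm (hX : ContDiffAt ℝ ∞ X p) (hM : ContDiffAt ℝ ∞ M p) (h0 : X p ≠ 0) :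
    ContDiffAt ℝ ∞ (fun p => balNorm (X p) (M p)) p := by
  have h1 := balScale_pos h0 (M p)
  exact ((contDiffAt_const.mul (contDiffAt_balScale hX hM)).sqrt (by positivity)).inv
    (by positivity)

theorem contDiffAt_balLeft (hX : ContDiffAt ℝ ∞ X p) (hM : ContDiffAt ℝ ∞ M p) (h0 : X p ≠ 0) :
    ContDiffAt ℝ ∞ (fun p => balLeft (X p) (M p)) p :=
  (contDiffAt_balNorm hX hM h0).smul (hX.add ((contDiffAt_balScale hX hM).smul hM))

theorem contDiffAt_balRight (hX : ContDiffAt ℝ ∞ X p) (hM : ContDiffAt ℝ ∞ M p) (h0 : X p ≠ 0) :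
    ContDiffAt ℝ ∞ (fun p => balRight (X p) (M p)) p :=
  (contDiffAt_balNorm hX hM h0).smul (hX.sub ((contDiffAt_balScale hX hM).smul hM))

/-- The derivatives of the two factors of a family of projections built from orthogonal pairs.
The contributions of the scale and of the normalization combine into the single number `κ`. -/
theorem exists_fderiv_balLeft (hX : ContDiffAt ℝ ∞ X p) (hM : ContDiffAt ℝ ∞ M p)
    (h0 : ∀ p, X p ≠ 0) (a : E) : ∃ κ : ℝ,
      fderiv ℝ (fun p => balLeft (X p) (M p)) p a = balNorm (X p) (M p) •
        (fderiv ℝ X p a + balScale (X p) (M p) • fderiv ℝ M p a) - κ • balRight (X p) (M p) ∧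
      fderiv ℝ (fun p => balRight (X p) (M p)) p a = balNorm (X p) (M p) •
        (fderiv ℝ X p a - balScale (X p) (M p) • fderiv ℝ M p a) - κ • balLeft (X p) (M p) := by
  have hX' := (hX.differentiableAt (by simp)).hasFDerivAt
  have hM' := (hM.differentiableAt (by simp)).hasFDerivAt
  have hk := ((contDiffAt_balScale hX hM).differentiableAt (by simp)).hasFDerivAt
  have hc := ((contDiffAt_balNorm hX hM (h0 p)).differentiableAt (by simp)).hasFDerivAt
  have h1 : HasFDerivAt (fun p => balLeft (X p) (M p)) _ p := hc.smul (hX'.add (hk.smul hM'))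
  have h2 : HasFDerivAt (fun p => balRight (X p) (M p)) _ p := hc.smul (hX'.sub (hk.smul hM'))
  have h3 : HasFDerivAt (fun p => balNorm (X p) (M p) * balNorm (X p) (M p)
      * (2 * balScale (X p) (M p))) _ p := (hc.mul hc).mul (hk.const_mul 2)
  have h4 : (fun p => balNorm (X p) (M p) * balNorm (X p) (M p) * (2 * balScale (X p) (M p)))
      = fun _ => (1 : ℝ) := funext fun p => balNorm_mul_self (h0 p) (M p)
  rw [h4] at h3
  have h5 := DFunLike.congr_fun (h3.unique (hasFDerivAt_const 1 p)) a
  have hkp := balScale_pos (h0 p) (M p)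
  have hc0 : balNorm (X p) (M p) ≠ 0 := fun h => by
    have := balNorm_mul_self (h0 p) (M p)
    simp [h] at this
  rw [h1.fderiv, h2.fderiv]
  simp only [_root_.add_apply, _root_.smul_apply, smul_eq_mul, _root_.zero_apply, Pi.mul_apply] at h5
  generalize fderiv ℝ (fun p => balNorm (X p) (M p)) p = c' at *
  generalize fderiv ℝ (fun p => balScale (X p) (M p)) p = k' at *
  have h6 : c' a = - (k' a / (2 * balScale (X p) (M p))) * balNorm (X p) (M p) := by
    field_simp
    have : balNorm (X p) (M p) * (2 * (2 * c' a * balScale (X p) (M p)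
      + balNorm (X p) (M p) * k' a)) = 0 := by linear_combination h5
    have := (mul_eq_zero.1 this).resolve_left hc0
    linear_combination this / 2
  refine ⟨k' a / (2 * balScale (X p) (M p)), ?_, ?_⟩
  · simp only [_root_.add_apply, _root_.smul_apply, smulRight_apply, balRight]
    rw [h6]
    match_scalars <;> field_simp <;> ring
  · simp only [_root_.add_apply, _root_.sub_apply, _root_.smul_apply, smulRight_apply, balLeft]
    rw [h6]
    match_scalars <;> field_simp <;> ring

/-- If `X` varies antiholomorphically and `M` holomorphically, the associated projection varies
holomorphically with respect to `𝐉`. -/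
theorem fderiv_balanced_strJJ (hX : ContDiffAt ℝ ∞ X p) (hM : ContDiffAt ℝ ∞ M p)
    (h0 : ∀ p, X p ≠ 0) (h : ∀ p, ⟪X p, M p⟫_ℂ = 0) {a b : E}
    (hXb : fderiv ℝ X p b = -(Complex.I • fderiv ℝ X p a))
    (hMb : fderiv ℝ M p b = Complex.I • fderiv ℝ M p a) :
    fderiv ℝ (fun p => (rankOne ℂ (balLeft (X p) (M p)) (balRight (X p) (M p)) : H →L[ℂ] H)) p b
      = strJJ (rankOne ℂ (balLeft (X p) (M p)) (balRight (X p) (M p)))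
        (fderiv ℝ (fun p =>
          (rankOne ℂ (balLeft (X p) (M p)) (balRight (X p) (M p)) : H →L[ℂ] H)) p a) := by
  have hξ := (contDiffAt_balLeft hX hM (h0 p)).differentiableAt (by simp)
  have hη := (contDiffAt_balRight hX hM (h0 p)).differentiableAt (by simp)
  obtain ⟨κ, h1, h2⟩ := exists_fderiv_balLeft hX hM h0 a
  obtain ⟨κ', h1', h2'⟩ := exists_fderiv_balLeft hX hM h0 b
  obtain ⟨hs1, hs2⟩ := inner_balLeft_self (h p)
  have h11 := inner_balRight_balLeft (h0 p) (h p)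
  have hpos := hsNorm_pos (rankOne_mem_projections h11)
  have hd : HasFDerivAt (fun p => ⟪balRight (X p) (M p), balLeft (X p) (M p)⟫_ℂ) _ p :=
    hη.hasFDerivAt.inner ℂ hξ.hasFDerivAt
  have hd1 : (fun p => ⟪balRight (X p) (M p), balLeft (X p) (M p)⟫_ℂ) = fun _ => 1 :=
    funext fun p => inner_balRight_balLeft (h0 p) (h p)
  rw [hd1] at hd
  have hd2 := DFunLike.congr_fun (hd.unique (hasFDerivAt_const 1 p)) b
  change ⟪balRight (X p) (M p), fderiv ℝ (fun p => balLeft (X p) (M p)) p b⟫_ℂ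
    + ⟪fderiv ℝ (fun p => balRight (X p) (M p)) p b, balLeft (X p) (M p)⟫_ℂ = 0 at hd2
  rw [fderiv_rankOne hξ hη, fderiv_rankOne hξ hη, strJJ_rankOne _ _ h11 hs1 hs2]
  rw [h1', h2', hXb, hMb] at hd2 ⊢
  rw [h1, h2]
  have e1 : balNorm (X p) (M p) • (-(Complex.I • fderiv ℝ X p a)
      + balScale (X p) (M p) • Complex.I • fderiv ℝ M p a) = -(Complex.I • (balNorm (X p) (M p) •
        (fderiv ℝ X p a - balScale (X p) (M p) • fderiv ℝ M p a))) := by module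
  have e2 : balNorm (X p) (M p) • (-(Complex.I • fderiv ℝ X p a)
      - balScale (X p) (M p) • Complex.I • fderiv ℝ M p a) = -(Complex.I • (balNorm (X p) (M p) •
        (fderiv ℝ X p a + balScale (X p) (M p) • fderiv ℝ M p a))) := by module
  rw [e1, e2] at hd2 ⊢
  generalize balNorm (X p) (M p) • (fderiv ℝ X p a - balScale (X p) (M p) • fderiv ℝ M p a) = g
    at *
  generalize balNorm (X p) (M p) • (fderiv ℝ X p a + balScale (X p) (M p) • fderiv ℝ M p a) = f
    at *
  generalize balLeft (X p) (M p) = ξ at *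
  generalize balRight (X p) (M p) = η at *
  generalize hsNorm (rankOne ℂ ξ η) = r at *
  have hr : (r : ℂ) ≠ 0 := by exact_mod_cast hpos.ne'
  simp only [← Complex.coe_smul, inner_sub_left, inner_sub_right, inner_neg_left, inner_neg_right,
    inner_smul_left, inner_smul_right, Complex.conj_I, Complex.conj_ofReal, hs1, hs2] at hd2 ⊢
  have hκ : (κ' : ℂ) = Complex.I / (2 * r) * (⟪f, ξ⟫_ℂ - ⟪η, g⟫_ℂ) := by
    field_simp
    linear_combination -hd2
  ext v
  simp only [_root_.smul_apply, _root_.add_apply, _root_.sub_apply, rankOne_apply, inner_sub_left,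
    inner_neg_left, inner_smul_left, h11, Complex.conj_ofReal, Complex.conj_I]
  rw [hκ]
  match_scalars <;> field_simp <;> ring

end Family

/-! ### The cotangent chart, and integrability of `𝐉` -/

/-- The vector `μ - ⟪z, μ⟫ e`. It is orthogonal to `e + z`, and it represents the covector
`v ↦ ⟪μ, v⟫` at the line through `e + z` in projective space. -/
noncomputable def covector (e : H) (p : perp e × perp e) : H := (p.2 : H) - ⟪p.1, p.2⟫_ℂ • e

/-- The cotangent coordinates `(z, μ) ↦` projection built from the orthogonal pair
`(e + z, μ - ⟪z, μ⟫ e)`. -/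
noncomputable def cotangentParam (e : H) (p : perp e × perp e) : H →L[ℂ] H :=
  rankOne ℂ (balLeft (e + (p.1 : H)) (covector e p)) (balRight (e + (p.1 : H)) (covector e p))

theorem hasFDerivAt_covector (e : H) (p : perp e × perp e) :
    HasFDerivAt (covector e) (((perp e).subtypeL.restrictScalars ℝ) ∘L
      ContinuousLinearMap.snd ℝ (perp e) (perp e) - ((fderivInnerCLM ℂ p).comp
        ((ContinuousLinearMap.fst ℝ (perp e) (perp e)).prod
          (ContinuousLinearMap.snd ℝ (perp e) (perp e)))).smulRight e) p :=
  (((perp e).subtypeL.restrictScalars ℝ).hasFDerivAt.comp p hasFDerivAt_snd).sub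
    ((hasFDerivAt_fst.inner ℂ hasFDerivAt_snd).smul_const e)

theorem contDiff_covector (e : H) : ContDiff ℝ ∞ (covector e) :=
  (((perp e).subtypeL.restrictScalars ℝ).contDiff.comp contDiff_snd).sub
    ((contDiff_fst.inner ℂ contDiff_snd).smul contDiff_const)

theorem inner_add_perp {e : H} (he : ⟪e, e⟫_ℂ = 1) (z : perp e) : ⟪e + (z : H), e⟫_ℂ = 1 := by
  rw [inner_add_left, he, inner_perp', add_zero]

theorem add_perp_ne_zero {e : H} (he : ⟪e, e⟫_ℂ = 1) (z : perp e) : e + (z : H) ≠ 0 := fun h => by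
  have := inner_add_perp he z
  simp [h] at this

theorem inner_covector {e : H} (he : ⟪e, e⟫_ℂ = 1) (p : perp e × perp e) :
    ⟪e + (p.1 : H), covector e p⟫_ℂ = 0 := by
  rw [covector, inner_sub_right, inner_smul_right, inner_add_perp he, inner_add_left, inner_perp,
    Submodule.coe_inner]
  ring

theorem contDiff_cotangentParam {e : H} (he : ⟪e, e⟫_ℂ = 1) : ContDiff ℝ ∞ (cotangentParam e) :=
  contDiff_iff_contDiffAt.2 fun p => by
    have hX := (contDiff_coe_fst e).contDiffAt (x := p)
    have hM := (contDiff_covector e).contDiffAt (x := p)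
    exact ((rankOneBilin H).contDiff.contDiffAt.comp p
      (contDiffAt_balLeft hX hM (add_perp_ne_zero he p.1))).clm_apply
      (contDiffAt_balRight hX hM (add_perp_ne_zero he p.1))

/-- Conjugating the first slot of the cotangent chart makes it holomorphic for `𝐉`. -/
theorem fderiv_cotangentParam_conj {e : H} (he : ⟪e, e⟫_ℂ = 1) (p v : perp e × perp e) :
    fderiv ℝ (cotangentParam e) p (-(Complex.I • v.1), Complex.I • v.2)
      = strJJ (cotangentParam e p) (fderiv ℝ (cotangentParam e) p v) := by
  refine fderiv_balanced_strJJ (contDiff_coe_fst e).contDiffAt (contDiff_covector e).contDiffAt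
    (fun p => add_perp_ne_zero he p.1) (fun p => inner_covector he p) ?_ ?_
  · rw [(hasFDerivAt_coe_fst e p).fderiv]
    rfl
  · rw [(hasFDerivAt_covector e p).fderiv]
    change Complex.I • (v.2 : H)
      - (⟪p.1, Complex.I • v.2⟫_ℂ + ⟪-(Complex.I • v.1), p.2⟫_ℂ) • e
        = Complex.I • ((v.2 : H) - (⟪p.1, v.2⟫_ℂ + ⟪v.1, p.2⟫_ℂ) • e)
    rw [inner_smul_right, inner_neg_left, inner_smul_left, Complex.conj_I]
    module

/-- A formula for the norm of a projection in terms of the vector `e`, which is smooth on an open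
set of operators. -/
noncomputable def normAt (e : H) (q : H →L[ℂ] H) : ℝ := ‖q e‖ * ‖star q e‖ / ‖⟪e, q e⟫_ℂ‖

/-- For a projection `q = |ξ⟩⟨η|` with `‖ξ‖ = ‖η‖` this is `⟪ξ + η, e⟫ (ξ + η)`. -/
noncomputable def baseVector (e : H) (q : H →L[ℂ] H) : H :=
  (normAt e q)⁻¹ • (q (star q e) + star q (q e)) + (q e + star q e)

/-- For a projection `q = |ξ⟩⟨η|` with `‖ξ‖ = ‖η‖` this is `½ ⟪ξ + η, e⟫ (ξ - η)`. -/
noncomputable def fibreVector (e : H) (q : H →L[ℂ] H) : H :=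
  (2⁻¹ : ℝ) • ((normAt e q)⁻¹ • (q (star q e) - star q (q e)) + (q e - star q e))

/-- The inverse of `cotangentParam`. For `q = |ξ⟩⟨η|` in balanced form, `e + z` is the multiple of
`ξ + η` whose inner product with `e` is `1`, and `μ` is the projection of `fibreVector e q`. -/
noncomputable def cotangentCoord (e : H) (he : ⟪e, e⟫_ℂ = 1) (q : H →L[ℂ] H) : perp e × perp e :=
  (toPerp e he ((⟪e, baseVector e q⟫_ℂ)⁻¹ • baseVector e q), toPerp e he (fibreVector e q))

/-- An open set of operators on which `cotangentCoord` is smooth; the projections in it form the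
range of the cotangent chart. -/
def cotangentTarget (e : H) : Set (H →L[ℂ] H) :=
  affineTarget e ∩ {q | ⟪e, baseVector e q⟫_ℂ ≠ 0}

theorem contDiffAt_normAt_inv {e : H} {q : H →L[ℂ] H} (hq : q ∈ affineTarget e) :
    ContDiffAt ℝ ∞ (fun q => (normAt e q)⁻¹) q := by
  have h0 : ⟪e, q e⟫_ℂ ≠ 0 := hq
  have h1 : q e ≠ 0 := fun h => h0 (by rw [h, inner_zero_right])
  have h2 : star q e ≠ 0 := fun h => h0 (by
    rw [← inner_conj_symm, ← inner_star_right, h, inner_zero_right, map_zero])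
  have d1 := (contDiff_apply e).contDiffAt (x := q)
  have d2 := (contDiff_star_apply e).contDiffAt (x := q)
  have h3 : normAt e q ≠ 0 := by
    simp only [normAt, ne_eq, div_eq_zero_iff, mul_eq_zero, norm_eq_zero]
    tauto
  exact (((d1.norm ℂ h1).mul (d2.norm ℂ h2)).div ((contDiffAt_const.inner ℂ d1).norm ℝ h0)
    (norm_ne_zero_iff.2 h0)).inv h3

theorem contDiff_applyBilin : ContDiff ℝ ∞ (fun p : (H →L[ℂ] H) × H => p.1 p.2) :=
  (isBoundedBilinearMap_apply (𝕜 := ℂ) (E := H) (F := H)).contDiff.restrict_scalars ℝ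

theorem contDiff_apply_star_apply (e : H) :
    ContDiff ℝ ∞ (fun q : H →L[ℂ] H => q (star q e)) :=
  contDiff_applyBilin.comp (contDiff_id.prodMk (contDiff_star_apply e))

theorem contDiff_star_apply_apply (e : H) :
    ContDiff ℝ ∞ (fun q : H →L[ℂ] H => star q (q e)) :=
  contDiff_applyBilin.comp (contDiff_star.prodMk (contDiff_apply e))

theorem contDiffAt_baseVector {e : H} {q : H →L[ℂ] H} (hq : q ∈ affineTarget e) :
    ContDiffAt ℝ ∞ (baseVector e) q :=
  ((contDiffAt_normAt_inv hq).smul ((contDiff_apply_star_apply e).add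
    (contDiff_star_apply_apply e)).contDiffAt).add
      ((contDiff_apply e).add (contDiff_star_apply e)).contDiffAt

theorem contDiffAt_fibreVector {e : H} {q : H →L[ℂ] H} (hq : q ∈ affineTarget e) :
    ContDiffAt ℝ ∞ (fibreVector e) q :=
  (((contDiffAt_normAt_inv hq).smul ((contDiff_apply_star_apply e).sub
    (contDiff_star_apply_apply e)).contDiffAt).add
      ((contDiff_apply e).sub (contDiff_star_apply e)).contDiffAt).const_smul _

theorem isOpen_cotangentTarget (e : H) : IsOpen (cotangentTarget e) :=
  ContinuousOn.isOpen_inter_preimage (t := {0}ᶜ) (f := fun q => ⟪e, baseVector e q⟫_ℂ)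
    (continuousOn_const.inner fun _ hq =>
      (contDiffAt_baseVector hq).continuousAt.continuousWithinAt)
    (isOpen_affineTarget e) isOpen_compl_singleton

theorem contDiffOn_cotangentCoord (e : H) (he : ⟪e, e⟫_ℂ = 1) :
    ContDiffOn ℝ ∞ (cotangentCoord e he) (cotangentTarget e) := by
  intro q hq
  refine ContDiffAt.contDiffWithinAt ?_
  have h1 := contDiffAt_baseVector hq.1
  have h2 := contDiffAt_fibreVector hq.1
  exact ((contDiff_toPerp e he).contDiffAt.comp q
    (((contDiffAt_const.inner ℂ h1).inv hq.2).smul h1)).prodMk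
    ((contDiff_toPerp e he).contDiffAt.comp q h2)

theorem normAt_rankOne {e ξ η : H} (h1 : ⟪η, e⟫_ℂ ≠ 0) (h2 : ⟪e, ξ⟫_ℂ ≠ 0) :
    normAt e (rankOne ℂ ξ η) = ‖ξ‖ * ‖η‖ := by
  have h1' : ‖⟪η, e⟫_ℂ‖ ≠ 0 := norm_ne_zero_iff.2 h1
  have h2' : ‖⟪e, ξ⟫_ℂ‖ ≠ 0 := norm_ne_zero_iff.2 h2
  rw [normAt, star_rankOne, rankOne_apply, rankOne_apply, norm_smul, norm_smul, inner_smul_right,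
    norm_mul, norm_inner_symm ξ e]
  field_simp

theorem baseVector_rankOne {e ξ η : H} (h1 : ⟪η, e⟫_ℂ ≠ 0) (h2 : ⟪e, ξ⟫_ℂ ≠ 0)
    (hn : ‖ξ‖ = ‖η‖) (h0 : ξ ≠ 0) :
    baseVector e (rankOne ℂ ξ η) = ⟪ξ + η, e⟫_ℂ • (ξ + η) := by
  have hη : (‖η‖ : ℂ) ≠ 0 := by rw [← hn]; simpa using h0
  rw [baseVector, normAt_rankOne h1 h2, star_rankOne]
  simp only [rankOne_apply, inner_smul_right, inner_self_eq_ofReal_sq, inner_add_left, hn,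
    ← Complex.coe_smul]
  push_cast
  match_scalars <;> field_simp <;> ring

theorem fibreVector_rankOne {e ξ η : H} (h1 : ⟪η, e⟫_ℂ ≠ 0) (h2 : ⟪e, ξ⟫_ℂ ≠ 0)
    (hn : ‖ξ‖ = ‖η‖) (h0 : ξ ≠ 0) :
    fibreVector e (rankOne ℂ ξ η) = (2⁻¹ * ⟪ξ + η, e⟫_ℂ) • (ξ - η) := by
  have hη : (‖η‖ : ℂ) ≠ 0 := by rw [← hn]; simpa using h0
  rw [fibreVector, normAt_rankOne h1 h2, star_rankOne]
  simp only [rankOne_apply, inner_smul_right, inner_self_eq_ofReal_sq, inner_add_left, hn,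
    ← Complex.coe_smul]
  push_cast
  match_scalars <;> field_simp <;> ring

/-- For a balanced factorization, the coordinates determine the pair `(X, M)`. -/
theorem cotangentCoord_rankOne {e ξ η : H} (he : ⟪e, e⟫_ℂ = 1) (h1 : ⟪η, e⟫_ℂ ≠ 0)
    (h2 : ⟪e, ξ⟫_ℂ ≠ 0) (hn : ‖ξ‖ = ‖η‖) (h : ⟪η, ξ⟫_ℂ = 1) (hw : ⟪ξ + η, e⟫_ℂ ≠ 0) :
    e + ((cotangentCoord e he (rankOne ℂ ξ η)).1 : H) = (⟪e, ξ + η⟫_ℂ)⁻¹ • (ξ + η) ∧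
    covector e (cotangentCoord e he (rankOne ℂ ξ η)) = (2⁻¹ * ⟪ξ + η, e⟫_ℂ) • (ξ - η) := by
  have h0 : ξ ≠ 0 := fun h0 => h2 (by rw [h0, inner_zero_right])
  have hX : e + ((cotangentCoord e he (rankOne ℂ ξ η)).1 : H) = (⟪e, ξ + η⟫_ℂ)⁻¹ • (ξ + η) := by
    have hw' : ⟪e, ξ + η⟫_ℂ ≠ 0 := by rw [← inner_conj_symm]; exact (map_ne_zero _).2 hw
    rw [cotangentCoord, coe_toPerp, baseVector_rankOne h1 h2 hn h0, smul_smul, inner_smul_right,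
      inner_smul_right, mul_inv_rev, inv_mul_cancel_right₀ hw, inv_mul_cancel₀ hw', one_smul]
    abel
  refine ⟨hX, ?_⟩
  have horth : ⟪ξ + η, ξ - η⟫_ℂ = 0 := by
    have h' : ⟪ξ, η⟫_ℂ = 1 := by rw [← inner_conj_symm, h, map_one]
    simp only [inner_add_left, inner_sub_right, h, h', inner_self_eq_norm_sq_to_K, hn]
    ring
  have hz : ((cotangentCoord e he (rankOne ℂ ξ η)).1 : H) = (⟪e, ξ + η⟫_ℂ)⁻¹ • (ξ + η) - e := by
    rw [← hX]; abel
  have h3 : ⟪(cotangentCoord e he (rankOne ℂ ξ η)).1, (cotangentCoord e he (rankOne ℂ ξ η)).2⟫_ℂ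
      = - ⟪e, (2⁻¹ * ⟪ξ + η, e⟫_ℂ) • (ξ - η)⟫_ℂ := by
    have h4 := inner_add_perp he (cotangentCoord e he (rankOne ℂ ξ η)).1
    rw [hX] at h4
    rw [Submodule.coe_inner, hz, inner_sub_left, inner_perp]
    rw [cotangentCoord, coe_toPerp, fibreVector_rankOne h1 h2 hn h0, inner_sub_right,
      inner_smul_right _ e, h4, inner_smul_left, inner_smul_right, horth]
    ring
  rw [covector, h3, cotangentCoord, coe_toPerp, fibreVector_rankOne h1 h2 hn h0]
  module

/-- The scale of the pair belonging to a balanced factorization is `2 / |⟪ξ + η, e⟫|²`, so that the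
factors are recovered up to a common phase. -/
theorem cotangentParam_eq_of_balanced {e ξ η : H} (he : ⟪e, e⟫_ℂ = 1) (h1 : ⟪η, e⟫_ℂ ≠ 0)
    (h2 : ⟪e, ξ⟫_ℂ ≠ 0) (hn : ‖ξ‖ = ‖η‖) (h : ⟪η, ξ⟫_ℂ = 1) (hw : ⟪ξ + η, e⟫_ℂ ≠ 0) :
    cotangentParam e (cotangentCoord e he (rankOne ℂ ξ η)) = rankOne ℂ ξ η := by
  obtain ⟨hX, hM⟩ := cotangentCoord_rankOne he h1 h2 hn h hw
  have h0 := add_perp_ne_zero he (cotangentCoord e he (rankOne ℂ ξ η)).1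
  rw [cotangentParam, rankOne_balLeft_balRight h0, hX, hM]
  have hw' : ⟪e, ξ + η⟫_ℂ ≠ 0 := by rw [← inner_conj_symm]; exact (map_ne_zero _).2 hw
  have hwn : ‖⟪ξ + η, e⟫_ℂ‖ ≠ 0 := norm_ne_zero_iff.2 hw
  have hu : ‖ξ + η‖ ^ 2 = 2 * ‖ξ‖ ^ 2 + 2 := by
    rw [@norm_add_sq ℂ, ← hn, ← inner_conj_symm, h]
    simp
    ring
  have hv : ‖ξ - η‖ ^ 2 = 2 * ‖ξ‖ ^ 2 - 2 := by
    rw [@norm_sub_sq ℂ, ← hn, ← inner_conj_symm, h]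
    simp
    ring
  have hk : balScale ((⟪e, ξ + η⟫_ℂ)⁻¹ • (ξ + η)) ((2⁻¹ * ⟪ξ + η, e⟫_ℂ) • (ξ - η))
      = 2 / ‖⟪ξ + η, e⟫_ℂ‖ ^ 2 := by
    have h3 : √(1 + ‖(⟪e, ξ + η⟫_ℂ)⁻¹ • (ξ + η)‖ ^ 2
        * ‖(2⁻¹ * ⟪ξ + η, e⟫_ℂ) • (ξ - η)‖ ^ 2) = ‖ξ‖ ^ 2 := by
      rw [Real.sqrt_eq_iff_mul_self_eq (by positivity) (by positivity)]
      simp only [norm_smul, norm_inv, norm_mul, mul_pow, hu, hv, norm_inner_symm e,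
        Complex.norm_ofNat]
      field_simp
      ring
    rw [balScale, h3, norm_smul, norm_inv, mul_pow, hu, norm_inner_symm e]
    have : ‖ξ‖ ^ 2 + 1 ≠ 0 := by positivity
    field_simp
    ring
  rw [hk]
  have hww : ((‖⟪ξ + η, e⟫_ℂ‖ ^ 2 : ℝ) : ℂ) = ⟪ξ + η, e⟫_ℂ * ⟪e, ξ + η⟫_ℂ := by
    rw [← inner_conj_symm e, ← Complex.normSq_eq_norm_sq, Complex.mul_conj]
  have e1 : (⟪e, ξ + η⟫_ℂ)⁻¹ • (ξ + η) + (2 / ‖⟪ξ + η, e⟫_ℂ‖ ^ 2 : ℝ) •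
      (2⁻¹ * ⟪ξ + η, e⟫_ℂ) • (ξ - η) = (2 * (⟪e, ξ + η⟫_ℂ)⁻¹) • ξ := by
    rw [← Complex.coe_smul, Complex.ofReal_div, hww]
    push_cast
    match_scalars <;> field_simp <;> norm_num
  have e2 : (⟪e, ξ + η⟫_ℂ)⁻¹ • (ξ + η) - (2 / ‖⟪ξ + η, e⟫_ℂ‖ ^ 2 : ℝ) •
      (2⁻¹ * ⟪ξ + η, e⟫_ℂ) • (ξ - η) = (2 * (⟪e, ξ + η⟫_ℂ)⁻¹) • η := by
    rw [← Complex.coe_smul, Complex.ofReal_div, hww]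
    push_cast
    match_scalars <;> field_simp <;> norm_num
  rw [e1, e2, ← Complex.coe_smul]
  ext v
  simp only [_root_.smul_apply, rankOne_apply, inner_smul_left, smul_smul, map_mul, map_inv₀,
    inner_conj_symm]
  congr 1
  rw [Complex.ofReal_inv, Complex.ofReal_mul, Complex.ofReal_div, hww, map_ofNat]
  push_cast
  field_simp

theorem norm_balLeft {X M : H} (h : ⟪X, M⟫_ℂ = 0) : ‖balLeft X M‖ = ‖balRight X M‖ := by
  obtain ⟨h1, h2⟩ := inner_balLeft_self h
  exact norm_eq_of_inner_self_eq (h1.trans h2.symm)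

theorem toPerp_covector {e : H} (he : ⟪e, e⟫_ℂ = 1) (p : perp e × perp e) :
    toPerp e he (covector e p) = p.2 := by
  rw [covector, sub_eq_add_neg, ← neg_smul, toPerp_eq]

theorem mem_cotangentTarget_iff {e ξ η : H} (hn : ‖ξ‖ = ‖η‖) :
    rankOne ℂ ξ η ∈ cotangentTarget e ↔
      ⟪η, e⟫_ℂ ≠ 0 ∧ ⟪e, ξ⟫_ℂ ≠ 0 ∧ ⟪ξ + η, e⟫_ℂ ≠ 0 := by
  have h : rankOne ℂ ξ η ∈ affineTarget e ↔ ⟪η, e⟫_ℂ ≠ 0 ∧ ⟪e, ξ⟫_ℂ ≠ 0 := by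
    rw [affineTarget, mem_ofPred_eq, rankOne_apply, inner_smul_right, mul_ne_zero_iff]
  rw [cotangentTarget, mem_inter_iff, h, and_assoc]
  refine and_congr_right fun h1 => and_congr_right fun h2 => ?_
  have h0 : ξ ≠ 0 := fun h0 => h2 (by rw [h0, inner_zero_right])
  rw [mem_ofPred_eq, baseVector_rankOne h1 h2 hn h0, inner_smul_right, mul_ne_zero_iff]
  refine ⟨fun h => h.1, fun h => ⟨h, ?_⟩⟩
  rw [← inner_conj_symm]
  exact (map_ne_zero _).2 h

theorem cotangentCoord_cotangentParam {e : H} (he : ⟪e, e⟫_ℂ = 1) {p : perp e × perp e}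
    (hp : cotangentParam e p ∈ cotangentTarget e) :
    cotangentCoord e he (cotangentParam e p) = p := by
  have hX0 := add_perp_ne_zero he p.1
  have horth := inner_covector he p
  have hn := norm_balLeft horth
  rw [cotangentParam, mem_cotangentTarget_iff hn] at hp
  obtain ⟨h1, h2, h3⟩ := hp
  obtain ⟨c1, c2⟩ := cotangentCoord_rankOne he h1 h2 hn (inner_balRight_balLeft hX0 horth) h3
  rw [← cotangentParam] at c1 c2
  have hadd : balLeft (e + (p.1 : H)) (covector e p) + balRight (e + (p.1 : H)) (covector e p)
      = ((2 * balNorm (e + (p.1 : H)) (covector e p) : ℝ) : ℂ) • (e + (p.1 : H)) := by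
    rw [balLeft, balRight, Complex.coe_smul]
    module
  have hsub : balLeft (e + (p.1 : H)) (covector e p) - balRight (e + (p.1 : H)) (covector e p)
      = ((2 * (balNorm (e + (p.1 : H)) (covector e p) *
        balScale (e + (p.1 : H)) (covector e p)) : ℝ) : ℂ) • covector e p := by
    rw [balLeft, balRight, Complex.coe_smul]
    module
  have hc := balNorm_mul_self hX0 (covector e p)
  have hc' : ((balNorm (e + (p.1 : H)) (covector e p) : ℝ) : ℂ) ≠ 0 := fun h => by
    simp [Complex.ofReal_eq_zero.1 h] at hc
  have hXe' : ⟪e, e + (p.1 : H)⟫_ℂ = 1 := by rw [inner_add_right, he, inner_perp, add_zero]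
  rw [hadd, inner_smul_right, hXe', smul_smul, mul_one, inv_mul_cancel₀ (by simpa using hc'),
    one_smul] at c1
  rw [hadd, hsub, inner_smul_left, inner_add_perp he, Complex.conj_ofReal, smul_smul,
    mul_one] at c2
  have hone : (2⁻¹ : ℂ) * ((2 * balNorm (e + (p.1 : H)) (covector e p) : ℝ) : ℂ)
      * ((2 * (balNorm (e + (p.1 : H)) (covector e p) *
        balScale (e + (p.1 : H)) (covector e p)) : ℝ) : ℂ) = 1 := by
    have hc2 := congrArg ((↑) : ℝ → ℂ) hc
    push_cast at hc2 ⊢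
    linear_combination hc2
  rw [hone, one_smul] at c2
  refine Prod.ext (Subtype.ext (add_left_cancel c1)) ?_
  rw [← toPerp_covector he, c2, toPerp_covector he]

theorem cotangentParam_cotangentCoord {e : H} (he : ⟪e, e⟫_ℂ = 1) {q : H →L[ℂ] H}
    (hq : q ∈ projections H) (hqe : q ∈ cotangentTarget e) :
    cotangentParam e (cotangentCoord e he q) = q := by
  obtain ⟨ξ, η, h, rfl, hξ, hη⟩ := exists_eq_rankOne_balanced hq
  have hn := norm_eq_of_inner_self_eq (hξ.trans hη.symm)
  obtain ⟨h1, h2, h3⟩ := (mem_cotangentTarget_iff hn).1 hqe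
  exact cotangentParam_eq_of_balanced he h1 h2 hn h h3

theorem isLocalParam_cotangentParam (e : H) (he : ⟪e, e⟫_ℂ = 1) :
    IsLocalParam (projections H) tangent
      (univ ∩ cotangentParam e ⁻¹' cotangentTarget e) (cotangentParam e) :=
  isLocalParam_of_inverse isOpen_univ (contDiff_cotangentParam he).contDiffOn
    (isOpen_cotangentTarget e) (contDiffOn_cotangentCoord e he)
    (fun p _ => rankOne_mem_projections
      (inner_balRight_balLeft (add_perp_ne_zero he p.1) (inner_covector he p)))
    (fun _ _ hp => cotangentCoord_cotangentParam he hp)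
    fun _ hq hqe => ⟨mem_univ _, cotangentParam_cotangentCoord he hq hqe⟩

theorem exists_cotangentParam {q : H →L[ℂ] H} (hq : q ∈ projections H) :
    ∃ e : H, ⟪e, e⟫_ℂ = 1 ∧
      q ∈ cotangentParam e '' (univ ∩ cotangentParam e ⁻¹' cotangentTarget e) := by
  obtain ⟨ξ, η, h, rfl, hξ, hη⟩ := exists_eq_rankOne_balanced hq
  have hn := norm_eq_of_inner_self_eq (hξ.trans hη.symm)
  have h' : ⟪ξ, η⟫_ℂ = 1 := by rw [← inner_conj_symm, h, map_one]
  have hs : (‖ξ‖ : ℂ) ^ 2 + 1 ≠ 0 := by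
    have : ‖ξ‖ ^ 2 + 1 ≠ 0 := by positivity
    exact_mod_cast this
  have h1 : ⟪η, ξ + η⟫_ℂ = ‖ξ‖ ^ 2 + 1 := by
    rw [inner_add_right, h, inner_self_eq_ofReal_sq, hn, add_comm]
  have h2 : ⟪ξ + η, ξ⟫_ℂ = ‖ξ‖ ^ 2 + 1 := by
    rw [inner_add_left, h, inner_self_eq_ofReal_sq]
  have hu : ξ + η ≠ 0 := fun h0 => hs (by rw [← h2, h0, inner_zero_left])
  have hu' : (‖ξ + η‖ : ℂ) ≠ 0 := by simpa using hu
  have he : ⟪(‖ξ + η‖⁻¹ : ℂ) • (ξ + η), (‖ξ + η‖⁻¹ : ℂ) • (ξ + η)⟫_ℂ = 1 := by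
    rw [inner_smul_left, inner_smul_right, inner_self_eq_ofReal_sq, map_inv₀, Complex.conj_ofReal]
    field_simp
  have hmem : rankOne ℂ ξ η ∈ cotangentTarget ((‖ξ + η‖⁻¹ : ℂ) • (ξ + η)) := by
    rw [mem_cotangentTarget_iff hn, inner_smul_right, inner_smul_right, inner_smul_left, h1, h2,
      inner_self_eq_ofReal_sq, map_inv₀, Complex.conj_ofReal]
    exact ⟨mul_ne_zero (inv_ne_zero hu') hs, mul_ne_zero (inv_ne_zero hu') hs,
      mul_ne_zero (inv_ne_zero hu') (pow_ne_zero 2 hu')⟩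
  have hinv := cotangentParam_cotangentCoord he hq hmem
  exact ⟨_, he, cotangentCoord _ he _, ⟨mem_univ _, by rwa [mem_preimage, hinv]⟩, hinv⟩

/-- `𝐉² = -1`, read off in the cotangent chart. -/
theorem strJJ_strJJ {q A : H →L[ℂ] H} (hq : q ∈ projections H) (hA : A ∈ tangent q) :
    strJJ q (strJJ q A) = -A := by
  obtain ⟨e, he, p, hp, rfl⟩ := exists_cotangentParam hq
  obtain ⟨v, rfl⟩ : A ∈ range (fderiv ℝ (cotangentParam e) p) := by
    rw [(isLocalParam_cotangentParam e he).range_fderiv p hp]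
    exact hA
  rw [← fderiv_cotangentParam_conj he, ← fderiv_cotangentParam_conj he, ← map_neg]
  congr 1
  ext <;> simp [smul_smul]

/-- The antilinear identification of the first factor with the dual space. -/
noncomputable def conjFst (K : Type u) [NormedAddCommGroup K] [InnerProductSpace ℂ K]
    [CompleteSpace K] : (StrongDual ℂ K × K) ≃L[ℝ] (K × K) :=
  (dualEquivReal K).prodCongr (ContinuousLinearEquiv.refl ℝ K)

theorem conjFst_I_smul {K : Type u} [NormedAddCommGroup K] [InnerProductSpace ℂ K]
    [CompleteSpace K] (p : StrongDual ℂ K × K) :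
    conjFst K (Complex.I • p) = (-(Complex.I • (conjFst K p).1), Complex.I • (conjFst K p).2) :=
  Prod.ext (dualEquivReal_I_smul p.1) rfl

theorem isIntegrable_strJJ : IsIntegrableAlmostComplex (projections H) tangent strJJ := by
  refine ⟨isAlmostComplex_strJJ fun q hq A hA => strJJ_strJJ hq hA, fun q hq => ?_⟩
  obtain ⟨e, he, hmem⟩ := exists_cotangentParam hq
  refine ⟨StrongDual ℂ (perp e) × perp e, inferInstance, inferInstance, _, _,
    (isLocalParam_cotangentParam e he).isHolParam_comp (conjFst (perp e)) fun p hp v => ?_, ?_⟩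
  · rw [conjFst_I_smul]
    exact fderiv_cotangentParam_conj he p _
  · rwa [image_comp, image_preimage_eq _ (conjFst (perp e)).surjective]

/-! ### The hyperkähler structure -/

theorem isHyperkahler_metric :
    IsHyperkahler (projections H) tangent metric strI strJJ where
  metric := isRiemannianMetric_metric
  almostComplex₁ := isAlmostComplex_strI
  almostComplex₂ := isIntegrable_strJJ.1
  anticomm q hq A _ := by rw [strI, strI, strJJ_smul hq, Complex.conj_I, neg_smul, neg_neg]
  closed₁ := isClosedTwoForm_metric_strI
  closed₂ := isClosedTwoForm_metric_strJJ
  closed₃ := isClosedTwoForm_metric_strI_strJJ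

theorem strI_strJ (q A : H →L[ℂ] H) : strI q (strJ q A) = strJ q (strI q A) := by
  simp only [strI, strJ, RankOne.comm, smul_mul_assoc, mul_smul_comm, ← smul_sub]

end RankOne

theorem proposition1 (H : Type u) [NormedAddCommGroup H] [InnerProductSpace ℂ H]
    [CompleteSpace H] :
    -- the identification of the cotangent bundle of projective space with rank-one projections
    (∃ Φ : RankOne.projections H ≃ RankOne.Cotangent H, ∀ q : RankOne.projections H,
      LinearMap.range (((Φ q).1 : H →L[ℂ] H) : H →ₗ[ℂ] H)
        = LinearMap.range ((q : H →L[ℂ] H) : H →ₗ[ℂ] H) ∧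
      ∀ A : RankOne.projTangent ((Φ q).1 : H →L[ℂ] H),
        (Φ q).2 A = (RankOne.tr (((q : H →L[ℂ] H) - ((Φ q).1 : H →L[ℂ] H)) * (A : H →L[ℂ] H))).re)
    ∧ (0 : H →L[ℂ] H) ∉ RankOne.projections H
    -- the Hilbert–Schmidt norm and the trace-class norm agree on rank-one projections
    ∧ (∀ q ∈ RankOne.projections H, RankOne.hsNorm q = RankOne.traceNorm q)
    -- the hyperkähler structure
    ∧ EmbGeom.IsHyperkahler (RankOne.projections H) RankOne.tangent RankOne.metric
        RankOne.strI RankOne.strJJ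
    ∧ EmbGeom.IsIntegrableAlmostComplex (RankOne.projections H) RankOne.tangent RankOne.strI
    ∧ EmbGeom.IsIntegrableAlmostComplex (RankOne.projections H) RankOne.tangent RankOne.strJJ
    -- the Hilbert–Schmidt norm is a Kähler potential
    ∧ EmbGeom.IsKahlerPotential (RankOne.projections H) RankOne.tangent RankOne.metric
        RankOne.strI RankOne.hsNorm
    -- the holomorphic symplectic form
    ∧ EmbGeom.IsHolomorphicSymplectic (RankOne.projections H) RankOne.tangent RankOne.strI
        RankOne.Omega
    -- the equation `h(𝐉A, B) = Ω(A, B)` holds, and it determines `𝐉A`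
    ∧ (∀ q ∈ RankOne.projections H, ∀ A ∈ RankOne.tangent q, ∀ C ∈ RankOne.tangent q,
        (∀ B ∈ RankOne.tangent q, RankOne.herm q C B = RankOne.Omega q A B)
          ↔ C = RankOne.strJJ q A)
    -- the integrable almost complex structure `J`, which commutes with `I` and preserves `Ω`
    ∧ EmbGeom.IsIntegrableAlmostComplex (RankOne.projections H) RankOne.tangent RankOne.strJ
    ∧ (∀ q ∈ RankOne.projections H, ∀ A ∈ RankOne.tangent q,
        RankOne.strI q (RankOne.strJ q A) = RankOne.strJ q (RankOne.strI q A))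
    ∧ (∀ q ∈ RankOne.projections H, ∀ A ∈ RankOne.tangent q, ∀ B ∈ RankOne.tangent q,
        RankOne.Omega q (RankOne.strJ q A) (RankOne.strJ q B) = RankOne.Omega q A B) := by
  exact ⟨⟨RankOne.cotangentEquiv,
      fun q => ⟨RankOne.range_imageProj q.2, RankOne.toCotangent_apply q⟩⟩,
    RankOne.zero_notMem_projections, fun q hq => RankOne.hsNorm_eq_traceNorm hq,
    RankOne.isHyperkahler_metric, RankOne.isIntegrable_strI, RankOne.isIntegrable_strJJ,
    RankOne.isKahlerPotential_hsNorm,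
    RankOne.isHolomorphicSymplectic_Omega fun q hq A hA => RankOne.strJJ_strJJ hq hA,
    fun q hq A hA C hC => RankOne.herm_eq_Omega_iff hq hA hC, RankOne.isIntegrable_strJ,
    fun q _ A _ => RankOne.strI_strJ q A, fun q hq A hA B hB => RankOne.Omega_strJ hq hA hB⟩
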